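/- **One-atom maser.** Fix $E,E_0,\tau>0$, $\lambda\in\mathbb R\setminus\{0\}$ and $\beta\in\mathbb R$. Let $\mathfrak h_S=\ell^2(\mathbb N)$ (with $0\in\mathbb N$) be the bosonic Fock space of one field mode, with number states $|n\rangle$, annihilation operator $a$, number operator $N=a^*a$ and Hamiltonian $h_S=EN$, and let $\mathfrak h_{\mathcal E}=\mathbb C^2$ be the space of a two-level atom with lowering operator $b$, Hamiltonian $h_{\mathcal E}=E_0b^*b$ and thermal state $\rho_{\mathcal E,\beta}=e^{-\beta h_{\mathcal E}}/\mathrm{Tr}\,e^{-\beta h_{\mathcal E}}$. Let $$h=h_S\otimes 1+1\otimes h_{\mathcal E}+\tfrac{\lambda}{2}(a^*\otimes b+a\otimes b^*)$$ be the Jaynes–Cummings Hamiltonian and $\mathcal L_\beta(\rho)=\mathrm{Tr}_{\mathfrak h_{\mathcal E}}\big[e^{-i\tau h}(\rho\otimes\rho_{\mathcal E,\beta})e^{i\tau h}\big]$ the reduced dynamics map. *States.* A state is a positive operator $\rho$ on $\mathfrak h_S$ with $\mathrm{Tr}\,\rho=1$; write $\rho(A)=\mathrm{Tr}(\rho A)$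 for bounded $A$, and let $s(\rho)$ be the orthogonal projection onto $\overline{\mathrm{Ran}\,\rho}$. A state $\rho$ is *invariant* if $\mathcal L_\beta(\rho)=\rho$. It is *ergodic* if $\lim_{M\to\infty}\frac1M\sum_{n=1}^M(\mathcal L_\beta^n\mu)(A)=\rho(A)$ for all bounded $A$ and all states $\mu$ with $s(\mu)\le s(\rho)$. It is *exponentially mixing* if there is $\alpha>0$ such that for all such $A,\mu$ there is a constant $C_{A,\mu}$ with $|(\mathcal L_\beta^n\mu)(A)-\rho(A)|\le C_{A,\mu}e^{-\alpha n}$ for all $n\ge 0$. *Resonances.* Let $\eta=\big(\frac{(E-E_0)\tau}{2\pi}\big)^2$, $\xi=\big(\frac{\lambda\tau}{2\pi}\big)^2$ and let $R$ be the set of Rabi resonances, i.e. of the integers $n\ge1$ such that $\xi n+\eta=k^2$ for some $k\in\mathbb N$. The system is *non-resonant*, *simply resonant*, or *fully resonant* if $R$ is empty, has exactly one element, or is infinite, respectively. It is *degenerate* if it is fully resonant and there are $n\in\{0\}\cup R$ and $m\in R$ with $n<m$ and $n+1,m+1\in R$; otherwise it is *non-degenerate*. Let $n_1<n_2<\cdots$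 be the elements of $R$, $n_0=0$, and let $I_k=\{n_{k-1},\dots,n_k-1\}$, $k=1,2,\dots$ (with $n_k=\infty$ if $R$ has exactly $k-1$ elements) be the resulting partition of $\mathbb N$. The $k$-th Rabi sector is $\ell^2(I_k)$, with orthogonal projection $P_k$. Put $\beta^*=\beta E_0/E$ and $$\rho_{\beta^*}=\frac{e^{-\beta^*h_S}}{\mathrm{Tr}\,e^{-\beta^*h_S}},\qquad \rho^{(k)}_{\beta^*}=\frac{e^{-\beta^*h_S}P_k}{\mathrm{Tr}(e^{-\beta^*h_S}P_k)}$$ whenever the trace in question is finite. **Theorem.** 1. If the system is non-resonant and $\beta\le0$, then $\mathcal L_\beta$ has no invariant state. If it is non-resonant and $\beta>0$, then $\rho_{\beta^*}$ is the unique ergodic state, and $\lim_{M\to\infty}\frac1M\sum_{n=1}^M(\mathcal L_\beta^n\rho)(A)=\rho_{\beta^*}(A)$ for every state $\rho$ and every bounded $A$. 2. If the system is simply resonant and $\beta\le0$, then $\rho^{(1)}_{\beta^*}$ is the unique ergodic state. If it is simply resonant and $\beta>0$, then there are exactly two ergodic states, $\rho^{(1)}_{\beta^*}$ and $\rho^{(2)}_{\beta^*}$,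 and for every state $\rho$ and every bounded $A$ $$\lim_{M\to\infty}\frac1M\sum_{n=1}^M(\mathcal L_\beta^n\rho)(A)=\rho(P_1)\,\rho^{(1)}_{\beta^*}(A)+\rho(P_2)\,\rho^{(2)}_{\beta^*}(A).$$ 3. If the system is fully resonant, then for every $\beta\in\mathbb R$ the states $\rho^{(k)}_{\beta^*}$, $k=1,2,\dots$, are pairwise different and ergodic. If moreover it is non-degenerate, then for every state $\rho$ and every bounded $A$ $$\lim_{M\to\infty}\frac1M\sum_{n=1}^M(\mathcal L_\beta^n\rho)(A)=\sum_{k=1}^\infty\rho(P_k)\,\rho^{(k)}_{\beta^*}(A),$$ where the series converges absolutely. 4. If the system is non-degenerate, then every invariant state is diagonal in the basis $(|n\rangle)$ and is a finite or countable convex combination $\sum_k c_k\,\rho^{(k)}_{\beta^*}$ (convergent in operator norm) of ergodic states $\rho^{(k)}_{\beta^*}$. 5. Whenever the state $\rho^{(k)}_{\beta^*}$ is ergodic and the Rabi sector $\ell^2(I_k)$ is finite-dimensional, $\rho^{(k)}_{\beta^*}$ is exponentially mixing. -/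

import Mathlib

open scoped TensorProduct InnerProductSpace ComplexOrder

noncomputable section

namespace OneAtomMaser

/-! ### Hilbert spaces -/

/-- The space `ℓ²(ι)`. -/
abbrev Ell2 (ι : Type) : Type := lp (fun _ : ι => ℂ) 2

/-- The Hilbert space of the cavity field, `ℓ²(ℕ)`; the `n`-th coordinate is the amplitude of
the state with `n` photons. -/
abbrev Field : Type := Ell2 ℕ

/-- The Hilbert space of field and atom, `ℓ²(ℕ) ⊗ ℂ² = ℓ²(ℕ × {0,1})`; the index `(n, σ)` stands
for `|n⟩ ⊗ |σ⟩`, where `σ = 0` is the ground state and `σ = 1` the excited state of the atom. -/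
abbrev Joint : Type := Ell2 (ℕ × Fin 2)

/-- The canonical orthonormal basis vector `|i⟩` of `ℓ²(ι)`. -/
def ket {ι : Type} [DecidableEq ι] (i : ι) : Ell2 ι := lp.single 2 i (1 : ℂ)

theorem inner_ket {ι : Type} [DecidableEq ι] (i j : ι) :
    ⟪ket i, ket j⟫_ℂ = if i = j then 1 else 0 := by
  unfold ket
  rw [lp.inner_single_left]
  by_cases h : i = j
  · subst h; simp
  · simp [lp.single_apply, h]

theorem orthonormal_ket {ι : Type} [DecidableEq ι] : Orthonormal ℂ (ket : ι → Ell2 ι) :=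
  orthonormal_iff_ite.mpr inner_ket

/-- The isometry of `ℓ²(ι)` that maps `|i⟩` to `v i`, for an orthonormal family `v`. -/
def isometryOf {ι : Type} {F : Type} [NormedAddCommGroup F] [InnerProductSpace ℂ F]
    [CompleteSpace F] (v : ι → F) (hv : Orthonormal ℂ v) : Ell2 ι →ₗᵢ[ℂ] F :=
  hv.orthogonalFamily.linearIsometry

theorem isometryOf_ket {ι : Type} [DecidableEq ι] {F : Type} [NormedAddCommGroup F]
    [InnerProductSpace ℂ F] [CompleteSpace F] (v : ι → F) (hv : Orthonormal ℂ v) (i : ι) :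
    isometryOf v hv (ket i) = v i := by
  unfold isometryOf ket
  rw [OrthogonalFamily.linearIsometry_apply_single]
  simp

theorem memlp_mul {ι : Type} {f : ι → ℂ} {C : ℝ} (hC : ∀ i, ‖f i‖ ≤ C) (x : Ell2 ι) :
    Memℓp (fun i => f i * x i) 2 := by
  refine (((lp.memℓp x).norm.const_mul C)).mono (fun i => ?_)
  simp only [norm_mul]
  exact mul_le_mul_of_nonneg_right (hC i) (norm_nonneg _)

/-- The diagonal operator `∑ₙ f(n) |n⟩⟨n|`, i.e. `f(N)`, for a bounded function `f`. -/
def diagOp (f : ℕ → ℂ) (hf : ∃ C : ℝ, ∀ n, ‖f n‖ ≤ C) : Field →L[ℂ] Field :=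
  LinearMap.mkContinuousOfExistsBound
    { toFun := fun x => ⟨fun n => f n * x n, memlp_mul hf.choose_spec x⟩
      map_add' := fun x y => by ext n; exact mul_add (f n) (x n) (y n)
      map_smul' := fun c x => by ext n; exact mul_left_comm (f n) c (x n) }
    (by
      obtain ⟨C, hC⟩ := hf
      refine ⟨‖(C : ℂ)‖, fun x => ?_⟩
      rw [← norm_smul]
      refine lp.norm_mono (by norm_num) (fun n => ?_)
      change ‖f n * x n‖ ≤ ‖(C : ℂ) * x n‖
      rw [norm_mul, norm_mul]
      refine mul_le_mul_of_nonneg_right ((hC n).trans ?_) (norm_nonneg _)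
      simpa using le_abs_self C)

theorem diagOp_apply (f : ℕ → ℂ) (hf : ∃ C : ℝ, ∀ n, ‖f n‖ ≤ C) (x : Field) (n : ℕ) :
    diagOp f hf x n = f n * x n := rfl

/-! ### The Jaynes-Cummings Hamiltonian -/

/-- The parameters of the one-atom maser: frequency `E` of the field mode, energy `E₀` of the
excited state of the atom, coupling constant `coupling` (usually written `λ`), and duration `τ` of
each interaction. -/
structure Maser where
  E : ℝ
  E₀ : ℝ
  coupling : ℝ
  τ : ℝ

/-- The field annihilation operator on finite combinations of number states:
`a|n⟩ = √n |n-1⟩`. -/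
def annihilate : Module.End ℂ (ℕ →₀ ℂ) :=
  Finsupp.linearCombination ℂ (fun n : ℕ => Finsupp.single (n - 1) ((√(n : ℝ) : ℝ) : ℂ))

/-- The field creation operator on finite combinations of number states:
`a*|n⟩ = √(n+1) |n+1⟩`. -/
def create : Module.End ℂ (ℕ →₀ ℂ) :=
  Finsupp.linearCombination ℂ (fun n : ℕ => Finsupp.single (n + 1) ((√((n : ℝ) + 1) : ℝ) : ℂ))

/-- The atomic annihilation operator `b`, with `b|1⟩ = |0⟩` and `b|0⟩ = 0`. -/
def lower : Matrix (Fin 2) (Fin 2) ℂ := !![0, 1; 0, 0]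

/-- The atomic creation operator `b*`. -/
def raise : Matrix (Fin 2) (Fin 2) ℂ := !![0, 0; 1, 0]

/-- The dense subspace of finite combinations of the vectors `|n⟩ ⊗ |σ⟩`. -/
abbrev Core : Type := (ℕ →₀ ℂ) ⊗[ℂ] (Fin 2 → ℂ)

/-- The inclusion of the dense subspace into the Hilbert space of field and atom. -/
def incl : Core →ₗ[ℂ] Joint :=
  TensorProduct.lift (Finsupp.linearCombination ℂ
    (fun n : ℕ => Fintype.linearCombination ℂ (fun σ : Fin 2 => (ket (n, σ) : Joint))))

theorem incl_tmul (n : ℕ) (c : ℂ) (g : Fin 2 → ℂ) :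
    incl (Finsupp.single n c ⊗ₜ[ℂ] g) =
      (c * g 0) • (ket (n, 0) : Joint) + (c * g 1) • (ket (n, 1) : Joint) := by
  simp [incl, Fintype.linearCombination_apply, smul_smul]

namespace Maser

variable (M : Maser)

/-- The Hamiltonian `h_E = E₀ b* b` of the atom. -/
def atomHamiltonian : Matrix (Fin 2) (Fin 2) ℂ := (M.E₀ : ℂ) • (raise * lower)

/-- The Jaynes-Cummings Hamiltonian
`h = E a*a ⊗ 1 + 1 ⊗ h_E + (λ/2) (a* ⊗ b + a ⊗ b*)` on finite combinations of the `|n⟩ ⊗ |σ⟩`. -/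
def hamiltonian : Module.End ℂ Core :=
  (M.E : ℂ) • TensorProduct.map (create ∘ₗ annihilate) LinearMap.id
    + TensorProduct.map LinearMap.id (Matrix.toLin' M.atomHamiltonian)
    + ((M.coupling / 2 : ℝ) : ℂ) •
      (TensorProduct.map create (Matrix.toLin' lower)
        + TensorProduct.map annihilate (Matrix.toLin' raise))

/-- The matrix of the Hamiltonian on its invariant subspace spanned by `|n+1⟩ ⊗ |0⟩` and
`|n⟩ ⊗ |1⟩` (see `incl_hamiltonian_excited` and `incl_hamiltonian_ground`). -/
def block (n : ℕ) : Matrix (Fin 2) (Fin 2) ℂ :=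
  !![((M.E * (n + 1) : ℝ) : ℂ), ((M.coupling / 2 * √((n : ℝ) + 1) : ℝ) : ℂ);
     ((M.coupling / 2 * √((n : ℝ) + 1) : ℝ) : ℂ), ((M.E * n + M.E₀ : ℝ) : ℂ)]

/-- `-i h` on that subspace. -/
def generatorBlock (n : ℕ) : Matrix (Fin 2) (Fin 2) ℂ := (-Complex.I) • M.block n

/-- `exp(-i t h)` on that subspace. -/
def propagatorBlock (t : ℝ) (n : ℕ) : Matrix (Fin 2) (Fin 2) ℂ :=
  NormedSpace.exp (t • M.generatorBlock n)

/-- The images `exp(-i t h) |n⟩ ⊗ |σ⟩` of the basis vectors. -/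
def evolvedKet (t : ℝ) : ℕ × Fin 2 → Joint
  | (0, 0) => ket (0, 0)
  | (n + 1, 0) => M.propagatorBlock t n 0 0 • ket (n + 1, 0)
      + M.propagatorBlock t n 1 0 • ket (n, 1)
  | (n, 1) => M.propagatorBlock t n 0 1 • ket (n + 1, 0)
      + M.propagatorBlock t n 1 1 • ket (n, 1)

theorem incl_hamiltonian_zero :
    incl (M.hamiltonian (Finsupp.single 0 1 ⊗ₜ[ℂ] Pi.single 0 1)) = 0 := by
  simp [hamiltonian, atomHamiltonian, annihilate, create, lower, raise, incl_tmul,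
    Matrix.toLin'_apply]

theorem incl_hamiltonian_ground (n : ℕ) :
    incl (M.hamiltonian (Finsupp.single (n + 1) 1 ⊗ₜ[ℂ] Pi.single 0 1)) =
      M.block n 0 0 • ket (n + 1, 0) + M.block n 1 0 • ket (n, 1) := by
  have hN : create (annihilate (Finsupp.single (n + 1) 1))
      = Finsupp.single (n + 1) ((n : ℂ) + 1) := by
    have h : ((√((n : ℝ) + 1) : ℝ) : ℂ) * ((√((n : ℝ) + 1) : ℝ) : ℂ) = (n : ℂ) + 1 := by
      rw [← Complex.ofReal_mul, Real.mul_self_sqrt (by positivity)]; simp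
    simp [annihilate, create, -Finsupp.single_mul, h]
  have ha : annihilate (Finsupp.single (n + 1) 1)
      = Finsupp.single n ((√((n : ℝ) + 1) : ℝ) : ℂ) := by simp [annihilate]
  simp only [hamiltonian, LinearMap.add_apply, LinearMap.smul_apply, TensorProduct.map_tmul,
    LinearMap.comp_apply, hN, LinearMap.id_apply, map_add, map_smul, Matrix.toLin'_apply,
    incl_tmul]
  rw [ha]
  simp [create, atomHamiltonian, lower, raise, incl_tmul, block]
  module

theorem incl_hamiltonian_excited (n : ℕ) :
    incl (M.hamiltonian (Finsupp.single n 1 ⊗ₜ[ℂ] Pi.single 1 1)) =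
      M.block n 0 1 • ket (n + 1, 0) + M.block n 1 1 • ket (n, 1) := by
  have hN : create (annihilate (Finsupp.single n 1)) = Finsupp.single n (n : ℂ) := by
    cases n with
    | zero => simp [annihilate, create]
    | succ n =>
      have h : ((√((n : ℝ) + 1) : ℝ) : ℂ) * ((√((n : ℝ) + 1) : ℝ) : ℂ) = (n : ℂ) + 1 := by
        rw [← Complex.ofReal_mul, Real.mul_self_sqrt (by positivity)]; simp
      simp [annihilate, create, -Finsupp.single_mul, h]
  have ha : create (Finsupp.single n 1)
      = Finsupp.single (n + 1) ((√((n : ℝ) + 1) : ℝ) : ℂ) := by simp [create]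
  simp only [hamiltonian, LinearMap.add_apply, LinearMap.smul_apply, TensorProduct.map_tmul,
    LinearMap.comp_apply, hN, ha, LinearMap.id_apply, map_add, map_smul, Matrix.toLin'_apply]
  simp [annihilate, atomHamiltonian, lower, raise, incl_tmul, block, smul_smul, add_smul]
  module

theorem block_conjTranspose (n : ℕ) : (M.block n).conjTranspose = M.block n := by
  ext i j
  fin_cases i <;> fin_cases j <;> simp [block]

theorem propagatorBlock_zero (n : ℕ) : M.propagatorBlock 0 n = 1 := by
  simp [propagatorBlock]

theorem propagatorBlock_add (s t : ℝ) (n : ℕ) :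
    M.propagatorBlock (s + t) n = M.propagatorBlock s n * M.propagatorBlock t n := by
  unfold propagatorBlock
  rw [add_smul]
  exact Matrix.exp_add_of_commute _ _ (((Commute.refl _).smul_left s).smul_right t)

theorem propagatorBlock_conjTranspose (t : ℝ) (n : ℕ) :
    (M.propagatorBlock t n).conjTranspose = M.propagatorBlock (-t) n := by
  unfold propagatorBlock generatorBlock
  rw [← Matrix.exp_conjTranspose]
  congr 1
  rw [Matrix.conjTranspose_smul, Matrix.conjTranspose_smul, block_conjTranspose]
  simp

theorem propagatorBlock_unitary (t : ℝ) (n : ℕ) :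
    (M.propagatorBlock t n).conjTranspose * M.propagatorBlock t n = 1 := by
  rw [propagatorBlock_conjTranspose, ← propagatorBlock_add, neg_add_cancel, propagatorBlock_zero]

theorem hasDerivAt_propagatorBlock (t : ℝ) (n : ℕ) (i j : Fin 2) :
    HasDerivAt (fun s : ℝ => M.propagatorBlock s n i j)
      ((M.propagatorBlock t n * M.generatorBlock n) i j) t := by
  let _ : NormedRing (Matrix (Fin 2) (Fin 2) ℂ) := Matrix.linftyOpNormedRing
  let _ : NormedAlgebra ℝ (Matrix (Fin 2) (Fin 2) ℂ) := Matrix.linftyOpNormedAlgebra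
  have h : HasDerivAt (fun s : ℝ => M.propagatorBlock s n)
      (M.propagatorBlock t n * M.generatorBlock n) t :=
    hasDerivAt_exp_smul_const (𝕂 := ℝ) (M.generatorBlock n) t
  have h1 := hasDerivAt_pi.mp h i
  exact hasDerivAt_pi.mp h1 j

theorem orthonormal_evolvedKet (t : ℝ) : Orthonormal ℂ (M.evolvedKet t) := by
  have key : ∀ n i j, starRingEnd ℂ (M.propagatorBlock t n 0 i) * M.propagatorBlock t n 0 j
      + starRingEnd ℂ (M.propagatorBlock t n 1 i) * M.propagatorBlock t n 1 j
      = if i = j then 1 else 0 := by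
    intro n i j
    have := congrFun (congrFun (M.propagatorBlock_unitary t n) i) j
    simpa [Matrix.mul_apply, Fin.sum_univ_two, Matrix.one_apply] using this
  rw [orthonormal_iff_ite]
  have h00 : M.evolvedKet t (0, 0) = ket (0, 0) := rfl
  have hs0 : ∀ n, M.evolvedKet t (n + 1, 0) = M.propagatorBlock t n 0 0 • ket (n + 1, 0)
      + M.propagatorBlock t n 1 0 • ket (n, 1) := fun _ => rfl
  have hs1 : ∀ n, M.evolvedKet t (n, 1) = M.propagatorBlock t n 0 1 • ket (n + 1, 0)
      + M.propagatorBlock t n 1 1 • ket (n, 1) := by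
    intro n; cases n <;> rfl
  have k00 := fun n => key n 0 0
  have k01 := fun n => key n 0 1
  have k10 := fun n => key n 1 0
  have k11 := fun n => key n 1 1
  simp only [Fin.isValue, reduceIte, zero_ne_one, one_ne_zero] at k00 k01 k10 k11
  rintro ⟨n, σ⟩ ⟨m, σ'⟩
  fin_cases σ <;> fin_cases σ'
  · rcases n with _ | n
    · rcases m with _ | m
      · simp [h00, orthonormal_ket.1]
      · simp [h00, hs0, inner_add_right, inner_smul_right, inner_ket]
    rcases m with _ | m
    · simp [h00, hs0, inner_add_left, inner_smul_left, inner_ket]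
    simp [hs0, inner_add_left, inner_add_right, inner_smul_left, inner_smul_right, inner_ket]
    by_cases h : n = m
    · subst h; simpa [mul_comm] using k00 n
    · simp [h]
  · rcases n with _ | n <;>
      simp [h00, hs0, hs1, inner_add_left, inner_add_right, inner_smul_left, inner_smul_right,
        inner_ket]
    by_cases h : n = m
    · subst h; simpa [mul_comm] using k01 n
    · simp [h]
  · rcases m with _ | m <;>
      simp [h00, hs0, hs1, inner_add_left, inner_add_right, inner_smul_left, inner_smul_right,
        inner_ket]
    by_cases h : n = m
    · subst h; simpa [mul_comm] using k10 n
    · simp [h]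
  · simp [hs1, inner_add_left, inner_add_right, inner_smul_left, inner_smul_right,
        inner_ket]
    by_cases h : n = m
    · subst h; simpa [mul_comm] using k11 n
    · simp [h]

/-- The propagator `exp(-i t h)` of the Jaynes-Cummings Hamiltonian, as an isometry of the Hilbert
space. By `propagator_zero`, `propagator_add`, `adjoint_propagator` and `hasDerivAt_propagator`, it
is a unitary group whose generator extends `-i h`. -/
def propagator (t : ℝ) : Joint →L[ℂ] Joint :=
  (isometryOf (M.evolvedKet t) (M.orthonormal_evolvedKet t)).toContinuousLinearMap

theorem propagator_ket (t : ℝ) (p : ℕ × Fin 2) :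
    M.propagator t (ket p) = M.evolvedKet t p :=
  isometryOf_ket (M.evolvedKet t) (M.orthonormal_evolvedKet t) p

theorem evolvedKet_zero_ground (t : ℝ) : M.evolvedKet t (0, 0) = ket (0, 0) := rfl

theorem evolvedKet_ground (t : ℝ) (n : ℕ) :
    M.evolvedKet t (n + 1, 0) = M.propagatorBlock t n 0 0 • ket (n + 1, 0)
      + M.propagatorBlock t n 1 0 • ket (n, 1) := rfl

theorem evolvedKet_excited (t : ℝ) (n : ℕ) :
    M.evolvedKet t (n, 1) = M.propagatorBlock t n 0 1 • ket (n + 1, 0)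
      + M.propagatorBlock t n 1 1 • ket (n, 1) := by
  cases n <;> rfl

theorem clm_ext {F : Type} [NormedAddCommGroup F] [NormedSpace ℂ F] {S T : Joint →L[ℂ] F}
    (h : ∀ p, S (ket p) = T (ket p)) : S = T := by
  refine lp.ext_continuousLinearMap (by norm_num) (fun p => ?_)
  ext
  exact h p

theorem propagator_zero : M.propagator 0 = 1 := by
  refine clm_ext ?_
  rintro ⟨n, σ⟩
  rw [propagator_ket]
  fin_cases σ
  · cases n with
    | zero => rfl
    | succ n => simp [evolvedKet_ground, propagatorBlock_zero]
  · simp [evolvedKet_excited, propagatorBlock_zero]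

theorem propagator_add (s t : ℝ) : M.propagator (s + t) = M.propagator s * M.propagator t := by
  refine clm_ext ?_
  rintro ⟨n, σ⟩
  change _ = M.propagator s (M.propagator t (ket (n, σ)))
  rw [propagator_ket, propagator_ket]
  fin_cases σ
  · cases n with
    | zero => simp [evolvedKet_zero_ground, propagator_ket]
    | succ n =>
      simp only [Fin.zero_eta, evolvedKet_ground, map_add, map_smul, propagator_ket,
        evolvedKet_excited, propagatorBlock_add, Matrix.mul_apply, Fin.sum_univ_two]
      module
  · simp only [Fin.mk_one, evolvedKet_ground, map_add, map_smul, propagator_ket,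
      evolvedKet_excited, propagatorBlock_add, Matrix.mul_apply, Fin.sum_univ_two]
    module

theorem adjoint_propagator (t : ℝ) :
    ContinuousLinearMap.adjoint (M.propagator t) = M.propagator (-t) := by
  have h1 : ContinuousLinearMap.adjoint (M.propagator t) * M.propagator t = 1 :=
    ((M.propagator t).norm_map_iff_adjoint_comp_self).mp
      (isometryOf (M.evolvedKet t) (M.orthonormal_evolvedKet t)).norm_map
  have h2 : M.propagator t * M.propagator (-t) = 1 := by
    rw [← propagator_add, add_neg_cancel, propagator_zero]
  exact left_inv_eq_right_inv h1 h2

/-- On the dense subspace the propagator solves the Schrödinger equation with Hamiltonian `h`. -/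
theorem hasDerivAt_propagator (t : ℝ) (ψ : Core) :
    HasDerivAt (fun s : ℝ => M.propagator s (incl ψ))
      (M.propagator t ((-Complex.I) • incl (M.hamiltonian ψ))) t := by
  have basis : ∀ (n : ℕ) (σ : Fin 2),
      HasDerivAt (fun s : ℝ => M.propagator s (incl (Finsupp.single n 1 ⊗ₜ[ℂ] Pi.single σ 1)))
      (M.propagator t ((-Complex.I) •
        incl (M.hamiltonian (Finsupp.single n 1 ⊗ₜ[ℂ] Pi.single σ 1)))) t := by
    intro n σ
    fin_cases σ
    · cases n with
      | zero =>
        have := M.incl_hamiltonian_zero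
        simp only [Fin.zero_eta, this]
        simpa [incl_tmul, propagator_ket, evolvedKet_zero_ground] using
          hasDerivAt_const t (ket (0, 0) : Joint)
      | succ n =>
        have := M.incl_hamiltonian_ground n
        simp only [Fin.zero_eta, this]
        have h := ((M.hasDerivAt_propagatorBlock t n 0 0).smul_const (ket (n + 1, 0) : Joint)).add
          ((M.hasDerivAt_propagatorBlock t n 1 0).smul_const (ket (n, 1) : Joint))
        refine (h.congr_deriv ?_).congr_of_eventuallyEq (Filter.Eventually.of_forall fun s => ?_)
        · simp only [map_smul, map_add, propagator_ket, evolvedKet_ground, evolvedKet_excited,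
            generatorBlock, Matrix.mul_apply, Fin.sum_univ_two, Matrix.smul_apply, smul_eq_mul]
          module
        · simp [incl_tmul, propagator_ket, evolvedKet_ground]
    · have := M.incl_hamiltonian_excited n
      simp only [Fin.mk_one, this]
      have h := ((M.hasDerivAt_propagatorBlock t n 0 1).smul_const (ket (n + 1, 0) : Joint)).add
          ((M.hasDerivAt_propagatorBlock t n 1 1).smul_const (ket (n, 1) : Joint))
      refine (h.congr_deriv ?_).congr_of_eventuallyEq (Filter.Eventually.of_forall fun s => ?_)
      · simp only [map_smul, map_add, propagator_ket, evolvedKet_ground, evolvedKet_excited,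
          generatorBlock, Matrix.mul_apply, Fin.sum_univ_two, Matrix.smul_apply, smul_eq_mul]
        module
      · simp [incl_tmul, propagator_ket, evolvedKet_excited]
  induction ψ using TensorProduct.induction_on with
  | zero => simpa using hasDerivAt_const t (0 : Joint)
  | add x y hx hy => simpa using hx.fun_add hy
  | tmul f g =>
    induction f using Finsupp.induction_linear with
    | zero => simpa using hasDerivAt_const t (0 : Joint)
    | add x y hx hy => simpa [TensorProduct.add_tmul] using hx.fun_add hy
    | single n c =>
      have hg : Finsupp.single n c ⊗ₜ[ℂ] g
          = (c * g 0) • (Finsupp.single n (1 : ℂ) ⊗ₜ[ℂ] (Pi.single 0 1 : Fin 2 → ℂ))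
            + (c * g 1) • (Finsupp.single n (1 : ℂ) ⊗ₜ[ℂ] (Pi.single 1 1 : Fin 2 → ℂ)) := by
        have h1 : g = g 0 • (Pi.single 0 1 : Fin 2 → ℂ) + g 1 • (Pi.single 1 1 : Fin 2 → ℂ) := by
          ext i; fin_cases i <;> simp
        have h2 : (Finsupp.single n c : ℕ →₀ ℂ) = c • Finsupp.single n (1 : ℂ) := by simp
        conv_lhs => rw [h1, h2]
        simp only [TensorProduct.tmul_add, TensorProduct.tmul_smul, TensorProduct.smul_tmul',
          smul_smul, mul_comm]
      rw [hg]
      have h := ((basis n 0).const_smul (c * g 0)).add ((basis n 1).const_smul (c * g 1))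
      refine (h.congr_deriv ?_).congr_of_eventuallyEq (Filter.Eventually.of_forall fun s => ?_)
      · simp only [map_add, map_smul]
        module
      · simp

/-! ### The reduced dynamics map -/

end Maser

/-- The isometry `J_σ : ψ ↦ ψ ⊗ |σ⟩`. -/
def tensorKet (σ : Fin 2) : Field →L[ℂ] Joint :=
  (isometryOf (fun n : ℕ => (ket (n, σ) : Joint))
    (orthonormal_ket.comp _ (fun _ _ h => congrArg Prod.fst h))).toContinuousLinearMap

/-- The operator `ρ ⊗ m` on the joint space: `∑ m_{σσ'} ρ ⊗ |σ⟩⟨σ'|`. -/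
def tensorOp (ρ : Field →L[ℂ] Field) (m : Matrix (Fin 2) (Fin 2) ℂ) : Joint →L[ℂ] Joint :=
  ∑ σ, ∑ σ', m σ σ' • (tensorKet σ ∘L ρ ∘L ContinuousLinearMap.adjoint (tensorKet σ'))

/-- The partial trace over the atom: `∑_σ ⟨σ| X |σ⟩`. -/
def partialTrace (X : Joint →L[ℂ] Joint) : Field →L[ℂ] Field :=
  ∑ σ, ContinuousLinearMap.adjoint (tensorKet σ) ∘L X ∘L tensorKet σ

namespace Maser

variable (M : Maser)

/-- The thermal state `exp(-β h_E) / Tr exp(-β h_E)` of the atom. -/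
def atomGibbs (β : ℝ) : Matrix (Fin 2) (Fin 2) ℂ :=
  (Matrix.trace (NormedSpace.exp (-(β : ℂ) • M.atomHamiltonian)))⁻¹ •
    NormedSpace.exp (-(β : ℂ) • M.atomHamiltonian)

/-- The reduced dynamics map
`L_β(ρ) = Tr_E [exp(-i τ h) (ρ ⊗ exp(-β h_E)/Tr exp(-β h_E)) exp(i τ h)]`. -/
def rdm (β : ℝ) (ρ : Field →L[ℂ] Field) : Field →L[ℂ] Field :=
  partialTrace (M.propagator M.τ ∘L tensorOp ρ (M.atomGibbs β) ∘L
    ContinuousLinearMap.adjoint (M.propagator M.τ))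

end Maser

/-! ### States -/

/-- A state (density matrix): a positive operator of trace one. -/
def IsState (ρ : Field →L[ℂ] Field) : Prop :=
  ρ.IsPositive ∧ HasSum (fun n : ℕ => ⟪(ket n : Field), ρ (ket n)⟫_ℂ) 1

/-- The expectation `ρ(A) = Tr(ρ A)`. -/
def expect (ρ A : Field →L[ℂ] Field) : ℂ := ∑' n : ℕ, ⟪(ket n : Field), ρ (A (ket n))⟫_ℂ

/-- The support `s(ρ)`: the orthogonal projection onto the closure of the range of `ρ`. -/
def supportProj (ρ : Field →L[ℂ] Field) : Field →L[ℂ] Field :=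
  (LinearMap.range ρ.toLinearMap).topologicalClosure.starProjection

/-- Invariant states of a map `L`. -/
def IsInvariantState (L : (Field →L[ℂ] Field) → (Field →L[ℂ] Field)) (ρ : Field →L[ℂ] Field) :
    Prop :=
  IsState ρ ∧ L ρ = ρ

/-- The Cesàro mean `(1/N) ∑_{n=1}^N (L^n μ)(A)`. -/
def cesaroMean (L : (Field →L[ℂ] Field) → (Field →L[ℂ] Field)) (μ A : Field →L[ℂ] Field)
    (N : ℕ) : ℂ :=
  (1 / (N : ℂ)) * ∑ n ∈ Finset.Icc 1 N, expect (L^[n] μ) A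

/-- A state `ρ` is ergodic for `L` if `(1/N) ∑_{n=1}^N (L^n μ)(A) → ρ(A)` for all bounded `A` and
all states `μ` with `s(μ) ≤ s(ρ)`. -/
def IsErgodicState (L : (Field →L[ℂ] Field) → (Field →L[ℂ] Field)) (ρ : Field →L[ℂ] Field) :
    Prop :=
  IsState ρ ∧ ∀ μ : Field →L[ℂ] Field, IsState μ → supportProj μ ≤ supportProj ρ →
    ∀ A : Field →L[ℂ] Field,
      Filter.Tendsto (cesaroMean L μ A) Filter.atTop (nhds (expect ρ A))

/-- A state `ρ` is exponentially mixing for `L` if `(L^n μ)(A) → ρ(A)` exponentially fast, with a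
rate that does not depend on `A` and `μ`, for all bounded `A` and all states `μ` with
`s(μ) ≤ s(ρ)`. -/
def IsExpMixingState (L : (Field →L[ℂ] Field) → (Field →L[ℂ] Field)) (ρ : Field →L[ℂ] Field) :
    Prop :=
  IsState ρ ∧ ∃ α : ℝ, 0 < α ∧ ∀ μ : Field →L[ℂ] Field, IsState μ →
    supportProj μ ≤ supportProj ρ → ∀ A : Field →L[ℂ] Field, ∃ C : ℝ, ∀ n : ℕ,
      ‖expect (L^[n] μ) A - expect ρ A‖ ≤ C * Real.exp (-α * n)

/-- `ρ` is diagonal in the basis of number states. -/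
def IsDiagonal (ρ : Field →L[ℂ] Field) : Prop :=
  ∀ m n : ℕ, m ≠ n → ⟪(ket m : Field), ρ (ket n)⟫_ℂ = 0

/-- The orthogonal projection onto `ℓ²(I)`. -/
def proj (I : Set ℕ) : Field →L[ℂ] Field :=
  diagOp (I.indicator (fun _ => 1)) ⟨1, fun n => by
    by_cases h : n ∈ I <;> simp [h]⟩

namespace Maser

variable (M : Maser)

/-- The Boltzmann factor `exp(-b E n)` of the field Hamiltonian `h_S = E N`, restricted to `I`. -/
def boltzmann (b : ℝ) (I : Set ℕ) : ℕ → ℝ := I.indicator (fun n => Real.exp (-b * (M.E * n)))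

theorem boltzmann_nonneg (b : ℝ) (I : Set ℕ) (n : ℕ) : 0 ≤ M.boltzmann b I n :=
  Set.indicator_nonneg (fun _ _ => (Real.exp_pos _).le) n

theorem gibbs_bounded (b : ℝ) (I : Set ℕ) :
    ∃ C : ℝ, ∀ n, ‖((M.boltzmann b I n / ∑' m, M.boltzmann b I m : ℝ) : ℂ)‖ ≤ C := by
  refine ⟨1, fun n => ?_⟩
  rw [Complex.norm_real, Real.norm_eq_abs,
    abs_of_nonneg (div_nonneg (M.boltzmann_nonneg b I n) (tsum_nonneg (M.boltzmann_nonneg b I)))]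
  by_cases h : Summable (M.boltzmann b I)
  · exact div_le_one_of_le₀ (h.le_tsum n (fun m _ => M.boltzmann_nonneg b I m))
      (tsum_nonneg (M.boltzmann_nonneg b I))
  · simp [tsum_eq_zero_of_not_summable h]

/-- The operator `exp(-b h_S) P_I / Tr (exp(-b h_S) P_I)`, where `h_S = E N` is the Hamiltonian of
the field and `P_I` is the projection onto `ℓ²(I)`. It is a state exactly when `I` is non-empty
and the trace is finite; it is `0` otherwise. -/
def gibbs (b : ℝ) (I : Set ℕ) : Field →L[ℂ] Field :=
  diagOp (fun n => ((M.boltzmann b I n / ∑' m, M.boltzmann b I m : ℝ) : ℂ)) (M.gibbs_bounded b I)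

/-- The renormalized inverse temperature `β* = β E₀ / E`. -/
def betaStar (β : ℝ) : ℝ := β * M.E₀ / M.E

/-! ### Rabi resonances -/

/-- The dimensionless detuning `η = (Δ τ / 2π)²`, with `Δ = E - E₀`. -/
def eta : ℝ := ((M.E - M.E₀) * M.τ / (2 * Real.pi)) ^ 2

/-- The dimensionless coupling `ξ = (λ τ / 2π)²`. -/
def xi : ℝ := (M.coupling * M.τ / (2 * Real.pi)) ^ 2

/-- The set `R(η, ξ)` of Rabi resonances: the `n ≥ 1` such that `ξ n + η` is the square of an
integer. -/
def resonances : Set ℕ := {n | 1 ≤ n ∧ ∃ k : ℕ, M.xi * n + M.eta = (k : ℝ) ^ 2}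

/-- No Rabi resonance. -/
def IsNonResonant : Prop := M.resonances = ∅

/-- Exactly one Rabi resonance. -/
def IsSimplyResonant : Prop := ∃ n, M.resonances = {n}

/-- Infinitely many Rabi resonances. -/
def IsFullyResonant : Prop := M.resonances.Infinite

/-- A fully resonant system is degenerate if there are two different `n, m ∈ {0} ∪ R(η, ξ)` such
that `n + 1` and `m + 1` are resonances. -/
def IsDegenerate : Prop :=
  M.IsFullyResonant ∧ ∃ n m : ℕ, (n = 0 ∨ n ∈ M.resonances) ∧ m ∈ M.resonances ∧ n < m ∧
    n + 1 ∈ M.resonances ∧ m + 1 ∈ M.resonances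

open Classical in
/-- The `k`-th set `I_k`, `k = 1, 2, …`, of the partition of `ℕ` induced by the resonances
`n₁ < n₂ < ⋯`: `I_k = {n_{k-1}, …, n_k - 1}`, where `n₀ = 0` and, if there are only `k - 1`
resonances, `n_k = ∞`. It consists of the `n` such that exactly `k - 1` resonances are at
most `n`. -/
def rabiIndices (k : ℕ) : Set ℕ := {n | Nat.count (· ∈ M.resonances) (n + 1) + 1 = k}

/-- The projection `P_k` onto the `k`-th Rabi sector `ℓ²(I_k)`. -/
def rabiProj (k : ℕ) : Field →L[ℂ] Field := proj (M.rabiIndices k)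

/-- The `k`-th Rabi sector `ℓ²(I_k)`. -/
def rabiSector (k : ℕ) : Submodule ℂ Field := LinearMap.range (M.rabiProj k).toLinearMap

/-- The operator `ρ^{(k)} = exp(-β* h_S) P_k / Tr (exp(-β* h_S) P_k)`. -/
def rabiGibbs (β : ℝ) (k : ℕ) : Field →L[ℂ] Field := M.gibbs (M.betaStar β) (M.rabiIndices k)

end Maser

end OneAtomMaser

end

/-!
Eliminating the atom turns `L_β` and its dual, the Heisenberg dynamics, into sums over four Kraus
operators, each of which is diagonal or shifts the field by one level. Hence the dual acts
separately on the `d`-th diagonals `m ↦ ⟨m+d| A |m⟩` of an observable, as a tridiagonal recursion.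
The exchange amplitude between the levels `n - 1` and `n` vanishes exactly when `n` is `0` or a
Rabi resonance, which cuts the recursion on the main diagonal into the Rabi sectors. Detailed
balance: conjugation by the weights `γᵐ`, `γ = exp (-β E₀) = exp (-β* E)`, turns the Heisenberg
recursion into the one for states.

Let `f` be an eigenvector of the recursion to an eigenvalue of modulus at least `1`, with
`γᵐ f m → 0`. The flux of `X m = |γᵐ f m|` through the bonds `{m - 1, m}` is then nondecreasing,
starts at `0` and is dominated by a null sequence, so it vanishes. Therefore `f m ≠ 0` only where
the levels `m` and `m + d` are indistinguishable, in the moduli and in the relative phases of their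
transition amplitudes. If `d > 0`, this forces `m` and `m + d` to be resonant somewhere (where `0`
also counts as resonant for `m`), which is impossible if both lie in one sector, and the arithmetic
of `ξ n + η = k²` excludes it for eigenvalue `1` unless the system is degenerate. If `d = 0`, a
fixed point has no flux either, and is constant on each sector.

The entries of an invariant state are such fixed points times `γᵐ`, so for a non-degenerate system
it is a mixture of Gibbs states of sectors. Limits along ultrafilters of the Cesàro means of the
Heisenberg dynamics are fixed points as well; pairing them with the invariant Gibbs states
identifies them, and this yields all the ergodic limits. On a finite sector, the observables of
zero Gibbs expectation contain no eigenvector to an eigenvalue of modulus at least `1`, so the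
spectral radius formula gives exponential decay.
-/

noncomputable section

namespace OneAtomMaser

open Filter Topology

/-! ### Tridiagonal eigenvalue equations -/

theorem eq_zero_of_monotone_of_le_of_tendsto_zero {J c : ℕ → ℝ} (hJ : Monotone J) (h0 : 0 ≤ J 0)
    (hle : ∀ m, J m ≤ c m) (hc : Tendsto c atTop (𝓝 0)) (m : ℕ) : J m = 0 :=
  le_antisymm
    (ge_of_tendsto hc (eventually_atTop.2 ⟨m, fun n hn => (hJ hn).trans (hle n)⟩))
    (h0.trans (hJ (Nat.zero_le m)))

section Tridiagonal

variable {w₀ w₁ : ℝ}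

/- The flux `w₀ κₘ Xₘ - w₁ κₘ Xₘ₋₁` through the bond `{m - 1, m}` is nondecreasing in `m`, starts
at `0` and is dominated by a null sequence: it vanishes, and with it every defect that makes it
grow. -/
theorem tridiagonal_subsolution_rigidity (hw₀ : 0 < w₀) (hw₁ : 0 < w₁) (hw : w₀ + w₁ = 1)
    {α α' κ X : ℕ → ℝ} (hα : ∀ m, 0 ≤ α m) (hκ : ∀ m, 0 ≤ κ m) (hκ0 : κ 0 = 0)
    (hακ : ∀ m, α m + κ m ≤ 1) (hακ' : ∀ m, α' m + κ (m + 1) ≤ 1) (hX : ∀ m, 0 ≤ X m)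
    (hlim : Tendsto X atTop (𝓝 0))
    (hsub : ∀ m, X m ≤ (w₀ * α m + w₁ * α' m) * X m + w₀ * κ (m + 1) * X (m + 1)
      + w₁ * κ m * X (m - 1)) (m : ℕ) :
    w₀ * κ m * X m = w₁ * κ m * X (m - 1) ∧
      (α m + κ m = 1 ∨ X m = 0) ∧ (α' m + κ (m + 1) = 1 ∨ X m = 0) := by
  set J : ℕ → ℝ := fun m => w₀ * κ m * X m - w₁ * κ m * X (m - 1) with hJ
  have defect (m : ℕ) : 0 ≤ w₀ * ((1 - (α m + κ m)) * X m) :=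
    mul_nonneg hw₀.le (mul_nonneg (sub_nonneg.2 (hακ m)) (hX m))
  have defect' (m : ℕ) : 0 ≤ w₁ * ((1 - (α' m + κ (m + 1))) * X m) :=
    mul_nonneg hw₁.le (mul_nonneg (sub_nonneg.2 (hακ' m)) (hX m))
  have growth (m : ℕ) : w₀ * ((1 - (α m + κ m)) * X m)
      + w₁ * ((1 - (α' m + κ (m + 1))) * X m) ≤ J (m + 1) - J m := by
    have hXm : w₀ * X m + w₁ * X m = X m := by rw [← add_mul, hw, one_mul]
    simp only [hJ, Nat.add_sub_cancel]
    linarith [hsub m]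
  have hJ0 : ∀ m, J m = 0 := by
    refine eq_zero_of_monotone_of_le_of_tendsto_zero (c := fun m => w₀ * X m)
      (monotone_nat_of_le_succ fun m => ?_) (by simp [hJ, hκ0]) (fun m => ?_)
      (by simpa using hlim.const_mul w₀)
    · linarith [growth m, defect m, defect' m]
    · have hκ1 : κ m ≤ 1 := by linarith [hα m, hακ m]
      have hnonneg : 0 ≤ w₁ * κ m * X (m - 1) :=
        mul_nonneg (mul_nonneg hw₁.le (hκ m)) (hX _)
      have : w₀ * κ m * X m ≤ w₀ * 1 * X m := by gcongr; exact hX m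
      simp only [hJ]
      linarith
  have hgrow := growth m
  rw [hJ0, hJ0, sub_zero] at hgrow
  have hzero : w₀ * ((1 - (α m + κ m)) * X m) = 0 := by linarith [defect m, defect' m]
  have hzero' : w₁ * ((1 - (α' m + κ (m + 1))) * X m) = 0 := by linarith [defect m, defect' m]
  simp only [mul_eq_zero, hw₀.ne', hw₁.ne', false_or, sub_eq_zero, eq_comm (a := (1 : ℝ))]
    at hzero hzero'
  exact ⟨sub_eq_zero.1 (hJ0 m), hzero, hzero'⟩

theorem sameRay_of_norm_add_norm_le {E : Type*} [NormedAddCommGroup E] [NormedSpace ℝ E]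
    [StrictConvexSpace ℝ E] {u r v : E} (h : u + r = v) (hle : ‖u‖ + ‖r‖ ≤ ‖v‖) :
    SameRay ℝ u v := by
  have hur : SameRay ℝ u r :=
    sameRay_iff_norm_add.2 (le_antisymm (norm_add_le _ _) (by rwa [h]))
  exact h ▸ (SameRay.refl u).add_right hur

theorem eq_norm_mul_of_norm_add_norm_le {w : ℝ} (hw : 0 < w) {y x r z : ℂ} (hx : x ≠ 0)
    (hz : ‖z‖ = 1) (h : w * y * x + r = z * x) (hle : w * ‖y‖ * ‖x‖ + ‖r‖ ≤ ‖x‖) :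
    y = ‖y‖ * z := by
  have hray := (sameRay_of_norm_add_norm_le h (by
    simpa [hz, abs_of_pos hw] using hle)).norm_smul_eq
  have hne : ((w * ‖x‖ : ℝ) : ℂ) * x ≠ 0 :=
    mul_ne_zero (by exact_mod_cast (mul_pos hw (norm_pos_iff.2 hx)).ne') hx
  refine mul_right_cancel₀ hne ?_
  simp only [norm_mul, hz, Complex.norm_real, Real.norm_eq_abs, abs_of_pos hw,
    Complex.real_smul] at hray
  push_cast at hray ⊢
  linear_combination -hray

theorem tridiagonal_eigenvector_rigidity (hw₀ : 0 < w₀) (hw₁ : 0 < w₁) (hw : w₀ + w₁ = 1)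
    {a a' k x : ℕ → ℂ} {z : ℂ} (hk : k 0 = 0) (ha : ∀ m, ‖a m‖ + ‖k m‖ ≤ 1)
    (ha' : ∀ m, ‖a' m‖ + ‖k (m + 1)‖ ≤ 1) (hx : Tendsto x atTop (𝓝 0)) (hz : 1 ≤ ‖z‖)
    (heig : ∀ m, (w₀ * a m + w₁ * a' m) * x m + w₀ * k (m + 1) * x (m + 1)
      + w₁ * k m * x (m - 1) = z * x m) {m : ℕ} (hm : x m ≠ 0) :
    ‖a m‖ + ‖k m‖ = 1 ∧ ‖a' m‖ + ‖k (m + 1)‖ = 1 ∧ (k m ≠ 0 → x (m - 1) ≠ 0) ∧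
      (k (m + 1) ≠ 0 → x (m + 1) ≠ 0) ∧ a m = ‖a m‖ * z ∧ a' m = ‖a' m‖ * z := by
  have norm_terms (m : ℕ) : ‖z‖ * ‖x m‖ ≤ w₀ * ‖a m‖ * ‖x m‖ + w₁ * ‖a' m‖ * ‖x m‖
      + w₀ * ‖k (m + 1)‖ * ‖x (m + 1)‖ + w₁ * ‖k m‖ * ‖x (m - 1)‖ := by
    rw [← norm_mul, ← heig m, add_mul]
    refine norm_add₄_le.trans_eq ?_
    simp only [norm_mul, Complex.norm_real, Real.norm_eq_abs, abs_of_pos hw₀, abs_of_pos hw₁]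
  have rigid := tridiagonal_subsolution_rigidity (X := fun m => ‖x m‖) hw₀ hw₁ hw
    (fun m => norm_nonneg (a m)) (fun m => norm_nonneg (k m)) (by simp [hk]) ha ha'
    (fun m => norm_nonneg (x m)) (by simpa using hx.norm) fun m => by
      rw [add_mul]
      exact (le_mul_of_one_le_left (norm_nonneg _) hz).trans (norm_terms m)
  have hxm : ‖x m‖ ≠ 0 := norm_ne_zero_iff.2 hm
  have hak : ‖a m‖ + ‖k m‖ = 1 := (rigid m).2.1.resolve_right hxm
  have hak' : ‖a' m‖ + ‖k (m + 1)‖ = 1 := (rigid m).2.2.resolve_right hxm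
  have flux : w₀ * ‖k m‖ * ‖x m‖ = w₁ * ‖k m‖ * ‖x (m - 1)‖ := (rigid m).1
  have flux' : w₀ * ‖k (m + 1)‖ * ‖x (m + 1)‖ = w₁ * ‖k (m + 1)‖ * ‖x m‖ := (rigid (m + 1)).1
  have norm_sum : w₀ * ‖a m‖ * ‖x m‖ + w₁ * ‖a' m‖ * ‖x m‖ + w₀ * ‖k (m + 1)‖ * ‖x (m + 1)‖
      + w₁ * ‖k m‖ * ‖x (m - 1)‖ = ‖x m‖ := by
    linear_combination w₀ * ‖x m‖ * hak + w₁ * ‖x m‖ * hak' + ‖x m‖ * hw + flux' - flux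
  have hz1 : ‖z‖ = 1 := by
    have h := norm_terms m
    rw [norm_sum] at h
    exact le_antisymm (le_of_mul_le_mul_right (by rwa [one_mul])
      (norm_pos_iff.2 hm)) hz
  refine ⟨hak, hak', fun hkm h => ?_, fun hkm h => ?_, ?_, ?_⟩
  · simp [h, hw₀.ne', hkm, hm] at flux
  · simp [h, hw₁.ne', hkm, hm] at flux'
  · refine eq_norm_mul_of_norm_add_norm_le hw₀ hm hz1 (r := w₁ * a' m * x m
      + w₀ * k (m + 1) * x (m + 1) + w₁ * k m * x (m - 1)) (by rw [← heig m]; ring) ?_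
    have := norm_add₃_le (a := w₁ * a' m * x m) (b := w₀ * k (m + 1) * x (m + 1))
      (c := w₁ * k m * x (m - 1))
    simp only [norm_mul, Complex.norm_real, Real.norm_eq_abs, abs_of_pos hw₀,
      abs_of_pos hw₁] at this
    linarith
  · refine eq_norm_mul_of_norm_add_norm_le hw₁ hm hz1 (r := w₀ * a m * x m
      + w₀ * k (m + 1) * x (m + 1) + w₁ * k m * x (m - 1)) (by rw [← heig m]; ring) ?_
    have := norm_add₃_le (a := w₀ * a m * x m) (b := w₀ * k (m + 1) * x (m + 1))
      (c := w₁ * k m * x (m - 1))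
    simp only [norm_mul, Complex.norm_real, Real.norm_eq_abs, abs_of_pos hw₀,
      abs_of_pos hw₁] at this
    linarith

end Tridiagonal

/-! ### Powers with spectrum in the open unit disk -/

theorem exists_norm_pow_le_of_spectralRadius_lt_one {A : Type*} [NormedRing A]
    [NormedAlgebra ℂ A] [CompleteSpace A] {a : A} (ha : spectralRadius ℂ a < 1) :
    ∃ r ∈ Set.Ioo (0 : ℝ) 1, ∃ C : ℝ, ∀ n : ℕ, ‖a ^ n‖ ≤ C * r ^ n := by
  obtain ⟨r, har, hr1⟩ := ENNReal.lt_iff_exists_nnreal_btwn.1 ha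
  have hr0 : (0 : ℝ) < r := by exact_mod_cast zero_le.trans_lt har
  have hbound : ∀ᶠ n in atTop, ‖a ^ n‖ ≤ 1 * ‖(r : ℝ) ^ n‖ := by
    filter_upwards [(spectrum.pow_nnnorm_pow_one_div_tendsto_nhds_spectralRadius
      a).eventually_lt_const har, eventually_ne_atTop 0] with n hn hn0
    have hn' : (0 : ℝ) < n := by positivity
    rw [one_div, ENNReal.rpow_inv_lt_iff hn', ENNReal.rpow_natCast] at hn
    rw [one_mul, Real.norm_of_nonneg (by positivity)]
    exact_mod_cast hn.le
  obtain ⟨C, -, hC⟩ := Asymptotics.bound_of_isBigO_nat_atTop (Asymptotics.IsBigO.of_bound 1 hbound)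
  refine ⟨r, ⟨hr0, by exact_mod_cast hr1⟩, C, fun n => ?_⟩
  simpa [abs_of_pos hr0] using hC (pow_ne_zero n hr0.ne')

theorem exists_norm_pow_apply_le {V : Type*} [NormedAddCommGroup V] [NormedSpace ℂ V]
    [FiniteDimensional ℂ V] {T : Module.End ℂ V}
    (hT : ∀ z : ℂ, 1 ≤ ‖z‖ → ∀ v, T v = z • v → v = 0) :
    ∃ r ∈ Set.Ioo (0 : ℝ) 1, ∀ v, ∃ C : ℝ, ∀ n : ℕ, ‖(T ^ n) v‖ ≤ C * r ^ n := by
  rcases subsingleton_or_nontrivial V with hV | hV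
  · exact ⟨1 / 2, by norm_num, fun v => ⟨0, fun n => by simp [Subsingleton.elim v 0]⟩⟩
  have : CompleteSpace V := FiniteDimensional.complete ℂ V
  let toCLM := Module.End.toContinuousLinearMap (𝕜 := ℂ) V
  have hspec : ∀ z ∈ spectrum ℂ (toCLM T), ‖z‖₊ < 1 := by
    intro z hz
    rw [AlgEquiv.spectrum_eq toCLM T, ← Module.End.hasEigenvalue_iff_mem_spectrum] at hz
    obtain ⟨v, hv⟩ := hz.exists_hasEigenvector
    by_contra! hlt
    exact hv.2 (hT z (by exact_mod_cast hlt) v hv.apply_eq_smul)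
  obtain ⟨r, hr, C, hC⟩ := exists_norm_pow_le_of_spectralRadius_lt_one
    (spectrum.spectralRadius_lt_of_forall_lt (toCLM T) hspec)
  refine ⟨r, hr, fun v => ⟨C * ‖v‖, fun n => ?_⟩⟩
  calc ‖(T ^ n) v‖ = ‖(toCLM T ^ n) v‖ := by rw [← map_pow]; rfl
    _ ≤ C * r ^ n * ‖v‖ := (toCLM T ^ n).le_of_opNorm_le (hC n) v
    _ = C * ‖v‖ * r ^ n := by ring

/-! ### Matrix elements and traces -/

section Ket

variable {ι κ : Type} [DecidableEq ι]

theorem inner_ket_left (i : ι) (x : Ell2 ι) : ⟪ket i, x⟫_ℂ = x i := by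
  unfold ket
  rw [lp.inner_single_left]
  simp

theorem inner_ket_right (i : ι) (x : Ell2 ι) : ⟪x, ket i⟫_ℂ = starRingEnd ℂ (x i) := by
  rw [← inner_conj_symm, inner_ket_left]

theorem ket_apply (i j : ι) : (ket i : Ell2 ι) j = if j = i then 1 else 0 := by
  rw [← inner_ket_left, inner_ket]

theorem norm_ket (i : ι) : ‖(ket i : Ell2 ι)‖ = 1 :=
  orthonormal_ket.1 i

theorem clm_ext_ket {F : Type} [NormedAddCommGroup F] [NormedSpace ℂ F] {S T : Ell2 ι →L[ℂ] F}
    (h : ∀ i, S (ket i) = T (ket i)) : S = T := by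
  refine lp.ext_continuousLinearMap (by norm_num) fun i => ?_
  ext
  exact h i

theorem clm_ext_entry {S T : Ell2 ι →L[ℂ] Ell2 κ} (h : ∀ k i, S (ket i) k = T (ket i) k) :
    S = T :=
  clm_ext_ket fun i => by ext k; exact h k i

theorem adjoint_apply_ket [DecidableEq κ] (T : Ell2 ι →L[ℂ] Ell2 κ) (i : ι) (k : κ) :
    ContinuousLinearMap.adjoint T (ket k) i = starRingEnd ℂ (T (ket i) k) := by
  rw [← inner_ket_left, ContinuousLinearMap.adjoint_inner_right, inner_ket_right]

end Ket

theorem hasSum_norm_sq {ι : Type} (x : Ell2 ι) : HasSum (fun i => ‖x i‖ ^ 2) (‖x‖ ^ 2) := by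
  simpa using lp.hasSum_norm (by norm_num : 0 < (2 : ENNReal).toReal) x

theorem hasSum_conj_mul {ι : Type} (x y : Ell2 ι) :
    HasSum (fun i => starRingEnd ℂ (x i) * y i) ⟪x, y⟫_ℂ := by
  simpa [mul_comm] using lp.hasSum_inner (𝕜 := ℂ) x y

theorem hasSum_columns_of_hasSum_rows {α β E : Type*} [AddCommMonoid E] [TopologicalSpace E]
    [ContinuousAdd E] [T3Space E] {F : α → β → E} {r : α → E} {c : β → E}
    (hF : Summable fun p : α × β => F p.1 p.2) (hr : ∀ a, HasSum (F a) (r a))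
    (hc : ∀ b, HasSum (fun a => F a b) (c b)) : Summable r ∧ HasSum c (∑' a, r a) := by
  have hrows := hF.hasSum.prod_fiberwise hr
  have hswap : HasSum (fun p : β × α => F p.2 p.1) (∑' p : α × β, F p.1 p.2) :=
    (Equiv.prodComm β α).hasSum_iff.2 hF.hasSum
  exact ⟨hrows.summable, hrows.tsum_eq ▸ hswap.prod_fiberwise hc⟩

theorem summable_norm_entries_sq {α ι : Type} {x : α → Ell2 ι}
    (hx : Summable fun a => ‖x a‖ ^ 2) : Summable fun p : α × ι => ‖x p.1 p.2‖ ^ 2 := by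
  rw [summable_prod_of_nonneg (fun _ => by positivity)]
  exact ⟨fun a => (hasSum_norm_sq (x a)).summable,
    hx.congr fun a => (hasSum_norm_sq (x a)).tsum_eq.symm⟩

theorem summable_conj_mul_entries {α ι : Type} {x y : α → Ell2 ι}
    (hx : Summable fun a => ‖x a‖ ^ 2) (hy : Summable fun a => ‖y a‖ ^ 2) :
    Summable fun p : α × ι => starRingEnd ℂ (x p.1 p.2) * y p.1 p.2 := by
  refine Summable.of_norm_bounded
    ((summable_norm_entries_sq hx).add (summable_norm_entries_sq hy)) fun p => ?_
  rw [norm_mul, RCLike.norm_conj]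
  nlinarith [sq_nonneg (‖x p.1 p.2‖ - ‖y p.1 p.2‖), sq_nonneg (‖x p.1 p.2‖ + ‖y p.1 p.2‖)]

theorem hasSum_trace_mul_adjoint {ι κ : Type} [DecidableEq ι] [DecidableEq κ]
    {T : Ell2 ι →L[ℂ] Ell2 κ} (hT : Summable fun i => ‖T (ket i)‖ ^ 2)
    (A : Ell2 κ →L[ℂ] Ell2 κ) :
    Summable (fun i => ⟪T (ket i), A (T (ket i))⟫_ℂ) ∧
      HasSum (fun k => ⟪ket k, T (ContinuousLinearMap.adjoint T (A (ket k)))⟫_ℂ)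
        (∑' i, ⟪T (ket i), A (T (ket i))⟫_ℂ) := by
  have hx : Summable fun i => ‖ContinuousLinearMap.adjoint A (T (ket i))‖ ^ 2 := by
    refine Summable.of_nonneg_of_le (fun _ => by positivity) (fun i => ?_)
      (hT.mul_left (‖ContinuousLinearMap.adjoint A‖ ^ 2))
    rw [← mul_pow]
    exact pow_le_pow_left₀ (norm_nonneg _) (ContinuousLinearMap.le_opNorm _ _) 2
  have hF := summable_conj_mul_entries (x := fun i => ContinuousLinearMap.adjoint A (T (ket i)))
    (y := fun i => T (ket i)) hx hT
  refine hasSum_columns_of_hasSum_rows (F := fun i k =>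
    starRingEnd ℂ (ContinuousLinearMap.adjoint A (T (ket i)) k) * T (ket i) k) hF
    (fun i => ?_) (fun k => ?_)
  · have h := hasSum_conj_mul (ContinuousLinearMap.adjoint A (T (ket i))) (T (ket i))
    rwa [ContinuousLinearMap.adjoint_inner_left] at h
  · have h := hasSum_conj_mul (ContinuousLinearMap.adjoint T (ket k))
      (ContinuousLinearMap.adjoint T (A (ket k)))
    rw [ContinuousLinearMap.adjoint_inner_left] at h
    refine h.congr_fun fun i => ?_
    have hA : starRingEnd ℂ (ContinuousLinearMap.adjoint A (T (ket i)) k)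
        = ContinuousLinearMap.adjoint T (A (ket k)) i := by
      rw [← inner_ket_left i, ContinuousLinearMap.adjoint_inner_right, ← inner_ket_right,
        ContinuousLinearMap.adjoint_inner_left]
    rw [adjoint_apply_ket, Complex.conj_conj, mul_comm, ← hA]

theorem exists_sqrt_of_isPositive {H : Type*} [NormedAddCommGroup H] [InnerProductSpace ℂ H]
    [CompleteSpace H] {ρ : H →L[ℂ] H} (h : ρ.IsPositive) :
    ∃ S : H →L[ℂ] H, ContinuousLinearMap.adjoint S = S ∧ S ∘L S = ρ :=
  ⟨CFC.sqrt ρ, IsSelfAdjoint.of_nonneg (CFC.sqrt_nonneg ρ),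
    CFC.sqrt_mul_sqrt_self ρ ((ContinuousLinearMap.nonneg_iff_isPositive ρ).2 h)⟩

/-! ### States and expectations -/

section Sqrt

variable {ρ S : Field →L[ℂ] Field}

theorem entry_self_eq_norm_sq (hS : ContinuousLinearMap.adjoint S = S) (hSS : S ∘L S = ρ)
    (n : ℕ) : ρ (ket n) n = ((‖S (ket n)‖ ^ 2 : ℝ) : ℂ) := by
  rw [← inner_ket_left, ← hSS, ContinuousLinearMap.comp_apply,
    ← ContinuousLinearMap.adjoint_inner_left, hS, inner_self_eq_norm_sq_to_K]
  simp

theorem hasSum_expect_of_sqrt (hS : ContinuousLinearMap.adjoint S = S) (hSS : S ∘L S = ρ)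
    (hs : Summable fun n : ℕ => ‖S (ket n)‖ ^ 2) (A : Field →L[ℂ] Field) :
    HasSum (fun m : ℕ => ⟪S (ket m), A (S (ket m))⟫_ℂ) (expect ρ A) := by
  obtain ⟨hsum, htrace⟩ := hasSum_trace_mul_adjoint hs A
  have : expect ρ A = ∑' m : ℕ, ⟪S (ket m), A (S (ket m))⟫_ℂ := by
    rw [← htrace.tsum_eq, hS, ← hSS]
    simp only [expect, ContinuousLinearMap.comp_apply]
  rw [this]
  exact hsum.hasSum

theorem IsState.exists_sqrt (h : IsState ρ) :
    ∃ S : Field →L[ℂ] Field, ContinuousLinearMap.adjoint S = S ∧ S ∘L S = ρ ∧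
      HasSum (fun n : ℕ => ‖S (ket n)‖ ^ 2) 1 := by
  obtain ⟨S, hS, hSS⟩ := exists_sqrt_of_isPositive h.1
  refine ⟨S, hS, hSS, Complex.hasSum_ofReal.1 ?_⟩
  rw [Complex.ofReal_one]
  exact h.2.congr_fun fun n => by rw [inner_ket_left, entry_self_eq_norm_sq hS hSS]

theorem IsState.hasSum_expect (h : IsState ρ) (A : Field →L[ℂ] Field) :
    HasSum (fun n : ℕ => ⟪(ket n : Field), ρ (A (ket n))⟫_ℂ) (expect ρ A) := by
  obtain ⟨S, hS, hSS, hs⟩ := h.exists_sqrt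
  have htrace := (hasSum_trace_mul_adjoint hs.summable A).2
  rw [hS, (hasSum_expect_of_sqrt hS hSS hs.summable A).tsum_eq] at htrace
  exact htrace.congr_fun fun n => by rw [← hSS, ContinuousLinearMap.comp_apply]

end Sqrt

theorem expect_rankOne (ρ : Field →L[ℂ] Field) (m n : ℕ) :
    expect ρ (InnerProductSpace.rankOne ℂ (ket n : Field) (ket m : Field)) = ρ (ket n) m := by
  unfold expect
  rw [tsum_eq_single m fun k hk => ?_]
  · rw [InnerProductSpace.rankOne_apply, inner_ket, if_pos rfl, one_smul, inner_ket_left]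
  · rw [InnerProductSpace.rankOne_apply, inner_ket, if_neg hk.symm, zero_smul, map_zero,
      inner_zero_right]

theorem eq_of_expect_eq {ρ σ : Field →L[ℂ] Field} (h : ∀ A, expect ρ A = expect σ A) : ρ = σ :=
  clm_ext_entry fun m n => by rw [← expect_rankOne, ← expect_rankOne, h]

/-- The population `⟨n|ρ|n⟩` of the level `n`. -/
def population (ρ : Field →L[ℂ] Field) (n : ℕ) : ℝ := (ρ (ket n) n).re

theorem population_eq_norm_sq {ρ S : Field →L[ℂ] Field} (hS : ContinuousLinearMap.adjoint S = S)
    (hSS : S ∘L S = ρ) (n : ℕ) : population ρ n = ‖S (ket n)‖ ^ 2 := by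
  rw [population, entry_self_eq_norm_sq hS hSS, Complex.ofReal_re]

namespace IsState

variable {ρ : Field →L[ℂ] Field}

theorem entry_self_nonneg (h : IsState ρ) (n : ℕ) : 0 ≤ ρ (ket n) n := by
  simpa only [inner_ket_left] using h.1.inner_nonneg_right (ket n)

theorem entry_self (h : IsState ρ) (n : ℕ) : ρ (ket n) n = population ρ n :=
  Complex.ext rfl (Complex.nonneg_iff.1 (h.entry_self_nonneg n)).2.symm

theorem population_nonneg (h : IsState ρ) (n : ℕ) : 0 ≤ population ρ n :=
  (Complex.nonneg_iff.1 (h.entry_self_nonneg n)).1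

theorem hasSum_population (h : IsState ρ) : HasSum (population ρ) 1 := by
  have htrace := h.2
  simp only [inner_ket_left, h.entry_self] at htrace
  exact Complex.hasSum_ofReal.1 (by simpa using htrace)

theorem exists_population_ne_zero (h : IsState ρ) : ∃ n, population ρ n ≠ 0 := by
  by_contra! hzero
  have hsum := h.hasSum_population
  rw [funext hzero] at hsum
  exact zero_ne_one (hasSum_zero.unique hsum)

theorem entry_conj (h : IsState ρ) (m n : ℕ) : ρ (ket m) n = starRingEnd ℂ (ρ (ket n) m) := by
  rw [← adjoint_apply_ket, h.1.isSelfAdjoint.adjoint_eq]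

theorem tendsto_entry (h : IsState ρ) (d : ℕ) :
    Tendsto (fun m => ρ (ket (m + d)) m) atTop (𝓝 0) := by
  obtain ⟨S, hS, hSS, hs⟩ := h.exists_sqrt
  have hnorm : Tendsto (fun m : ℕ => ‖S (ket m)‖) atTop (𝓝 0) := by
    simpa using hs.summable.tendsto_atTop_zero.sqrt
  refine squeeze_zero_norm (fun m => ?_) (by simpa using hnorm.mul_const ‖S‖)
  rw [← inner_ket_left, ← hSS, ContinuousLinearMap.comp_apply,
    ← ContinuousLinearMap.adjoint_inner_left, hS]
  refine (norm_inner_le_norm _ _).trans ?_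
  gcongr
  simpa [norm_ket] using S.le_opNorm (ket (m + d))

end IsState

/-! ### Rabi oscillations -/

theorem exp_eq_of_mul_eq_mul_diagonal {n : Type*} [Fintype n] [DecidableEq n]
    {A S W : Matrix n n ℂ} {v : n → ℂ} (hS : IsUnit S) (hA : A * S = S * Matrix.diagonal v)
    (hW : W * S = S * Matrix.diagonal fun i => Complex.exp (v i)) : NormedSpace.exp A = W := by
  have hdet : IsUnit S.det := (Matrix.isUnit_iff_isUnit_det _).1 hS
  have hexp : NormedSpace.exp v = fun i => Complex.exp (v i) := by
    ext i
    rw [Pi.coe_exp, Complex.exp_eq_exp_ℂ]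
  rw [← Matrix.mul_nonsing_inv_cancel_right S A hdet, hA, Matrix.exp_conj _ _ hS,
    Matrix.exp_diagonal, hexp, ← hW, Matrix.mul_nonsing_inv_cancel_right _ _ hdet]

/-- The matrix `exp(-iK)` for `K = !![δ, g; g, -δ]`, an infinitesimal rotation with `K² = θ²`:
the evolution of a two-level system with detuning `δ` and coupling `g`. -/
def rabiRotation (δ g θ : ℝ) : Matrix (Fin 2) (Fin 2) ℂ :=
  !![Real.cos θ - Complex.I * δ * (Real.sin θ / θ : ℝ), -Complex.I * g * (Real.sin θ / θ : ℝ);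
    -Complex.I * g * (Real.sin θ / θ : ℝ), Real.cos θ + Complex.I * δ * (Real.sin θ / θ : ℝ)]

theorem exp_neg_I_mul_add (c θ : ℝ) : Complex.exp (-(Complex.I * (c + θ))) =
    Complex.exp (-(Complex.I * c)) * (Real.cos θ - Complex.I * Real.sin θ) := by
  rw [mul_add, neg_add, Complex.exp_add,
    show -(Complex.I * (θ : ℂ)) = (-θ : ℂ) * Complex.I by ring, Complex.exp_mul_I,
    Complex.cos_neg, Complex.sin_neg]
  push_cast
  ring

theorem exp_eq_smul_rabiRotation (c : ℝ) {δ g θ : ℝ} (hg : g ≠ 0) (hθ : θ ^ 2 = δ ^ 2 + g ^ 2) :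
    NormedSpace.exp (!![-Complex.I * (c + δ), -Complex.I * g;
      -Complex.I * g, -Complex.I * (c - δ)] : Matrix (Fin 2) (Fin 2) ℂ) =
    Complex.exp (-(Complex.I * c)) • rabiRotation δ g θ := by
  have hg' : (g : ℂ) ≠ 0 := by exact_mod_cast hg
  have hθ0 : (θ : ℂ) ≠ 0 := by
    have : θ ^ 2 ≠ 0 := by rw [hθ]; positivity
    exact_mod_cast fun h => this (by rw [h]; ring)
  have hsq : (θ : ℂ) ^ 2 = (δ : ℂ) ^ 2 + (g : ℂ) ^ 2 := by exact_mod_cast hθ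
  have hneg : Complex.exp (-(Complex.I * (c - θ))) =
      Complex.exp (-(Complex.I * c)) * (Real.cos θ + Complex.I * Real.sin θ) := by
    simpa [← sub_eq_add_neg] using exp_neg_I_mul_add c (-θ)
  -- The columns of this matrix are eigenvectors of `K`, for the eigenvalues `θ` and `-θ`.
  refine exp_eq_of_mul_eq_mul_diagonal (S := !![(g : ℂ), g; θ - δ, -θ - δ])
    (v := ![-(Complex.I * (c + θ)), -(Complex.I * (c - θ))]) ?_ ?_ ?_
  · rw [Matrix.isUnit_iff_isUnit_det, Matrix.det_fin_two_of, isUnit_iff_ne_zero,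
      show (g : ℂ) * (-θ - δ) - g * (θ - δ) = -2 * g * θ by ring]
    exact mul_ne_zero (mul_ne_zero (by norm_num) hg') hθ0
  · ext i j
    fin_cases i <;> fin_cases j <;>
      simp [Matrix.mul_apply, Fin.sum_univ_two, Matrix.diagonal]
    · ring
    · ring
    · linear_combination Complex.I * hsq
    · linear_combination Complex.I * hsq
  · ext i j
    fin_cases i <;> fin_cases j <;>
      simp [rabiRotation, Matrix.mul_apply, Fin.sum_univ_two, Matrix.diagonal,
        exp_neg_I_mul_add, hneg] <;> field_simp
    · ring
    · ring
    · linear_combination Complex.I * Complex.sin θ * hsq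
    · linear_combination Complex.I * Complex.sin θ * hsq

theorem eq_of_norm_smul_rabiRotation_eq {u u' : ℂ} (hu : ‖u‖ = 1) (hu' : ‖u'‖ = 1)
    {δ g g' θ θ' : ℝ} (hδ : δ ≠ 0) (hθ : 0 < θ) (hθ' : 0 < θ') (hsin : Real.sin θ ≠ 0)
    (h0 : (u • rabiRotation δ g θ) 0 0 = (u' • rabiRotation δ g' θ') 0 0)
    (h1 : (u • rabiRotation δ g θ) 1 1 = (u' • rabiRotation δ g' θ') 1 1) : θ = θ' := by
  simp only [rabiRotation, Matrix.smul_apply, Matrix.of_apply, Matrix.cons_val',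
    Matrix.cons_val_zero, Matrix.cons_val_one, Matrix.cons_val_fin_one, smul_eq_mul] at h0 h1
  have abs_eq {x y : ℝ} (h : u * x = u' * y) : |x| = |y| := by
    simpa [hu, hu'] using congrArg norm h
  have hcos : |Real.cos θ| = |Real.cos θ'| := abs_eq (by linear_combination (h0 + h1) / 2)
  have hdiv : |Real.sin θ / θ| = |Real.sin θ' / θ'| := by
    have hIδ : Complex.I * δ ≠ 0 := mul_ne_zero Complex.I_ne_zero (by exact_mod_cast hδ)
    exact abs_eq (mul_left_cancel₀ hIδ (by linear_combination (h1 - h0) / 2))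
  have habs : |Real.sin θ| = |Real.sin θ'| := by
    rw [Real.abs_sin_eq_sqrt_one_sub_cos_sq, Real.abs_sin_eq_sqrt_one_sub_cos_sq,
      ← sq_abs, hcos, sq_abs]
  rw [abs_div, abs_div, ← habs, abs_of_pos hθ, abs_of_pos hθ',
    div_eq_div_iff hθ.ne' hθ'.ne'] at hdiv
  exact (mul_left_cancel₀ (abs_ne_zero.2 hsin) hdiv).symm

namespace Maser

variable (M : Maser)

/-- Half the detuning phase `(E - E₀) τ / 2`. -/
def detuningPhase : ℝ := (M.E - M.E₀) * M.τ / 2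

/-- The Rabi angle `π √(ξ n + η)` of the transition between `|n⟩ ⊗ |0⟩` and `|n-1⟩ ⊗ |1⟩`. -/
def rabiAngle (n : ℕ) : ℝ := Real.pi * √(M.xi * n + M.eta)

/-- The amplitude of `|n⟩ ⊗ |0⟩ → |n⟩ ⊗ |0⟩`. -/
def groundAmp : ℕ → ℂ
  | 0 => 1
  | n + 1 => M.propagatorBlock M.τ n 0 0

/-- The amplitude of `|n⟩ ⊗ |0⟩ → |n-1⟩ ⊗ |1⟩`. -/
def exchangeAmp : ℕ → ℂ
  | 0 => 0
  | n + 1 => M.propagatorBlock M.τ n 0 1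

/-- The amplitude of `|n⟩ ⊗ |1⟩ → |n⟩ ⊗ |1⟩`. -/
def excitedAmp (n : ℕ) : ℂ := M.propagatorBlock M.τ n 1 1

variable {M}

theorem xi_pos (hcoupling : M.coupling ≠ 0) (hτ : M.τ ≠ 0) : 0 < M.xi := by
  unfold xi
  positivity

theorem coupling_mul_τ_ne_zero (hξ : 0 < M.xi) : M.coupling * M.τ ≠ 0 := fun h => by
  simp [xi, h] at hξ

theorem eta_nonneg : 0 ≤ M.eta := sq_nonneg _

theorem pi_sq_mul_eta : Real.pi ^ 2 * M.eta = M.detuningPhase ^ 2 := by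
  have := Real.pi_ne_zero
  unfold eta detuningPhase
  field_simp

theorem pi_sq_mul_xi : Real.pi ^ 2 * M.xi = (M.coupling * M.τ / 2) ^ 2 := by
  have := Real.pi_ne_zero
  unfold xi
  field_simp

theorem rabiAngle_sq (n : ℕ) : M.rabiAngle n ^ 2 = Real.pi ^ 2 * (M.xi * n + M.eta) := by
  have := M.eta_nonneg
  have : 0 ≤ M.xi := sq_nonneg _
  rw [rabiAngle, mul_pow, Real.sq_sqrt (by positivity)]

theorem rabiAngle_pos (hξ : 0 < M.xi) (n : ℕ) : 0 < M.rabiAngle (n + 1) := by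
  have := M.eta_nonneg
  unfold rabiAngle
  positivity

theorem rabiAngle_injective (hξ : 0 < M.xi) : Function.Injective M.rabiAngle := fun m n h => by
  have hsq := congrArg (· ^ 2) h
  simp only [rabiAngle_sq] at hsq
  exact_mod_cast mul_left_cancel₀ hξ.ne'
    (add_right_cancel (mul_left_cancel₀ (pow_ne_zero 2 Real.pi_ne_zero) hsq))

theorem propagatorBlock_eq (hξ : 0 < M.xi) (n : ℕ) : ∃ u : ℂ, ‖u‖ = 1 ∧ ∃ g : ℝ, g ≠ 0 ∧
    M.propagatorBlock M.τ n = u • rabiRotation M.detuningPhase g (M.rabiAngle (n + 1)) := by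
  set g : ℝ := M.coupling * M.τ / 2 * √((n : ℝ) + 1) with hg
  set c : ℝ := M.τ * (M.E * n + (M.E + M.E₀) / 2) with hc
  have hg0 : g ≠ 0 :=
    mul_ne_zero (div_ne_zero (coupling_mul_τ_ne_zero hξ) two_ne_zero) (by positivity)
  have hθ : M.rabiAngle (n + 1) ^ 2 = M.detuningPhase ^ 2 + g ^ 2 := by
    rw [rabiAngle_sq, hg, mul_pow, Real.sq_sqrt (by positivity), ← pi_sq_mul_eta, ← pi_sq_mul_xi]
    push_cast
    ring
  refine ⟨Complex.exp (-(Complex.I * c)), ?_, g, hg0, ?_⟩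
  · rw [show -(Complex.I * (c : ℂ)) = ((-c : ℝ) : ℂ) * Complex.I by push_cast; ring]
    exact Complex.norm_exp_ofReal_mul_I _
  · rw [← exp_eq_smul_rabiRotation c hg0 hθ, propagatorBlock]
    congr 1
    ext i j
    fin_cases i <;> fin_cases j <;>
      simp [generatorBlock, block, hg, hc, detuningPhase] <;> ring

theorem propagatorBlock_symm (hξ : 0 < M.xi) (n : ℕ) :
    M.propagatorBlock M.τ n 1 0 = M.propagatorBlock M.τ n 0 1 := by
  obtain ⟨u, -, g, -, h⟩ := propagatorBlock_eq hξ n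
  simp [h, rabiRotation]

theorem norm_sq_groundAmp_add (hξ : 0 < M.xi) (n : ℕ) :
    ‖M.groundAmp n‖ ^ 2 + ‖M.exchangeAmp n‖ ^ 2 = 1 := by
  cases n with
  | zero => simp [groundAmp, exchangeAmp]
  | succ n =>
    have := congrFun (congrFun (M.propagatorBlock_unitary M.τ n) 0) 0
    simp only [Matrix.mul_apply, Fin.sum_univ_two, Matrix.conjTranspose_apply,
      Matrix.one_apply_eq, propagatorBlock_symm hξ, RCLike.star_def, Complex.conj_mul'] at this
    exact_mod_cast this

theorem norm_sq_excitedAmp_add (n : ℕ) :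
    ‖M.excitedAmp n‖ ^ 2 + ‖M.exchangeAmp (n + 1)‖ ^ 2 = 1 := by
  have := congrFun (congrFun (M.propagatorBlock_unitary M.τ n) 1) 1
  simp only [Matrix.mul_apply, Fin.sum_univ_two, Matrix.conjTranspose_apply,
    Matrix.one_apply_eq, RCLike.star_def, Complex.conj_mul'] at this
  rw [add_comm]
  exact_mod_cast this

theorem sin_rabiAngle_eq_zero_iff (n : ℕ) :
    Real.sin (M.rabiAngle (n + 1)) = 0 ↔ n + 1 ∈ M.resonances := by
  have hη := M.eta_nonneg
  have hξ : 0 ≤ M.xi := sq_nonneg _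
  have hnonneg : 0 ≤ M.xi * (n + 1 : ℕ) + M.eta := by positivity
  rw [Real.sin_eq_zero_iff]
  constructor
  · rintro ⟨k, hk⟩
    refine ⟨n.succ_pos, k.natAbs, ?_⟩
    have hsqrt : (k : ℝ) = √(M.xi * (n + 1 : ℕ) + M.eta) := by
      rw [rabiAngle, mul_comm] at hk
      exact mul_left_cancel₀ Real.pi_ne_zero hk
    rw [Nat.cast_natAbs, Int.cast_abs, sq_abs, hsqrt, Real.sq_sqrt hnonneg]
  · rintro ⟨-, k, hk⟩
    exact ⟨k, by rw [rabiAngle, hk, Real.sqrt_sq k.cast_nonneg, mul_comm, Int.cast_natCast]⟩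

theorem exchangeAmp_eq_zero_iff (hξ : 0 < M.xi) (n : ℕ) :
    M.exchangeAmp n = 0 ↔ n = 0 ∨ n ∈ M.resonances := by
  cases n with
  | zero => simp [exchangeAmp]
  | succ n =>
    obtain ⟨u, hu, g, hg, h⟩ := propagatorBlock_eq hξ n
    have hu0 : u ≠ 0 := norm_ne_zero_iff.1 (by simp [hu])
    rw [← sin_rabiAngle_eq_zero_iff]
    simp [exchangeAmp, h, rabiRotation, hu0, hg, (rabiAngle_pos hξ n).ne', -Complex.ofReal_sin]

theorem eq_of_amp_eq (hξ : 0 < M.xi) (hη : M.eta ≠ 0) {m n : ℕ} (hm : m + 1 ∉ M.resonances)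
    (hground : M.groundAmp (m + 1) = M.groundAmp (n + 1))
    (hexcited : M.excitedAmp m = M.excitedAmp n) : m = n := by
  obtain ⟨u, hu, g, -, h⟩ := propagatorBlock_eq hξ m
  obtain ⟨u', hu', g', -, h'⟩ := propagatorBlock_eq hξ n
  have hδ : M.detuningPhase ≠ 0 := fun hδ => by
    have := M.pi_sq_mul_eta
    simp [hδ, hη, Real.pi_ne_zero] at this
  simp only [groundAmp, excitedAmp, h, h'] at hground hexcited
  have hangle := eq_of_norm_smul_rabiRotation_eq hu hu' hδ (rabiAngle_pos hξ m)
    (rabiAngle_pos hξ n) (fun h => hm ((sin_rabiAngle_eq_zero_iff m).1 h)) hground hexcited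
  exact Nat.succ_injective (rabiAngle_injective hξ hangle)

end Maser

/-! ### Kraus maps -/

theorem opNorm_le_of_norm_inner_le {H : Type*} [NormedAddCommGroup H] [InnerProductSpace ℂ H]
    {T : H →L[ℂ] H} {C : ℝ} (hC : 0 ≤ C) (hT : ∀ x y, ‖⟪y, T x⟫_ℂ‖ ≤ C * (‖y‖ * ‖x‖)) :
    ‖T‖ ≤ C := by
  refine T.opNorm_le_bound hC fun x => ?_
  rcases (norm_nonneg (T x)).eq_or_lt with hTx | hTx
  · rw [← hTx]
    positivity
  · have hself := hT x (T x)
    rw [inner_self_eq_norm_sq_to_K, norm_pow, RCLike.norm_ofReal, abs_norm] at hself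
    exact le_of_mul_le_mul_left (by linarith) hTx

section Kraus

variable {H : Type*} [NormedAddCommGroup H] [InnerProductSpace ℂ H] [CompleteSpace H]
  {ι : Type} [Fintype ι]

/-- The map `ρ ↦ ∑ᵢ wᵢ Kᵢ ρ Kᵢ*` with weights `w` and Kraus operators `K`. -/
def krausMap (w : ι → ℝ) (K : ι → H →L[ℂ] H) (ρ : H →L[ℂ] H) : H →L[ℂ] H :=
  ∑ i, (w i : ℂ) • (K i ∘L ρ ∘L ContinuousLinearMap.adjoint (K i))

/-- The map `A ↦ ∑ᵢ wᵢ Kᵢ* A Kᵢ`, dual to `krausMap w K` in the Heisenberg picture. -/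
def krausDual (w : ι → ℝ) (K : ι → H →L[ℂ] H) : (H →L[ℂ] H) →ₗ[ℂ] (H →L[ℂ] H) where
  toFun A := ∑ i, (w i : ℂ) • (ContinuousLinearMap.adjoint (K i) ∘L A ∘L K i)
  map_add' A B := by
    simp only [ContinuousLinearMap.add_comp, ContinuousLinearMap.comp_add, smul_add,
      Finset.sum_add_distrib]
  map_smul' c A := by
    simp only [ContinuousLinearMap.smul_comp, ContinuousLinearMap.comp_smul, Finset.smul_sum,
      RingHom.id_apply, smul_comm c]

variable {w : ι → ℝ} {K : ι → H →L[ℂ] H}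

theorem krausDual_apply (A : H →L[ℂ] H) :
    krausDual w K A = ∑ i, (w i : ℂ) • (ContinuousLinearMap.adjoint (K i) ∘L A ∘L K i) := rfl

theorem inner_krausDual_apply (A : H →L[ℂ] H) (x y : H) :
    ⟪y, krausDual w K A x⟫_ℂ = ∑ i, (w i : ℂ) * ⟪K i y, A (K i x)⟫_ℂ := by
  simp only [krausDual_apply, _root_.sum_apply, _root_.smul_apply, ContinuousLinearMap.comp_apply,
    inner_sum, inner_smul_right, ContinuousLinearMap.adjoint_inner_right]

theorem krausDual_adjoint (A : H →L[ℂ] H) :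
    krausDual w K (ContinuousLinearMap.adjoint A) =
      ContinuousLinearMap.adjoint (krausDual w K A) := by
  refine ContinuousLinearMap.ext fun x => ext_inner_left ℂ fun y => ?_
  rw [ContinuousLinearMap.adjoint_inner_right, inner_krausDual_apply,
    ← inner_conj_symm (krausDual w K A y), inner_krausDual_apply, map_sum]
  refine Finset.sum_congr rfl fun i _ => ?_
  rw [map_mul, Complex.conj_ofReal, inner_conj_symm, ContinuousLinearMap.adjoint_inner_right]

theorem krausMap_isPositive (hw : ∀ i, 0 ≤ w i) {ρ : H →L[ℂ] H} (hρ : ρ.IsPositive) :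
    (krausMap w K ρ).IsPositive :=
  Finset.sum_induction _ ContinuousLinearMap.IsPositive (fun _ _ => .add)
    ContinuousLinearMap.isPositive_zero fun i _ =>
    (hρ.conj_adjoint (K i)).smul_of_nonneg (by exact_mod_cast hw i)

theorem sum_mul_norm_sq_of_krausDual_one (hone : krausDual w K 1 = 1) (x : H) :
    ∑ i, w i * ‖K i x‖ ^ 2 = ‖x‖ ^ 2 := by
  have hinner := inner_krausDual_apply (w := w) (K := K) 1 x x
  simp only [hone, one_apply_eq_self, inner_self_eq_norm_sq_to_K] at hinner
  apply Complex.ofReal_injective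
  push_cast
  exact hinner.symm

theorem norm_krausDual_le (hw : ∀ i, 0 ≤ w i) (hone : krausDual w K 1 = 1) (A : H →L[ℂ] H) :
    ‖krausDual w K A‖ ≤ ‖A‖ := by
  refine opNorm_le_of_norm_inner_le (norm_nonneg A) fun x y => ?_
  have cauchySchwarz : ∑ i, (√(w i) * ‖K i y‖) * (√(w i) * ‖K i x‖) ≤ ‖y‖ * ‖x‖ := by
    refine (abs_le_of_sq_le_sq' ?_ (by positivity)).2
    refine (Finset.sum_mul_sq_le_sq_mul_sq _ _ _).trans_eq ?_
    simp only [mul_pow, Real.sq_sqrt (hw _), sum_mul_norm_sq_of_krausDual_one hone]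
  refine le_trans ?_ (mul_le_mul_of_nonneg_left cauchySchwarz (norm_nonneg A))
  rw [inner_krausDual_apply, Finset.mul_sum]
  refine (norm_sum_le _ _).trans (Finset.sum_le_sum fun i _ => ?_)
  have hinner : ‖⟪K i y, A (K i x)⟫_ℂ‖ ≤ ‖K i y‖ * (‖A‖ * ‖K i x‖) :=
    (norm_inner_le_norm _ _).trans (by gcongr; exact A.le_opNorm _)
  rw [norm_mul, Complex.norm_real, Real.norm_of_nonneg (hw i)]
  refine (mul_le_mul_of_nonneg_left hinner (hw i)).trans_eq ?_
  linear_combination (-‖A‖ * ‖K i y‖ * ‖K i x‖) * Real.mul_self_sqrt (hw i)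

end Kraus

theorem IsState.expect_sum {ρ : Field →L[ℂ] Field} (h : IsState ρ) {ι : Type} (s : Finset ι)
    (A : ι → Field →L[ℂ] Field) :
    expect ρ (∑ i ∈ s, A i) = ∑ i ∈ s, expect ρ (A i) := by
  rw [← (hasSum_sum fun i _ => h.hasSum_expect (A i)).tsum_eq]
  exact tsum_congr fun n => by rw [_root_.sum_apply, map_sum, inner_sum]

theorem expect_smul (ρ : Field →L[ℂ] Field) (c : ℂ) (A : Field →L[ℂ] Field) :
    expect ρ (c • A) = c * expect ρ A := by
  unfold expect
  rw [← tsum_mul_left]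
  exact tsum_congr fun n => by rw [_root_.smul_apply, map_smul, inner_smul_right]

theorem IsState.expect_one {ρ : Field →L[ℂ] Field} (h : IsState ρ) : expect ρ 1 = 1 :=
  h.2.tsum_eq

theorem IsState.hasSum_expect_conj {ρ : Field →L[ℂ] Field} (h : IsState ρ)
    (K A : Field →L[ℂ] Field) :
    HasSum (fun n : ℕ => ⟪(ket n : Field), (K ∘L ρ ∘L ContinuousLinearMap.adjoint K) (A (ket n))⟫_ℂ)
      (expect ρ (ContinuousLinearMap.adjoint K ∘L A ∘L K)) := by
  obtain ⟨S, hS, hSS, hs⟩ := h.exists_sqrt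
  have hKS : Summable fun n : ℕ => ‖(K ∘L S) (ket n)‖ ^ 2 := by
    refine Summable.of_nonneg_of_le (fun _ => by positivity) (fun m => ?_)
      (hs.summable.mul_left (‖K‖ ^ 2))
    rw [← mul_pow]
    exact pow_le_pow_left₀ (norm_nonneg _) (K.le_opNorm _) 2
  have htrace := (hasSum_trace_mul_adjoint hKS A).2
  have hexpect := (hasSum_expect_of_sqrt hS hSS hs.summable
    (ContinuousLinearMap.adjoint K ∘L A ∘L K)).tsum_eq
  simp only [ContinuousLinearMap.comp_apply, ContinuousLinearMap.adjoint_inner_right] at hexpect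
  simp only [ContinuousLinearMap.comp_apply, hexpect] at htrace
  refine htrace.congr_fun fun n => ?_
  simp only [ContinuousLinearMap.comp_apply, ContinuousLinearMap.adjoint_comp, hS, ← hSS]

section Kraus

variable {ι : Type} [Fintype ι] {w : ι → ℝ} {K : ι → Field →L[ℂ] Field} {ρ : Field →L[ℂ] Field}

theorem IsState.hasSum_expect_krausMap (h : IsState ρ) (A : Field →L[ℂ] Field) :
    HasSum (fun n : ℕ => ⟪(ket n : Field), krausMap w K ρ (A (ket n))⟫_ℂ)
      (expect ρ (krausDual w K A)) := by
  have hsum := hasSum_sum fun i (_ : i ∈ Finset.univ) =>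
    (h.hasSum_expect_conj (K i) A).mul_left (w i : ℂ)
  simp only [krausDual_apply, h.expect_sum, expect_smul]
  refine hsum.congr_fun fun n => ?_
  simp only [krausMap, _root_.sum_apply, _root_.smul_apply, inner_sum, inner_smul_right]

theorem IsState.krausMap (h : IsState ρ) (hw : ∀ i, 0 ≤ w i) (hone : krausDual w K 1 = 1) :
    IsState (krausMap w K ρ) := by
  refine ⟨krausMap_isPositive hw h.1, ?_⟩
  have htrace := h.hasSum_expect_krausMap (w := w) (K := K) 1
  rwa [hone, h.expect_one] at htrace

end Kraus

/-! ### Kraus form of the reduced dynamics -/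

theorem tensorKet_ket (σ : Fin 2) (n : ℕ) : tensorKet σ (ket n) = ket (n, σ) :=
  isometryOf_ket _ (orthonormal_ket.comp _ (fun _ _ h => congrArg Prod.fst h)) n

theorem adjoint_tensorKet_ket (σ σ' : Fin 2) (n : ℕ) :
    ContinuousLinearMap.adjoint (tensorKet σ') (ket (n, σ)) = if σ = σ' then ket n else 0 := by
  ext m
  rw [← inner_ket_left, ContinuousLinearMap.adjoint_inner_right, tensorKet_ket, inner_ket]
  by_cases h : σ = σ'
  · subst h; simp [ket_apply]
  · simp [h, Ne.symm h]

namespace Maser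

variable {M : Maser}

variable (M) in
/-- The Kraus operators `⟨σ'| exp(-i τ h) |σ⟩` of the atomic transitions `σ → σ'`. -/
def kraus (σ' σ : Fin 2) : Field →L[ℂ] Field :=
  ContinuousLinearMap.adjoint (tensorKet σ') ∘L M.propagator M.τ ∘L tensorKet σ

theorem kraus_apply_ket (σ' σ : Fin 2) (n : ℕ) : M.kraus σ' σ (ket n) =
    ContinuousLinearMap.adjoint (tensorKet σ') (M.evolvedKet M.τ (n, σ)) := by
  simp only [kraus, ContinuousLinearMap.comp_apply, tensorKet_ket, propagator_ket]

theorem kraus_ground_ground (n : ℕ) : M.kraus 0 0 (ket n) = M.groundAmp n • ket n := by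
  rw [kraus_apply_ket]
  cases n with
  | zero => simp [evolvedKet_zero_ground, adjoint_tensorKet_ket, groundAmp]
  | succ n => simp [evolvedKet_ground, adjoint_tensorKet_ket, groundAmp]

theorem kraus_excited_excited (n : ℕ) : M.kraus 1 1 (ket n) = M.excitedAmp n • ket n := by
  rw [kraus_apply_ket]
  simp [evolvedKet_excited, adjoint_tensorKet_ket, excitedAmp]

theorem kraus_ground_excited (n : ℕ) :
    M.kraus 0 1 (ket n) = M.exchangeAmp (n + 1) • ket (n + 1) := by
  rw [kraus_apply_ket]
  simp [evolvedKet_excited, adjoint_tensorKet_ket, exchangeAmp]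

theorem kraus_excited_ground (hξ : 0 < M.xi) (n : ℕ) :
    M.kraus 1 0 (ket n) = M.exchangeAmp n • ket (n - 1) := by
  rw [kraus_apply_ket]
  cases n with
  | zero => simp [evolvedKet_zero_ground, adjoint_tensorKet_ket, exchangeAmp]
  | succ n => simp [evolvedKet_ground, adjoint_tensorKet_ket, exchangeAmp, propagatorBlock_symm hξ]

theorem adjoint_kraus_ground_ground (n : ℕ) :
    ContinuousLinearMap.adjoint (M.kraus 0 0) (ket n) = starRingEnd ℂ (M.groundAmp n) • ket n := by
  ext m
  rw [adjoint_apply_ket, kraus_ground_ground]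
  rcases eq_or_ne n m with rfl | h
  · simp [ket_apply]
  · simp [ket_apply, h, h.symm]

theorem adjoint_kraus_excited_excited (n : ℕ) :
    ContinuousLinearMap.adjoint (M.kraus 1 1) (ket n) =
      starRingEnd ℂ (M.excitedAmp n) • ket n := by
  ext m
  rw [adjoint_apply_ket, kraus_excited_excited]
  rcases eq_or_ne n m with rfl | h
  · simp [ket_apply]
  · simp [ket_apply, h, h.symm]

theorem adjoint_kraus_ground_excited (n : ℕ) :
    ContinuousLinearMap.adjoint (M.kraus 0 1) (ket n) =
      starRingEnd ℂ (M.exchangeAmp n) • ket (n - 1) := by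
  ext m
  rw [adjoint_apply_ket, kraus_ground_excited]
  rcases n with _ | n
  · simp [ket_apply, exchangeAmp]
  · rcases eq_or_ne n m with rfl | h
    · simp [ket_apply]
    · simp [ket_apply, h, h.symm]

theorem adjoint_kraus_excited_ground (hξ : 0 < M.xi) (n : ℕ) :
    ContinuousLinearMap.adjoint (M.kraus 1 0) (ket n) =
      starRingEnd ℂ (M.exchangeAmp (n + 1)) • ket (n + 1) := by
  ext m
  rw [adjoint_apply_ket, kraus_excited_ground hξ]
  rcases m with _ | m
  · simp [ket_apply, exchangeAmp]
  · rcases eq_or_ne n m with rfl | h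
    · simp [ket_apply]
    · simp [ket_apply, h, h.symm]

variable (M) in
/-- The ratio `exp(-β E₀)` of the populations of the atom. -/
def atomRatio (β : ℝ) : ℝ := Real.exp (-β * M.E₀)

variable (M) in
/-- The populations of the atom in its thermal state. -/
def atomPopulation (β : ℝ) (σ : Fin 2) : ℝ := M.atomRatio β ^ (σ : ℕ) / (1 + M.atomRatio β)

theorem atomRatio_pos (β : ℝ) : 0 < M.atomRatio β := Real.exp_pos _

theorem atomPopulation_pos (β : ℝ) (σ : Fin 2) : 0 < M.atomPopulation β σ := by
  have := M.atomRatio_pos β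
  unfold atomPopulation
  positivity

theorem atomPopulation_sum (β : ℝ) : M.atomPopulation β 0 + M.atomPopulation β 1 = 1 := by
  have := M.atomRatio_pos β
  simp only [atomPopulation, Fin.val_zero, Fin.val_one, pow_zero, pow_one]
  field_simp

theorem atomPopulation_one (β : ℝ) :
    M.atomPopulation β 1 = M.atomPopulation β 0 * M.atomRatio β := by
  simp only [atomPopulation, Fin.val_zero, Fin.val_one, pow_zero, pow_one]
  ring

theorem atomGibbs_eq (β : ℝ) :
    M.atomGibbs β = Matrix.diagonal fun σ => (M.atomPopulation β σ : ℂ) := by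
  have hH : -(β : ℂ) • M.atomHamiltonian = Matrix.diagonal ![0, ((-β * M.E₀ : ℝ) : ℂ)] := by
    ext i j
    fin_cases i <;> fin_cases j <;>
      simp [atomHamiltonian, raise, lower, Matrix.diagonal]
  have hexp : NormedSpace.exp (-(β : ℂ) • M.atomHamiltonian)
      = Matrix.diagonal ![1, (M.atomRatio β : ℂ)] := by
    rw [hH, Matrix.exp_diagonal]
    congr 1
    ext i
    fin_cases i <;> simp [← Complex.exp_eq_exp_ℂ, atomRatio]
  rw [atomGibbs, hexp, Matrix.trace_diagonal]
  ext i j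
  fin_cases i <;> fin_cases j <;>
    simp [Matrix.diagonal, atomPopulation, Fin.sum_univ_two, div_eq_inv_mul]

theorem rdm_eq_krausMap (β : ℝ) (ρ : Field →L[ℂ] Field) : M.rdm β ρ =
    krausMap (fun p : Fin 2 × Fin 2 => M.atomPopulation β p.1) (fun p => M.kraus p.2 p.1) ρ := by
  ext x : 1
  simp only [rdm, partialTrace, tensorOp, krausMap, atomGibbs_eq, kraus,
    ContinuousLinearMap.adjoint_comp, ContinuousLinearMap.adjoint_adjoint, Fintype.sum_prod_type,
    Fin.sum_univ_two, Matrix.diagonal_apply_eq,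
    Matrix.diagonal_apply_ne _ (zero_ne_one : (0 : Fin 2) ≠ 1),
    Matrix.diagonal_apply_ne _ (one_ne_zero : (1 : Fin 2) ≠ 0), zero_smul, add_zero, zero_add,
    ContinuousLinearMap.comp_apply, _root_.add_apply, _root_.smul_apply, map_add, map_smul]
  abel

variable (M) in
/-- The reduced dynamics in the Heisenberg picture. -/
def heisenberg (β : ℝ) : (Field →L[ℂ] Field) →ₗ[ℂ] (Field →L[ℂ] Field) :=
  krausDual (fun p : Fin 2 × Fin 2 => M.atomPopulation β p.1) fun p => M.kraus p.2 p.1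

theorem rdm_entry (hξ : 0 < M.xi) (β : ℝ) (ρ : Field →L[ℂ] Field)
    (m n : ℕ) : M.rdm β ρ (ket n) m =
    (M.atomPopulation β 0 * (M.groundAmp m * starRingEnd ℂ (M.groundAmp n)) +
      M.atomPopulation β 1 * (M.excitedAmp m * starRingEnd ℂ (M.excitedAmp n))) * ρ (ket n) m +
    M.atomPopulation β 0 * (M.exchangeAmp (m + 1) * starRingEnd ℂ (M.exchangeAmp (n + 1))) *
      ρ (ket (n + 1)) (m + 1) +
    M.atomPopulation β 1 * (M.exchangeAmp m * starRingEnd ℂ (M.exchangeAmp n)) *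
      ρ (ket (n - 1)) (m - 1) := by
  rw [← inner_ket_left, rdm_eq_krausMap]
  simp only [krausMap, Fintype.sum_prod_type, Fin.sum_univ_two, _root_.add_apply,
    _root_.smul_apply, ContinuousLinearMap.comp_apply, inner_add_right, inner_smul_right]
  simp only [← ContinuousLinearMap.adjoint_inner_left (M.kraus _ _)]
  simp only [adjoint_kraus_ground_ground, adjoint_kraus_excited_excited,
    adjoint_kraus_ground_excited, adjoint_kraus_excited_ground hξ, map_smul, inner_smul_left,
    inner_smul_right, inner_ket_left, Complex.conj_conj]
  ring

theorem heisenberg_entry (hξ : 0 < M.xi) (β : ℝ) (A : Field →L[ℂ] Field)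
    (m n : ℕ) : M.heisenberg β A (ket m) n =
    (M.atomPopulation β 0 * (M.groundAmp m * starRingEnd ℂ (M.groundAmp n)) +
      M.atomPopulation β 1 * (M.excitedAmp m * starRingEnd ℂ (M.excitedAmp n))) * A (ket m) n +
    M.atomPopulation β 0 * (M.exchangeAmp m * starRingEnd ℂ (M.exchangeAmp n)) *
      A (ket (m - 1)) (n - 1) +
    M.atomPopulation β 1 * (M.exchangeAmp (m + 1) * starRingEnd ℂ (M.exchangeAmp (n + 1))) *
      A (ket (m + 1)) (n + 1) := by
  rw [← inner_ket_left, heisenberg, inner_krausDual_apply]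
  simp only [Fintype.sum_prod_type, Fin.sum_univ_two, kraus_ground_ground, kraus_excited_excited,
    kraus_ground_excited, kraus_excited_ground hξ, map_smul, inner_smul_left, inner_smul_right,
    inner_ket_left]
  ring

theorem groundAmp_mul_conj_add (hξ : 0 < M.xi) (n : ℕ) :
    M.groundAmp n * starRingEnd ℂ (M.groundAmp n)
      + M.exchangeAmp n * starRingEnd ℂ (M.exchangeAmp n) = 1 := by
  rw [Complex.mul_conj', Complex.mul_conj']
  exact_mod_cast norm_sq_groundAmp_add hξ n

theorem excitedAmp_mul_conj_add (n : ℕ) :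
    M.excitedAmp n * starRingEnd ℂ (M.excitedAmp n)
      + M.exchangeAmp (n + 1) * starRingEnd ℂ (M.exchangeAmp (n + 1)) = 1 := by
  rw [Complex.mul_conj', Complex.mul_conj']
  exact_mod_cast M.norm_sq_excitedAmp_add n

theorem heisenberg_one (hξ : 0 < M.xi) (β : ℝ) : M.heisenberg β 1 = 1 := by
  refine clm_ext_entry fun n m => ?_
  rw [heisenberg_entry hξ]
  simp only [one_apply_eq_self, ket_apply]
  rcases eq_or_ne n m with rfl | h
  · have hpop : (M.atomPopulation β 0 : ℂ) + M.atomPopulation β 1 = 1 := by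
      exact_mod_cast M.atomPopulation_sum β
    simp only [if_true]
    linear_combination (M.atomPopulation β 0 : ℂ) * groundAmp_mul_conj_add hξ n
      + (M.atomPopulation β 1 : ℂ) * M.excitedAmp_mul_conj_add n + hpop
  · rcases m with _ | m
    · simp [h, exchangeAmp]
    · rcases n with _ | n
      · simp [exchangeAmp]
      · have h' : n ≠ m := fun h' => h (by rw [h'])
        simp [h']

theorem norm_heisenberg_le (hξ : 0 < M.xi) (β : ℝ) (A : Field →L[ℂ] Field) :
    ‖M.heisenberg β A‖ ≤ ‖A‖ := by
  have hone := heisenberg_one hξ β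
  rw [heisenberg] at hone ⊢
  refine norm_krausDual_le ?_ hone A
  exact fun p => (M.atomPopulation_pos β p.1).le

theorem norm_heisenberg_iterate_le (hξ : 0 < M.xi) (β : ℝ)
    (A : Field →L[ℂ] Field) (n : ℕ) : ‖(M.heisenberg β)^[n] A‖ ≤ ‖A‖ := by
  induction n with
  | zero => rfl
  | succ n ih =>
    rw [Function.iterate_succ_apply']
    exact (norm_heisenberg_le hξ β _).trans ih

theorem expect_rdm {ρ : Field →L[ℂ] Field} (h : IsState ρ) (β : ℝ) (A : Field →L[ℂ] Field) :
    expect (M.rdm β ρ) A = expect ρ (M.heisenberg β A) := by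
  rw [rdm_eq_krausMap]
  exact (h.hasSum_expect_krausMap A).tsum_eq

theorem isState_rdm (hξ : 0 < M.xi) (β : ℝ) {ρ : Field →L[ℂ] Field} (h : IsState ρ) :
    IsState (M.rdm β ρ) := by
  rw [rdm_eq_krausMap]
  exact h.krausMap (fun p => (M.atomPopulation_pos β p.1).le) (heisenberg_one hξ β)

theorem isState_rdm_iterate (hξ : 0 < M.xi) (β : ℝ) {ρ : Field →L[ℂ] Field}
    (h : IsState ρ) (n : ℕ) : IsState ((M.rdm β)^[n] ρ) :=
  Function.Iterate.rec IsState h (fun _ => isState_rdm hξ β) n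

theorem expect_rdm_iterate (hξ : 0 < M.xi) (β : ℝ)
    {ρ : Field →L[ℂ] Field} (h : IsState ρ) (n : ℕ) (A : Field →L[ℂ] Field) :
    expect ((M.rdm β)^[n] ρ) A = expect ρ ((M.heisenberg β)^[n] A) := by
  induction n generalizing A with
  | zero => rfl
  | succ n ih =>
    rw [Function.iterate_succ_apply', expect_rdm (isState_rdm_iterate hξ β h n), ih,
      ← Function.iterate_succ_apply]

end Maser

/-! ### Arithmetic of the resonances -/

section SquareMultiples

variable {c : ℝ}

theorem lt_iff_lt_of_mul_eq_sq (hc : 0 < c) {a b k l : ℕ} (ha : c * a = (k : ℝ) ^ 2)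
    (hb : c * b = (l : ℝ) ^ 2) : a < b ↔ k < l := by
  rw [← Nat.cast_lt (α := ℝ), ← mul_lt_mul_iff_right₀ hc, ha, hb,
    pow_lt_pow_iff_left₀ k.cast_nonneg l.cast_nonneg two_ne_zero, Nat.cast_lt]

theorem exists_mul_eq_mul {a b n k l j : ℕ} (hn : c * n = (j : ℝ) ^ 2) (hn0 : 0 < n)
    (ha : c * a = (k : ℝ) ^ 2) (hb : c * b = (l : ℝ) ^ 2) : ∃ t : ℕ, c * t = (k : ℝ) * l := by
  have hsq : (k * l * n) ^ 2 = a * b * (j ^ 2) ^ 2 := by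
    have : ((k : ℝ) * l * n) ^ 2 = a * b * ((j : ℝ) ^ 2) ^ 2 := by
      rw [mul_pow, mul_pow, ← ha, ← hb, ← hn]
      ring
    exact_mod_cast this
  obtain ⟨t, ht⟩ : j ^ 2 ∣ k * l * n := by
    rw [← Nat.pow_dvd_pow_iff two_ne_zero, hsq]
    exact Dvd.intro_left _ rfl
  have ht' : (k : ℝ) * l * n = c * n * t := by
    rw [hn]
    exact_mod_cast ht
  exact ⟨t, mul_right_cancel₀ (Nat.cast_ne_zero.2 hn0.ne') (by linear_combination -ht')⟩

theorem add_lt_of_sq_add_sq_eq {k₀ k₁ k₂ g : ℕ} (hg : 0 < g) (h₀₁ : k₀ < k₁)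
    (h : k₂ ^ 2 + k₁ ^ 2 = (k₁ + g) ^ 2 + k₀ ^ 2) : k₀ + g < k₂ := by
  by_contra hlt
  nlinarith

theorem exists_mul_eq_sq_between (hc : 0 < c) {m n d k₀ k₁ k₂ k₃ : ℕ} (hd : 0 < d) (hmn : m < n)
    (h₀ : c * m = (k₀ : ℝ) ^ 2) (h₁ : c * (m + d : ℕ) = (k₁ : ℝ) ^ 2)
    (h₂ : c * n = (k₂ : ℝ) ^ 2) (h₃ : c * (n + d : ℕ) = (k₃ : ℝ) ^ 2) :
    ∃ p k : ℕ, m < p ∧ p < n ∧ c * p = (k : ℝ) ^ 2 := by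
  obtain ⟨t₀₃, ht₀₃⟩ := exists_mul_eq_mul h₂ (by omega) h₀ h₃
  obtain ⟨t₀₁, ht₀₁⟩ := exists_mul_eq_mul h₂ (by omega) h₀ h₁
  obtain ⟨t₁₃, ht₁₃⟩ := exists_mul_eq_mul h₂ (by omega) h₁ h₃
  have h₀₁ : k₀ < k₁ := (lt_iff_lt_of_mul_eq_sq hc h₀ h₁).1 (by omega)
  obtain ⟨g, hg, rfl⟩ : ∃ g, 0 < g ∧ k₃ = k₁ + g := by
    have h₁₃ : k₁ < k₃ := (lt_iff_lt_of_mul_eq_sq hc h₁ h₃).1 (by omega)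
    exact ⟨k₃ - k₁, by omega, by omega⟩
  have hlt : k₀ + g < k₂ := by
    refine add_lt_of_sq_add_sq_eq hg h₀₁ ?_
    have : (k₂ : ℝ) ^ 2 + k₁ ^ 2 = ((k₁ + g : ℕ) : ℝ) ^ 2 + k₀ ^ 2 := by
      rw [← h₀, ← h₁, ← h₂, ← h₃]
      push_cast
      ring
    exact_mod_cast this
  -- The integer `(k₀ + g)² / c`, from expanding the square of `k₀ + g = k₀ + k₃ - k₁`.
  obtain ⟨N, hN⟩ : ∃ N : ℤ, c * N = ((k₀ + g : ℕ) : ℝ) ^ 2 := by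
    refine ⟨m + (n + d) + (m + d) + 2 * t₀₃ - 2 * t₀₁ - 2 * t₁₃, ?_⟩
    push_cast at *
    linear_combination h₀ + h₁ + h₃ + 2 * ht₀₃ - 2 * ht₀₁ - 2 * ht₁₃
  lift N to ℕ using by
    have : 0 ≤ c * N := hN ▸ sq_nonneg _
    exact_mod_cast nonneg_of_mul_nonneg_right this hc
  exact ⟨N, k₀ + g, (lt_iff_lt_of_mul_eq_sq hc h₀ hN).2 (by omega),
    (lt_iff_lt_of_mul_eq_sq hc hN h₂).2 hlt, hN⟩

end SquareMultiples

namespace Maser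

variable {M : Maser}

theorem zero_notMem_resonances : 0 ∉ M.resonances := fun h => by simpa using h.1

theorem isFullyResonant_of_lt (hξ : 0 < M.xi) {m n : ℕ}
    (hm : m ∈ M.resonances) (hn : n ∈ M.resonances) (hmn : m < n) : M.IsFullyResonant := by
  obtain ⟨hm1, k, hk⟩ := hm
  obtain ⟨-, l, hl⟩ := hn
  obtain ⟨s, rfl⟩ : ∃ s, n = m + s := ⟨n - m, by omega⟩
  have hs : 0 < s := by omega
  have hξs : M.xi * s = (l : ℝ) ^ 2 - k ^ 2 := by
    push_cast at hl
    linarith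
  have hkl : k ^ 2 < l ^ 2 := by
    have : (0 : ℝ) < (l : ℝ) ^ 2 - k ^ 2 := by
      rw [← hξs]
      positivity
    exact_mod_cast sub_pos.1 this
  obtain ⟨D, hD⟩ : ∃ D, l ^ 2 = k ^ 2 + D := ⟨l ^ 2 - k ^ 2, by omega⟩
  have hξD : (D : ℝ) = M.xi * s := by
    have : (l : ℝ) ^ 2 = k ^ 2 + D := by exact_mod_cast hD
    linarith
  -- `(k + (N + 1) D)²` exceeds `k²` by a multiple of `D = ξ s`, for every `N`.
  refine Set.infinite_of_forall_exists_gt fun N =>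
    ⟨m + s * (2 * k * (N + 1) + (N + 1) ^ 2 * D), ⟨by omega, k + (N + 1) * D, ?_⟩, ?_⟩
  · push_cast
    rw [hξD]
    linear_combination hk
  · have hN : N + 1 ≤ (N + 1) ^ 2 * D := by nlinarith [show 1 ≤ D by omega]
    have : 1 * (N + 1) ≤ s * (2 * k * (N + 1) + (N + 1) ^ 2 * D) :=
      Nat.mul_le_mul hs (by omega)
    omega

theorem exists_resonance_between (hξ : 0 < M.xi) (hη : M.eta = 0) {m n d : ℕ} (hd : 0 < d)
    (hm : m = 0 ∨ m ∈ M.resonances) (hn : n ∈ M.resonances) (hmn : m < n)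
    (hmd : m + d ∈ M.resonances) (hnd : n + d ∈ M.resonances) :
    ∃ p ∈ M.resonances, m < p ∧ p < n := by
  have mem_iff (p : ℕ) : p ∈ M.resonances ↔ 1 ≤ p ∧ ∃ k : ℕ, M.xi * p = (k : ℝ) ^ 2 := by
    simp [resonances, hη]
  obtain ⟨k₀, h₀⟩ : ∃ k : ℕ, M.xi * m = (k : ℝ) ^ 2 := by
    rcases hm with rfl | hm
    · exact ⟨0, by simp⟩
    · exact ((mem_iff m).1 hm).2
  obtain ⟨-, k₁, h₁⟩ := (mem_iff _).1 hmd
  obtain ⟨-, k₂, h₂⟩ := (mem_iff _).1 hn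
  obtain ⟨-, k₃, h₃⟩ := (mem_iff _).1 hnd
  obtain ⟨p, k, hmp, hpn, hp⟩ := exists_mul_eq_sq_between hξ hd hmn h₀ h₁ h₂ h₃
  exact ⟨p, (mem_iff p).2 ⟨by omega, k, hp⟩, hmp, hpn⟩

/-! ### Rabi sectors -/

variable (M) in
open Classical in
/-- The number of resonances that are at most `n`: the level `n` lies in the Rabi sector
`sectorIndex n + 1`, the sectors being numbered from one. -/
def sectorIndex (n : ℕ) : ℕ := Nat.count (· ∈ M.resonances) (n + 1)

theorem mem_rabiIndices {n k : ℕ} : n ∈ M.rabiIndices k ↔ M.sectorIndex n + 1 = k := Iff.rfl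

theorem sectorIndex_zero : M.sectorIndex 0 = 0 := by
  classical
  simp [sectorIndex, Nat.count_succ, zero_notMem_resonances]

open Classical in
theorem sectorIndex_succ (n : ℕ) :
    M.sectorIndex (n + 1) = M.sectorIndex n + if n + 1 ∈ M.resonances then 1 else 0 := by
  unfold sectorIndex
  rw [Nat.count_succ]

theorem sectorIndex_succ_of_mem {n : ℕ} (h : n + 1 ∈ M.resonances) :
    M.sectorIndex (n + 1) = M.sectorIndex n + 1 := by
  classical
  rw [sectorIndex_succ, if_pos h]

theorem sectorIndex_succ_of_notMem {n : ℕ} (h : n + 1 ∉ M.resonances) :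
    M.sectorIndex (n + 1) = M.sectorIndex n := by
  classical
  rw [sectorIndex_succ, if_neg h, add_zero]

theorem sectorIndex_mono : Monotone M.sectorIndex := monotone_nat_of_le_succ fun n => by
  classical
  exact sectorIndex_succ n ▸ Nat.le_add_right _ _

theorem sectorIndex_lt_of_mem {i j p : ℕ} (hp : p ∈ M.resonances) (hi : i < p) (hj : p ≤ j) :
    M.sectorIndex i < M.sectorIndex j := by
  obtain ⟨q, rfl⟩ := Nat.exists_eq_succ_of_ne_zero (Nat.ne_zero_of_lt hi)
  have hiq := M.sectorIndex_mono (Nat.le_of_lt_succ hi)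
  have hqj := M.sectorIndex_mono hj
  rw [sectorIndex_succ_of_mem hp] at hqj
  omega

theorem sectorIndex_eq_of_forall {i j : ℕ} (hij : i ≤ j)
    (h : ∀ p, i < p → p ≤ j → p ∉ M.resonances) : M.sectorIndex i = M.sectorIndex j := by
  induction j, hij using Nat.le_induction with
  | base => rfl
  | succ j hj ih =>
    rw [sectorIndex_succ_of_notMem (h _ (by omega) le_rfl)]
    exact ih fun p hip hpj => h p hip (by omega)

end Maser

/-! ### The dynamics of the diagonals -/

/-- The products `a m * conj (a (m + d))` of amplitudes by which the dynamics multiplies the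
matrix entries at distance `d` from the main diagonal. -/
def coherence (a : ℕ → ℂ) (d m : ℕ) : ℂ := a m * starRingEnd ℂ (a (m + d))

theorem coherence_ne_zero_iff {a : ℕ → ℂ} {d m : ℕ} :
    coherence a d m ≠ 0 ↔ a m ≠ 0 ∧ a (m + d) ≠ 0 := by
  simp [coherence]

theorem norm_mul_conj_add_le_one {a b c d : ℂ} (h : ‖a‖ ^ 2 + ‖b‖ ^ 2 = 1)
    (h' : ‖c‖ ^ 2 + ‖d‖ ^ 2 = 1) : ‖a * starRingEnd ℂ c‖ + ‖b * starRingEnd ℂ d‖ ≤ 1 := by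
  simp only [norm_mul, RCLike.norm_conj]
  nlinarith [sq_nonneg (‖a‖ - ‖c‖), sq_nonneg (‖b‖ - ‖d‖)]

theorem norm_eq_of_norm_mul_conj_add_eq_one {a b c d : ℂ} (h : ‖a‖ ^ 2 + ‖b‖ ^ 2 = 1)
    (h' : ‖c‖ ^ 2 + ‖d‖ ^ 2 = 1)
    (heq : ‖a * starRingEnd ℂ c‖ + ‖b * starRingEnd ℂ d‖ = 1) : ‖a‖ = ‖c‖ ∧ ‖b‖ = ‖d‖ := by
  simp only [norm_mul, RCLike.norm_conj] at heq
  have hsum : (‖a‖ - ‖c‖) ^ 2 + (‖b‖ - ‖d‖) ^ 2 = 0 := by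
    linear_combination h + h' - 2 * heq
  rw [add_eq_zero_iff_of_nonneg (sq_nonneg _) (sq_nonneg _)] at hsum
  simpa [sub_eq_zero] using hsum

theorem eq_of_mul_conj_eq_norm {a b : ℂ} (h : ‖a‖ = ‖b‖)
    (h' : a * starRingEnd ℂ b = ‖a * starRingEnd ℂ b‖) : a = b := by
  rcases eq_or_ne b 0 with rfl | hb
  · simpa using h
  · refine mul_right_cancel₀ ((map_ne_zero (starRingEnd ℂ)).2 hb) ?_
    rw [h', norm_mul, RCLike.norm_conj, h, Complex.mul_conj', Complex.ofReal_mul, sq]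

namespace Maser

variable {M : Maser}

theorem exchangeAmp_zero : M.exchangeAmp 0 = 0 := rfl

theorem coherence_exchangeAmp_zero (d : ℕ) : coherence M.exchangeAmp d 0 = 0 := by
  simp [coherence, exchangeAmp_zero]

theorem norm_coherence_groundAmp_add_le (hξ : 0 < M.xi) (d m : ℕ) :
    ‖coherence M.groundAmp d m‖ + ‖coherence M.exchangeAmp d m‖ ≤ 1 :=
  norm_mul_conj_add_le_one (norm_sq_groundAmp_add hξ m) (norm_sq_groundAmp_add hξ (m + d))

theorem norm_coherence_excitedAmp_add_le (d m : ℕ) :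
    ‖coherence M.excitedAmp d m‖ + ‖coherence M.exchangeAmp d (m + 1)‖ ≤ 1 := by
  rw [coherence, coherence, Nat.add_right_comm]
  exact norm_mul_conj_add_le_one (M.norm_sq_excitedAmp_add m) (M.norm_sq_excitedAmp_add (m + d))

variable (M) in
/-- The Heisenberg dynamics of the entries `⟨m+d|A|m⟩`, `m = 0, 1, …`, of an observable `A`. The
truncated `m - 1` at `m = 0` is harmless since `exchangeAmp 0 = 0`. -/
def diagHeisenberg (β : ℝ) (d : ℕ) : (ℕ → ℂ) →ₗ[ℂ] (ℕ → ℂ) where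
  toFun f m := (M.atomPopulation β 0 * coherence M.groundAmp d m +
      M.atomPopulation β 1 * coherence M.excitedAmp d m) * f m +
    M.atomPopulation β 0 * coherence M.exchangeAmp d m * f (m - 1) +
    M.atomPopulation β 1 * coherence M.exchangeAmp d (m + 1) * f (m + 1)
  map_add' f g := by
    ext m
    simp only [Pi.add_apply]
    ring
  map_smul' c f := by
    ext m
    simp only [Pi.smul_apply, smul_eq_mul, RingHom.id_apply]
    ring

theorem diagHeisenberg_apply (β : ℝ) (d : ℕ) (f : ℕ → ℂ) (m : ℕ) : M.diagHeisenberg β d f m =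
    (M.atomPopulation β 0 * coherence M.groundAmp d m +
      M.atomPopulation β 1 * coherence M.excitedAmp d m) * f m +
    M.atomPopulation β 0 * coherence M.exchangeAmp d m * f (m - 1) +
    M.atomPopulation β 1 * coherence M.exchangeAmp d (m + 1) * f (m + 1) := rfl

theorem diagHeisenberg_entry (hξ : 0 < M.xi) (β : ℝ) (d : ℕ) (A : Field →L[ℂ] Field) :
    M.diagHeisenberg β d (fun m => A (ket m) (m + d)) =
      fun m => M.heisenberg β A (ket m) (m + d) := by
  ext m
  rw [diagHeisenberg_apply, heisenberg_entry hξ, Nat.add_right_comm m d 1]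
  rcases m with _ | m
  · simp [coherence, exchangeAmp_zero]
  · rw [Nat.add_sub_cancel, Nat.add_right_comm m 1 d, Nat.add_sub_cancel]
    simp only [coherence, Nat.add_right_comm]

/- Detailed balance: conjugation by the weights `γᵐ` turns the Heisenberg dynamics of a diagonal
into the Schrödinger dynamics, see `rdm_entry`. -/
theorem pow_mul_diagHeisenberg (β : ℝ) (d : ℕ) (f : ℕ → ℂ) (m : ℕ) :
    (M.atomRatio β : ℂ) ^ m * M.diagHeisenberg β d f m =
    (M.atomPopulation β 0 * coherence M.groundAmp d m +
      M.atomPopulation β 1 * coherence M.excitedAmp d m) * ((M.atomRatio β : ℂ) ^ m * f m) +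
    M.atomPopulation β 0 * coherence M.exchangeAmp d (m + 1) *
      ((M.atomRatio β : ℂ) ^ (m + 1) * f (m + 1)) +
    M.atomPopulation β 1 * coherence M.exchangeAmp d m *
      ((M.atomRatio β : ℂ) ^ (m - 1) * f (m - 1)) := by
  have h : (M.atomPopulation β 1 : ℂ) = M.atomPopulation β 0 * M.atomRatio β := by
    exact_mod_cast M.atomPopulation_one β
  rw [diagHeisenberg_apply, h]
  rcases m with _ | m
  · rw [coherence_exchangeAmp_zero]
    ring
  · rw [Nat.add_sub_cancel]
    ring

theorem diagHeisenberg_eq_of_rdm_eq (hξ : 0 < M.xi) {β : ℝ} {ρ : Field →L[ℂ] Field}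
    (h : M.rdm β ρ = ρ) (d : ℕ) :
    M.diagHeisenberg β d (fun m => ((M.atomRatio β : ℂ) ^ m)⁻¹ * ρ (ket (m + d)) m) =
      fun m => ((M.atomRatio β : ℂ) ^ m)⁻¹ * ρ (ket (m + d)) m := by
  have hγ : (M.atomRatio β : ℂ) ≠ 0 := by exact_mod_cast (M.atomRatio_pos β).ne'
  ext m
  refine mul_left_cancel₀ (pow_ne_zero m hγ) ?_
  rw [pow_mul_diagHeisenberg]
  simp only [mul_inv_cancel_left₀ (pow_ne_zero _ hγ)]
  conv_rhs => rw [← h, rdm_entry hξ]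
  rw [Nat.add_right_comm m d 1]
  rcases m with _ | m
  · simp [coherence, exchangeAmp_zero]
  · rw [Nat.add_sub_cancel, Nat.add_right_comm m 1 d, Nat.add_sub_cancel]
    simp only [coherence, Nat.add_right_comm]

/-! ### Peripheral eigenvectors -/

/-- What it means for the levels `m` and `m + d` to be indistinguishable to the dynamics, as they
are wherever an eigenvector `f` of `diagHeisenberg` to a peripheral eigenvalue `z` does not vanish:
equal transition probabilities, coherent phases, and propagation of `f ≠ 0` to the neighbours. -/
structure PeripheralAt (M : Maser) (d : ℕ) (f : ℕ → ℂ) (z : ℂ) (m : ℕ) : Prop where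
  norm_ground : ‖M.groundAmp m‖ = ‖M.groundAmp (m + d)‖
  norm_exchange : ‖M.exchangeAmp m‖ = ‖M.exchangeAmp (m + d)‖
  norm_excited : ‖M.excitedAmp m‖ = ‖M.excitedAmp (m + d)‖
  norm_exchange_succ : ‖M.exchangeAmp (m + 1)‖ = ‖M.exchangeAmp (m + 1 + d)‖
  down : M.exchangeAmp m ≠ 0 → f (m - 1) ≠ 0
  up : M.exchangeAmp (m + 1) ≠ 0 → f (m + 1) ≠ 0
  phase_ground : coherence M.groundAmp d m = ‖coherence M.groundAmp d m‖ * z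
  phase_excited : coherence M.excitedAmp d m = ‖coherence M.excitedAmp d m‖ * z

theorem peripheralAt (hξ : 0 < M.xi) {β : ℝ} {d : ℕ} {f : ℕ → ℂ} {z : ℂ} (hz : 1 ≤ ‖z‖)
    (hf : M.diagHeisenberg β d f = z • f)
    (hlim : Tendsto (fun m => (M.atomRatio β : ℂ) ^ m * f m) atTop (𝓝 0)) {m : ℕ}
    (hm : f m ≠ 0) : PeripheralAt M d f z m := by
  have hγ : (M.atomRatio β : ℂ) ≠ 0 := by exact_mod_cast (M.atomRatio_pos β).ne'
  have ne_zero_iff (n : ℕ) : (M.atomRatio β : ℂ) ^ n * f n ≠ 0 ↔ f n ≠ 0 := by simp [hγ]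
  obtain ⟨hground, hexcited, hdown, hup, phase_ground, phase_excited⟩ :=
    tridiagonal_eigenvector_rigidity (M.atomPopulation_pos β 0) (M.atomPopulation_pos β 1)
      (M.atomPopulation_sum β) (coherence_exchangeAmp_zero d)
      (norm_coherence_groundAmp_add_le hξ d) (norm_coherence_excitedAmp_add_le d) hlim hz
      (fun m => by
        rw [← pow_mul_diagHeisenberg, hf, Pi.smul_apply, smul_eq_mul]
        ring)
      ((ne_zero_iff m).2 hm)
  obtain ⟨norm_ground, norm_exchange⟩ := norm_eq_of_norm_mul_conj_add_eq_one
    (norm_sq_groundAmp_add hξ m) (norm_sq_groundAmp_add hξ (m + d)) hground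
  have hunit := M.norm_sq_excitedAmp_add (m + d)
  rw [Nat.add_right_comm] at hunit
  obtain ⟨norm_excited, norm_exchange_succ⟩ :=
    norm_eq_of_norm_mul_conj_add_eq_one (M.norm_sq_excitedAmp_add m) hunit hexcited
  refine ⟨norm_ground, norm_exchange, norm_excited, norm_exchange_succ,
    fun h => (ne_zero_iff _).1 (hdown (coherence_ne_zero_iff.2 ⟨h, ?_⟩)),
    fun h => (ne_zero_iff _).1 (hup (coherence_ne_zero_iff.2 ⟨h, ?_⟩)), phase_ground,
    phase_excited⟩
  · rwa [← norm_ne_zero_iff, ← norm_exchange, norm_ne_zero_iff]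
  · rwa [← norm_ne_zero_iff, ← norm_exchange_succ, norm_ne_zero_iff]

section Peripheral

variable {d : ℕ} {f : ℕ → ℂ} {z : ℂ}

theorem exists_ne_zero_of_exchangeAmp_eq_zero
    (hf : ∀ m, f m ≠ 0 → M.exchangeAmp m ≠ 0 → f (m - 1) ≠ 0) {m : ℕ} (hm : f m ≠ 0) :
    ∃ n, f n ≠ 0 ∧ M.exchangeAmp n = 0 := by
  induction m with
  | zero => exact ⟨0, hm, exchangeAmp_zero⟩
  | succ m ih =>
    by_cases h : M.exchangeAmp (m + 1) = 0
    · exact ⟨m + 1, hm, h⟩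
    · exact ih (hf _ hm h)

theorem exists_add_mem_resonances (hξ : 0 < M.xi) (hd : 0 < d)
    (hp : ∀ m, f m ≠ 0 → PeripheralAt M d f z m) {m : ℕ} (hm : f m ≠ 0) :
    ∃ n, f n ≠ 0 ∧ (n = 0 ∨ n ∈ M.resonances) ∧ n + d ∈ M.resonances := by
  obtain ⟨n, hfn, hn⟩ := exists_ne_zero_of_exchangeAmp_eq_zero (fun m hm => (hp m hm).down) hm
  have hnd := (hp n hfn).norm_exchange
  rw [hn, norm_zero, eq_comm, norm_eq_zero, exchangeAmp_eq_zero_iff hξ] at hnd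
  exact ⟨n, hfn, (exchangeAmp_eq_zero_iff hξ n).1 hn, hnd.resolve_left (by omega)⟩

theorem ne_zero_of_forall_notMem_resonances (hξ : 0 < M.xi)
    (hp : ∀ m, f m ≠ 0 → PeripheralAt M d f z m) {m n : ℕ} (hm : f m ≠ 0) (hmn : m ≤ n)
    (hgap : ∀ p, m < p → p ≤ n → p ∉ M.resonances) : f n ≠ 0 := by
  induction n, hmn using Nat.le_induction with
  | base => exact hm
  | succ n hmn ih =>
    refine (hp n (ih fun p hmp hpn => hgap p hmp (by omega))).up ?_
    rw [Ne, exchangeAmp_eq_zero_iff hξ]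
    simpa using hgap (n + 1) (by omega) le_rfl

theorem add_mem_resonances_of_succ_mem (hξ : 0 < M.xi) {m : ℕ} (hp : PeripheralAt M d f z m)
    (hm : m + 1 ∈ M.resonances) : m + 1 + d ∈ M.resonances := by
  have h := hp.norm_exchange_succ
  rw [(exchangeAmp_eq_zero_iff hξ _).2 (Or.inr hm), norm_zero, eq_comm, norm_eq_zero,
    exchangeAmp_eq_zero_iff hξ] at h
  exact h.resolve_left (by omega)

theorem eta_eq_zero_of_peripheralAt_succ (hξ : 0 < M.xi) (hd : 0 < d) {m : ℕ}
    (hm : PeripheralAt M d f 1 m) (hm' : PeripheralAt M d f 1 (m + 1))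
    (hres : m + 1 ∉ M.resonances) : M.eta = 0 := by
  by_contra hη
  have hexcited := eq_of_mul_conj_eq_norm hm.norm_excited (hm.phase_excited.trans (mul_one _))
  have hground := eq_of_mul_conj_eq_norm hm'.norm_ground (hm'.phase_ground.trans (mul_one _))
  rw [Nat.add_right_comm] at hground
  have := eq_of_amp_eq hξ hη hres hground hexcited
  omega

/- Below the first resonance `n` above a level `m` with `m`, `m + d` resonant, `f` does not vanish,
so `n + d` is resonant too. Without detuning such pairs leave room for a resonance between `m` and
`n`; with detuning the phases force `n = m + 1`, which makes the system degenerate. -/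
theorem eq_zero_of_peripheralAt_one (hξ : 0 < M.xi) (hM : ¬ M.IsDegenerate) (hd : 0 < d)
    (hp : ∀ m, f m ≠ 0 → PeripheralAt M d f 1 m) : f = 0 := by
  classical
  by_contra hf
  obtain ⟨k, hk⟩ := Function.ne_iff.1 hf
  obtain ⟨m, hfm, hm, hmd⟩ := exists_add_mem_resonances hξ hd hp hk
  have hex : ∃ n, m < n ∧ n ∈ M.resonances := ⟨m + d, by omega, hmd⟩
  obtain ⟨q, hmq, hq, hgap⟩ : ∃ q, m ≤ q ∧ q + 1 ∈ M.resonances ∧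
      ∀ p, m < p → p < q + 1 → p ∉ M.resonances := by
    obtain ⟨q, hq⟩ : ∃ q, Nat.find hex = q + 1 :=
      Nat.exists_eq_succ_of_ne_zero (by have := (Nat.find_spec hex).1; omega)
    have hspec := Nat.find_spec hex
    rw [hq] at hspec
    exact ⟨q, by omega, hspec.2, fun p hmp hpq hpR => Nat.find_min hex (hq ▸ hpq) ⟨hmp, hpR⟩⟩
  have hne (p : ℕ) (hmp : m ≤ p) (hpq : p ≤ q) : f p ≠ 0 :=
    ne_zero_of_forall_notMem_resonances hξ hp hfm hmp fun r hmr hrp => hgap r hmr (by omega)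
  have hqd := add_mem_resonances_of_succ_mem hξ (hp q (hne q hmq le_rfl)) hq
  rcases hmq.eq_or_lt with rfl | hlt
  · rw [Nat.add_right_comm] at hqd
    exact hM ⟨isFullyResonant_of_lt hξ hq hqd (by omega), m, m + d, hm, hmd, by omega, hq, hqd⟩
  · have hη := eta_eq_zero_of_peripheralAt_succ hξ hd (hp m hfm)
      (hp (m + 1) (hne _ (by omega) hlt)) (hgap _ (by omega) (by omega))
    obtain ⟨p, hpR, hmp, hpq⟩ :=
      exists_resonance_between hξ hη hd hm hq (by omega) hmd hqd
    exact hgap p hmp hpq hpR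

end Peripheral

theorem eq_zero_of_not_isDegenerate (hξ : 0 < M.xi) (hM : ¬ M.IsDegenerate) {β : ℝ} {d : ℕ}
    (hd : 0 < d) {f : ℕ → ℂ} (hf : M.diagHeisenberg β d f = f)
    (hlim : Tendsto (fun m => (M.atomRatio β : ℂ) ^ m * f m) atTop (𝓝 0)) : f = 0 :=
  eq_zero_of_peripheralAt_one hξ hM hd fun _ =>
    peripheralAt hξ norm_one.ge (by rwa [one_smul]) hlim

theorem eq_zero_of_sectorIndex_eq (hξ : 0 < M.xi) {β : ℝ} {d : ℕ} (hd : 0 < d) {f : ℕ → ℂ}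
    {z : ℂ} (hz : 1 ≤ ‖z‖) (hf : M.diagHeisenberg β d f = z • f)
    (hlim : Tendsto (fun m => (M.atomRatio β : ℂ) ^ m * f m) atTop (𝓝 0))
    (hsec : ∀ m, f m ≠ 0 → M.sectorIndex m = M.sectorIndex (m + d)) : f = 0 := by
  by_contra hne
  obtain ⟨m, hm⟩ := Function.ne_iff.1 hne
  obtain ⟨n, hfn, -, hnd⟩ :=
    exists_add_mem_resonances hξ hd (fun _ => peripheralAt hξ hz hf hlim) hm
  exact (sectorIndex_lt_of_mem hnd (by omega) le_rfl).ne (hsec n hfn)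

/-! ### Invariance of the Rabi sectors -/

theorem exchangeAmp_mul_sub_eq_zero (hξ : 0 < M.xi) {β : ℝ} {f : ℕ → ℂ}
    (hf : M.diagHeisenberg β 0 f = f) (m : ℕ) :
    coherence M.exchangeAmp 0 m * (f m - f (m - 1)) = 0 := by
  have hne : (M.atomPopulation β 1 : ℂ) ≠ 0 := by exact_mod_cast (M.atomPopulation_pos β 1).ne'
  have hsum : (M.atomPopulation β 0 : ℂ) + M.atomPopulation β 1 = 1 := by
    exact_mod_cast M.atomPopulation_sum β
  induction m with
  | zero => simp
  | succ m ih =>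
    have hfm := congrFun hf m
    rw [diagHeisenberg_apply] at hfm
    simp only [coherence, add_zero, Nat.add_sub_cancel] at hfm ih ⊢
    refine (mul_eq_zero.1 (?_ : (M.atomPopulation β 1 : ℂ) * _ = 0)).resolve_left hne
    linear_combination hfm + (M.atomPopulation β 0 : ℂ) * ih
      - f m * ((M.atomPopulation β 0 : ℂ) * groundAmp_mul_conj_add hξ m
        + (M.atomPopulation β 1 : ℂ) * M.excitedAmp_mul_conj_add m + hsum)

theorem eq_of_sectorIndex_eq (hξ : 0 < M.xi) {β : ℝ} {f : ℕ → ℂ}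
    (hf : M.diagHeisenberg β 0 f = f) {i j : ℕ} (h : M.sectorIndex i = M.sectorIndex j) :
    f i = f j := by
  wlog hij : i ≤ j generalizing i j
  · exact (this h.symm (by omega)).symm
  induction j, hij using Nat.le_induction with
  | base => rfl
  | succ j hij ih =>
    have hj : j + 1 ∉ M.resonances := fun hR =>
      (sectorIndex_lt_of_mem (i := i) hR (by omega) le_rfl).ne h
    have hne : M.exchangeAmp (j + 1) ≠ 0 := by simp [exchangeAmp_eq_zero_iff hξ, hj]
    have hstep := (mul_eq_zero.1 (exchangeAmp_mul_sub_eq_zero hξ hf (j + 1))).resolve_left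
      (coherence_ne_zero_iff.2 ⟨hne, hne⟩)
    rw [ih (by rw [h, sectorIndex_succ_of_notMem hj])]
    exact (sub_eq_zero.1 hstep).symm

theorem diagHeisenberg_indicator {d : ℕ} {S : Set ℕ}
    (hS : ∀ m, coherence M.exchangeAmp d (m + 1) ≠ 0 → (m ∈ S ↔ m + 1 ∈ S)) (β : ℝ)
    (f : ℕ → ℂ) :
    M.diagHeisenberg β d (S.indicator f) = S.indicator (M.diagHeisenberg β d f) := by
  classical
  have up (m : ℕ) : coherence M.exchangeAmp d (m + 1) * S.indicator f (m + 1) =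
      coherence M.exchangeAmp d (m + 1) * if m ∈ S then f (m + 1) else 0 := by
    by_cases h : coherence M.exchangeAmp d (m + 1) = 0
    · rw [h, zero_mul, zero_mul]
    · simp only [Set.indicator_apply, hS m h]
  have down (m : ℕ) : coherence M.exchangeAmp d m * S.indicator f (m - 1) =
      coherence M.exchangeAmp d m * if m ∈ S then f (m - 1) else 0 := by
    rcases m with _ | m
    · simp [coherence_exchangeAmp_zero]
    · by_cases h : coherence M.exchangeAmp d (m + 1) = 0
      · rw [h, zero_mul, zero_mul]
      · simp only [Set.indicator_apply, Nat.add_sub_cancel, hS m h]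
  ext m
  rw [diagHeisenberg_apply, mul_assoc _ _ (S.indicator f (m - 1)),
    mul_assoc _ _ (S.indicator f (m + 1)), up, down, Set.indicator_apply, Set.indicator_apply,
    diagHeisenberg_apply]
  split_ifs <;> ring

theorem diagHeisenberg_indicator_sectorIndex (hξ : 0 < M.xi) (β : ℝ) (d a b : ℕ) (f : ℕ → ℂ) :
    M.diagHeisenberg β d ({m | M.sectorIndex m = a ∧ M.sectorIndex (m + d) = b}.indicator f) =
      {m | M.sectorIndex m = a ∧ M.sectorIndex (m + d) = b}.indicator
        (M.diagHeisenberg β d f) := by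
  refine diagHeisenberg_indicator (fun m hm => ?_) β f
  rw [coherence_ne_zero_iff, Ne, Ne, exchangeAmp_eq_zero_iff hξ, exchangeAmp_eq_zero_iff hξ,
    Nat.add_right_comm] at hm
  push Not at hm
  simp only [Set.mem_ofPred_eq]
  rw [sectorIndex_succ_of_notMem hm.1.2, Nat.add_right_comm, sectorIndex_succ_of_notMem hm.2.2]

end Maser

/-! ### Weak operator convergence and expectations -/

section WeakConvergence

variable {ι α : Type} [DecidableEq ι] {l : Filter α} {C : ℝ} {J : Set ι}

theorem hasSum_smul_ket (x : Ell2 ι) : HasSum (fun i => x i • (ket i : Ell2 ι)) x := by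
  refine (lp.hasSum_single (by norm_num) x).congr_fun fun i => ?_
  rw [ket, ← lp.single_smul, smul_eq_mul, mul_one]

theorem norm_entry_le (T : Ell2 ι →L[ℂ] Ell2 ι) (i j : ι) : ‖T (ket i) j‖ ≤ ‖T‖ := by
  rw [← inner_ket_left]
  refine (norm_inner_le_norm _ _).trans ?_
  simpa [norm_ket] using T.le_opNorm (ket i)

theorem tendsto_apply_zero_of_tendsto_ket {φ : α → Ell2 ι →L[ℂ] ℂ} (hφ : ∀ a, ‖φ a‖ ≤ C)
    (hJ : ∀ i ∈ J, Tendsto (fun a => φ a (ket i)) l (𝓝 0)) {x : Ell2 ι}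
    (hx : ∀ i ∉ J, x i = 0) : Tendsto (fun a => φ a x) l (𝓝 0) := by
  have equicontinuous_iff_bounded : Equicontinuous ((↑) ∘ φ) ↔ ∃ C, ∀ a, ‖φ a‖ ≤ C :=
    (NormedSpace.equicontinuous_TFAE φ).out 1 5
  have hequicontinuous := equicontinuous_iff_bounded.2 ⟨C, hφ⟩
  refine (hequicontinuous.isClosed_setOfPred_tendsto continuous_const).mem_of_tendsto
    (hasSum_smul_ket x) (Eventually.of_forall fun s => ?_)
  change Tendsto (fun a => φ a (∑ i ∈ s, x i • ket i)) l (𝓝 0)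
  simp only [map_sum, map_smul]
  rw [← Finset.sum_const_zero (s := s)]
  refine tendsto_finsetSum _ fun i _ => ?_
  by_cases hi : i ∈ J
  · simpa using (hJ i hi).const_smul (x i)
  · simpa [hx i hi] using tendsto_const_nhds

theorem tendsto_inner_zero_of_tendsto_entry {D : α → Ell2 ι →L[ℂ] Ell2 ι}
    (hD : ∀ a, ‖D a‖ ≤ C)
    (hJ : ∀ i ∈ J, ∀ j ∈ J, Tendsto (fun a => D a (ket i) j) l (𝓝 0)) {x y : Ell2 ι}
    (hx : ∀ i ∉ J, x i = 0) (hy : ∀ i ∉ J, y i = 0) :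
    Tendsto (fun a => ⟪D a x, y⟫_ℂ) l (𝓝 0) := by
  have hentry : ∀ j ∈ J, Tendsto (fun a => D a x j) l (𝓝 0) := by
    intro j hj
    refine (tendsto_apply_zero_of_tendsto_ket (φ := fun a => innerSL ℂ (ket j) ∘L D a) (C := C)
      (fun a => ?_) (fun i hi => ?_) hx).congr fun a => inner_ket_left j (D a x)
    · refine (ContinuousLinearMap.opNorm_comp_le _ _).trans ?_
      rw [innerSL_apply_norm, norm_ket, one_mul]
      exact hD a
    · exact (hJ i hi j hj).congr fun a => (inner_ket_left j (D a (ket i))).symm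
  refine tendsto_apply_zero_of_tendsto_ket (φ := fun a => innerSL ℂ (D a x)) (C := C * ‖x‖)
    (fun a => ?_) (fun i hi => ?_) hy
  · rw [innerSL_apply_norm]
    exact (D a).le_of_opNorm_le (hD a) x
  · have hstar := (hentry i hi).star
    rw [star_zero] at hstar
    exact hstar.congr fun a => (inner_ket_right i (D a x)).symm

end WeakConvergence

theorem diagOp_ket (f : ℕ → ℂ) (hf : ∃ C : ℝ, ∀ n, ‖f n‖ ≤ C) (n : ℕ) :
    diagOp f hf (ket n) = f n • ket n := by
  ext m
  rw [diagOp_apply]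
  by_cases h : m = n
  · subst h; simp
  · simp [ket_apply, h]

theorem sqrt_ket_apply_eq_zero {ρ S : Field →L[ℂ] Field}
    (hS : ContinuousLinearMap.adjoint S = S) (hSS : S ∘L S = ρ) {i : ℕ}
    (hi : population ρ i = 0) (m : ℕ) : S (ket m) i = 0 := by
  rw [population_eq_norm_sq hS hSS, sq_eq_zero_iff, norm_eq_zero] at hi
  rw [← hS, adjoint_apply_ket, hi]
  simp

namespace IsState

variable {ρ : Field →L[ℂ] Field}

theorem norm_expect_le (h : IsState ρ) (A : Field →L[ℂ] Field) : ‖expect ρ A‖ ≤ ‖A‖ := by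
  obtain ⟨S, hS, hSS, hs⟩ := h.exists_sqrt
  rw [← (hasSum_expect_of_sqrt hS hSS hs.summable A).tsum_eq]
  refine tsum_of_norm_bounded (by simpa using hs.mul_left ‖A‖) fun m => ?_
  calc ‖⟪S (ket m), A (S (ket m))⟫_ℂ‖ ≤ ‖S (ket m)‖ * (‖A‖ * ‖S (ket m)‖) :=
        (norm_inner_le_norm _ _).trans (by gcongr; exact A.le_opNorm _)
    _ = ‖A‖ * ‖S (ket m)‖ ^ 2 := by ring

theorem expect_sub (h : IsState ρ) (A B : Field →L[ℂ] Field) :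
    expect ρ (A - B) = expect ρ A - expect ρ B := by
  rw [← ((h.hasSum_expect A).sub (h.hasSum_expect B)).tsum_eq]
  exact tsum_congr fun n => by rw [_root_.sub_apply, map_sub, inner_sub_right]

theorem hasSum_expect_diagOp (h : IsState ρ) (f : ℕ → ℂ) (hf : ∃ C : ℝ, ∀ n, ‖f n‖ ≤ C) :
    HasSum (fun n => population ρ n * f n) (expect ρ (diagOp f hf)) := by
  refine (h.hasSum_expect _).congr_fun fun n => ?_
  rw [diagOp_ket, map_smul, inner_smul_right, inner_ket_left, h.entry_self, mul_comm]

theorem tendsto_expect_zero (h : IsState ρ) {J : Set ℕ} (hρJ : ∀ i ∉ J, population ρ i = 0)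
    {D : ℕ → Field →L[ℂ] Field} {C : ℝ} (hD : ∀ N, ‖D N‖ ≤ C)
    (hJ : ∀ i ∈ J, ∀ j ∈ J, Tendsto (fun N => D N (ket i) j) atTop (𝓝 0)) :
    Tendsto (fun N => expect ρ (D N)) atTop (𝓝 0) := by
  obtain ⟨S, hS, hSS, hs⟩ := h.exists_sqrt
  have hsupp (m i : ℕ) (hi : i ∉ J) : S (ket m) i = 0 := sqrt_ket_apply_eq_zero hS hSS (hρJ i hi) m
  simp only [← (hasSum_expect_of_sqrt hS hSS hs.summable (D _)).tsum_eq]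
  rw [← tsum_zero (α := ℂ) (β := ℕ) (L := .unconditional ℕ)]
  refine tendsto_tsum_of_dominated_convergence (hs.summable.mul_left C) (fun m => ?_)
    (Eventually.of_forall fun N m => ?_)
  · simpa only [RCLike.star_def, inner_conj_symm, map_zero] using
      (tendsto_inner_zero_of_tendsto_entry hD hJ (hsupp m) (hsupp m)).star
  · calc ‖⟪S (ket m), D N (S (ket m))⟫_ℂ‖ ≤ ‖S (ket m)‖ * (C * ‖S (ket m)‖) :=
          (norm_inner_le_norm _ _).trans (by gcongr; exact (D N).le_of_opNorm_le (hD N) _)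
      _ = C * ‖S (ket m)‖ ^ 2 := by ring

theorem tendsto_expect (h : IsState ρ) {J : Set ℕ} (hρJ : ∀ i ∉ J, population ρ i = 0)
    {B : ℕ → Field →L[ℂ] Field} {C : ℝ} (hB : ∀ N, ‖B N‖ ≤ C) {t : ℕ → ℂ}
    (ht : ∃ C : ℝ, ∀ n, ‖t n‖ ≤ C)
    (hdiag : ∀ i ∈ J, Tendsto (fun N => B N (ket i) i) atTop (𝓝 (t i)))
    (hoff : ∀ i ∈ J, ∀ j ∈ J, i ≠ j → Tendsto (fun N => B N (ket i) j) atTop (𝓝 0)) :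
    Tendsto (fun N => expect ρ (B N)) atTop (𝓝 (∑' n, population ρ n * t n)) := by
  have hentry (N i j : ℕ) :
      (B N - diagOp t ht) (ket i) j = B N (ket i) j - if j = i then t i else 0 := by
    rw [_root_.sub_apply, diagOp_ket]
    change B N (ket i) j - t i * (ket i : Field) j = _
    rw [ket_apply, mul_ite, mul_one, mul_zero]
  have hsub : Tendsto (fun N => expect ρ (B N - diagOp t ht)) atTop (𝓝 0) := by
    refine h.tendsto_expect_zero hρJ (C := C + ‖diagOp t ht‖)
      (fun N => (norm_sub_le _ _).trans (by gcongr; exact hB N)) fun i hi j hj => ?_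
    simp only [hentry]
    rcases eq_or_ne j i with rfl | hji
    · simpa using (hdiag j hj).sub_const (t j)
    · simpa [hji] using hoff i hi j hj hji.symm
  rw [(h.hasSum_expect_diagOp t ht).tsum_eq]
  simpa only [h.expect_sub, sub_add_cancel, zero_add] using
    hsub.add_const (expect ρ (diagOp t ht))

end IsState

/-! ### Time averages -/

theorem norm_birkhoffAverage_le {α V : Type*} [NormedAddCommGroup V] [NormedSpace ℂ V]
    {T : α → α} {g : α → V} {x : α} {C : ℝ} (hg : ∀ n, ‖g (T^[n] x)‖ ≤ C) (N : ℕ) :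
    ‖birkhoffAverage ℂ T g N x‖ ≤ C := by
  rcases Nat.eq_zero_or_pos N with rfl | hN
  · simpa using (norm_nonneg _).trans (hg 0)
  have hsum : ‖birkhoffSum T g N x‖ ≤ N * C :=
    (norm_sum_le _ _).trans ((Finset.sum_le_sum fun n _ => hg n).trans_eq (by simp))
  rw [birkhoffAverage, norm_smul, norm_inv, Complex.norm_natCast,
    inv_mul_le_iff₀ (by exact_mod_cast hN)]
  exact hsum

theorem IsState.expect_birkhoffAverage {ρ : Field →L[ℂ] Field} (h : IsState ρ)
    (T : (Field →L[ℂ] Field) → (Field →L[ℂ] Field)) (N : ℕ) (A : Field →L[ℂ] Field) :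
    expect ρ (birkhoffAverage ℂ T id N A) = birkhoffAverage ℂ T (expect ρ) N A := by
  simp only [birkhoffAverage, birkhoffSum, expect_smul, h.expect_sum, id, smul_eq_mul]

namespace Maser

variable {M : Maser}

variable (M) in
/-- The Cesàro mean of the dynamics in the Heisenberg picture, over the times `1, …, N`. -/
def heisenbergMean (β : ℝ) (A : Field →L[ℂ] Field) (N : ℕ) : Field →L[ℂ] Field :=
  birkhoffAverage ℂ (M.heisenberg β) id N (M.heisenberg β A)

theorem norm_heisenbergMean_le (hξ : 0 < M.xi) (β : ℝ) (A : Field →L[ℂ] Field) (N : ℕ) :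
    ‖M.heisenbergMean β A N‖ ≤ ‖A‖ :=
  norm_birkhoffAverage_le
    (fun n => (norm_heisenberg_iterate_le hξ β _ n).trans (norm_heisenberg_le hξ β A)) N

theorem heisenbergMean_adjoint (β : ℝ) (A : Field →L[ℂ] Field) (N : ℕ) :
    M.heisenbergMean β (ContinuousLinearMap.adjoint A) N =
      ContinuousLinearMap.adjoint (M.heisenbergMean β A N) := by
  have hsemiconj : Function.Semiconj
      (ContinuousLinearMap.adjoint : (Field →L[ℂ] Field) → (Field →L[ℂ] Field))
      (M.heisenberg β) (M.heisenberg β) := fun A => (krausDual_adjoint A).symm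
  rw [heisenbergMean, heisenbergMean, ← hsemiconj.eq, map_birkhoffAverage ℂ ℂ]
  simp only [birkhoffAverage, birkhoffSum, Function.comp_apply, id,
    (hsemiconj.iterate_right _).eq]

theorem cesaroMean_rdm (hξ : 0 < M.xi) (β : ℝ) {ρ : Field →L[ℂ] Field} (h : IsState ρ)
    (A : Field →L[ℂ] Field) :
    cesaroMean (M.rdm β) ρ A = fun N => expect ρ (M.heisenbergMean β A N) := by
  ext N
  rw [cesaroMean, heisenbergMean, h.expect_birkhoffAverage, birkhoffAverage, birkhoffSum, one_div,
    smul_eq_mul, Finset.range_eq_Ico]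
  simp only [expect_rdm_iterate hξ β h, ← Function.iterate_succ_apply, Nat.succ_eq_add_one]
  rw [Finset.sum_Ico_add' (fun n => expect ρ ((M.heisenberg β)^[n] A)), zero_add]
  rfl

theorem tendsto_heisenberg_heisenbergMean_sub (hξ : 0 < M.xi) (β : ℝ) (A : Field →L[ℂ] Field) :
    Tendsto (fun N => M.heisenberg β (M.heisenbergMean β A N) - M.heisenbergMean β A N) atTop
      (𝓝 0) := by
  have hbounded : Bornology.IsBounded
      (Set.range fun n => id ((M.heisenberg β)^[n] (M.heisenberg β A))) :=
    (Metric.isBounded_closedBall (x := 0) (r := ‖M.heisenberg β A‖)).subset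
      (Set.range_subset_iff.2 fun n =>
        mem_closedBall_zero_iff.2 (norm_heisenberg_iterate_le hξ β _ n))
  refine (tendsto_birkhoffAverage_apply_sub_birkhoffAverage ℂ hbounded).congr fun N => ?_
  rw [heisenbergMean, map_birkhoffAverage ℂ ℂ]
  simp only [birkhoffAverage, birkhoffSum, Function.comp_apply, id,
    ← Function.iterate_succ_apply, ← Function.iterate_succ_apply']

theorem exists_tendsto_heisenbergMean_entry (hξ : 0 < M.xi) (β : ℝ) (A : Field →L[ℂ] Field)
    (U : Ultrafilter ℕ) (i j : ℕ) : ∃ z : ℂ, ‖z‖ ≤ ‖A‖ ∧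
      Tendsto (fun N => M.heisenbergMean β A N (ket i) j) U (𝓝 z) := by
  obtain ⟨z, hz, hlim⟩ := (isCompact_closedBall (0 : ℂ) ‖A‖).ultrafilter_le_nhds
    (U.map fun N => M.heisenbergMean β A N (ket i) j) (by
      rw [Ultrafilter.coe_map, le_principal_iff, mem_map]
      refine univ_mem' fun N => mem_closedBall_zero_iff.2 ?_
      exact (norm_entry_le _ _ _).trans (norm_heisenbergMean_le hξ β A N))
  exact ⟨z, mem_closedBall_zero_iff.1 hz, hlim⟩

theorem exists_stationary_limit (hξ : 0 < M.xi) (β : ℝ) (d : ℕ) (A : Field →L[ℂ] Field)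
    {U : Ultrafilter ℕ} (hU : (U : Filter ℕ) ≤ atTop) :
    ∃ g : ℕ → ℂ, (∀ m, Tendsto (fun N => M.heisenbergMean β A N (ket m) (m + d)) U (𝓝 (g m))) ∧
      M.diagHeisenberg β d g = g ∧ ∀ m, ‖g m‖ ≤ ‖A‖ := by
  choose g hbound hlim using fun m => exists_tendsto_heisenbergMean_entry hξ β A U m (m + d)
  refine ⟨g, hlim, ?_, hbound⟩
  ext m
  have hlim_heisenberg : Tendsto (fun N => M.heisenberg β (M.heisenbergMean β A N) (ket m) (m + d))
      U (𝓝 (M.diagHeisenberg β d g m)) := by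
    simp only [← congrFun (diagHeisenberg_entry hξ β d _) m, diagHeisenberg_apply]
    exact (((hlim m).const_mul _).add ((hlim (m - 1)).const_mul _)).add
      ((hlim (m + 1)).const_mul _)
  have hsub : Tendsto (fun N => M.heisenberg β (M.heisenbergMean β A N) (ket m) (m + d) -
      M.heisenbergMean β A N (ket m) (m + d)) U (𝓝 0) :=
    (squeeze_zero_norm (fun N => norm_entry_le
      (M.heisenberg β (M.heisenbergMean β A N) - M.heisenbergMean β A N) m (m + d))
      (tendsto_zero_iff_norm_tendsto_zero.1
        (tendsto_heisenberg_heisenbergMean_sub hξ β A))).mono_left hU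
  exact sub_eq_zero.1 (tendsto_nhds_unique (hlim_heisenberg.sub (hlim m)) hsub)

end Maser

/-! ### Gibbs states -/

theorem adjoint_diagOp (f : ℕ → ℝ) (hf : ∃ C : ℝ, ∀ n, ‖(f n : ℂ)‖ ≤ C) :
    ContinuousLinearMap.adjoint (diagOp (fun n => (f n : ℂ)) hf) =
      diagOp (fun n => (f n : ℂ)) hf := by
  refine clm_ext_entry fun m n => ?_
  rw [adjoint_apply_ket, diagOp_apply, diagOp_apply, map_mul, Complex.conj_ofReal, ket_apply,
    ket_apply]
  rcases eq_or_ne m n with rfl | h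
  · simp
  · simp [h, h.symm]

theorem isPositive_diagOp (f : ℕ → ℝ) (hf : ∃ C : ℝ, ∀ n, ‖(f n : ℂ)‖ ≤ C)
    (hnonneg : ∀ n, 0 ≤ f n) : (diagOp (fun n => (f n : ℂ)) hf).IsPositive := by
  have hsqrt : ∃ C : ℝ, ∀ n, ‖((√(f n) : ℝ) : ℂ)‖ ≤ C := by
    obtain ⟨C, hC⟩ := hf
    refine ⟨√C, fun n => ?_⟩
    rw [Complex.norm_real, Real.norm_of_nonneg (Real.sqrt_nonneg _)]
    exact Real.sqrt_le_sqrt ((le_abs_self _).trans (by simpa using hC n))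
  have hpos := ContinuousLinearMap.isPositive_adjoint_comp_self
    (diagOp (fun n => ((√(f n) : ℝ) : ℂ)) hsqrt)
  rw [adjoint_diagOp] at hpos
  convert hpos using 1
  ext x n
  rw [ContinuousLinearMap.comp_apply, diagOp_apply, diagOp_apply, diagOp_apply, ← mul_assoc,
    ← Complex.ofReal_mul, Real.mul_self_sqrt (hnonneg n)]

theorem norm_diagOp_le (f : ℕ → ℂ) (hf : ∃ C : ℝ, ∀ n, ‖f n‖ ≤ C) {C : ℝ}
    (h : ∀ n, ‖f n‖ ≤ C) : ‖diagOp f hf‖ ≤ C := by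
  have hC : 0 ≤ C := (norm_nonneg _).trans (h 0)
  refine ContinuousLinearMap.opNorm_le_bound _ hC fun x => ?_
  calc ‖diagOp f hf x‖ ≤ ‖(C : ℂ) • x‖ := lp.norm_mono (by norm_num) fun n => by
        change ‖f n * x n‖ ≤ ‖(C : ℂ) * x n‖
        rw [norm_mul, norm_mul, Complex.norm_real, Real.norm_of_nonneg hC]
        gcongr
        exact h n
    _ = C * ‖x‖ := by rw [norm_smul, Complex.norm_real, Real.norm_of_nonneg hC]

theorem IsInvariantState.cesaroMean_eq {L : (Field →L[ℂ] Field) → (Field →L[ℂ] Field)}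
    {ρ : Field →L[ℂ] Field} (h : IsInvariantState L ρ) (A : Field →L[ℂ] Field) {N : ℕ}
    (hN : N ≠ 0) : cesaroMean L ρ A N = expect ρ A := by
  have hN' : (N : ℂ) ≠ 0 := by exact_mod_cast hN
  simp only [cesaroMean, Function.iterate_fixed h.2, Finset.sum_const, Nat.card_Icc,
    Nat.add_sub_cancel, nsmul_eq_mul]
  field_simp

namespace Maser

variable {M : Maser}

variable (M) in
/-- The normalized Boltzmann weights, that is, the diagonal entries of `gibbs`. -/
def gibbsWeight (b : ℝ) (I : Set ℕ) (n : ℕ) : ℝ := M.boltzmann b I n / ∑' m, M.boltzmann b I m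

theorem gibbs_entry (b : ℝ) (I : Set ℕ) (m n : ℕ) :
    M.gibbs b I (ket n) m = if m = n then (M.gibbsWeight b I n : ℂ) else 0 := by
  rw [gibbs, diagOp_ket]
  change (M.gibbsWeight b I n : ℂ) * (ket n : Field) m = _
  rw [ket_apply, mul_ite, mul_one, mul_zero]

theorem gibbsWeight_nonneg (b : ℝ) (I : Set ℕ) (n : ℕ) : 0 ≤ M.gibbsWeight b I n :=
  div_nonneg (M.boltzmann_nonneg b I n) (tsum_nonneg (M.boltzmann_nonneg b I))

theorem gibbsWeight_of_notMem (b : ℝ) {I : Set ℕ} {n : ℕ} (h : n ∉ I) :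
    M.gibbsWeight b I n = 0 := by
  simp [gibbsWeight, boltzmann, h]

theorem tsum_boltzmann_pos {b : ℝ} {I : Set ℕ} (hs : Summable (M.boltzmann b I))
    (hI : I.Nonempty) : 0 < ∑' m, M.boltzmann b I m := by
  obtain ⟨i, hi⟩ := hI
  exact hs.tsum_pos (M.boltzmann_nonneg b I) i (by simp [boltzmann, hi, Real.exp_pos])

theorem gibbsWeight_pos {b : ℝ} {I : Set ℕ} (hs : Summable (M.boltzmann b I)) {n : ℕ}
    (hn : n ∈ I) : 0 < M.gibbsWeight b I n :=
  div_pos (by simp [boltzmann, hn, Real.exp_pos]) (tsum_boltzmann_pos hs ⟨n, hn⟩)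

theorem hasSum_gibbsWeight {b : ℝ} {I : Set ℕ} (hs : Summable (M.boltzmann b I))
    (hI : I.Nonempty) : HasSum (M.gibbsWeight b I) 1 := by
  have hsum := hs.hasSum.div_const (∑' m, M.boltzmann b I m)
  rwa [div_self (tsum_boltzmann_pos hs hI).ne'] at hsum

theorem isState_gibbs {b : ℝ} {I : Set ℕ} (hs : Summable (M.boltzmann b I))
    (hI : I.Nonempty) : IsState (M.gibbs b I) := by
  refine ⟨isPositive_diagOp _ (M.gibbs_bounded b I) (M.gibbsWeight_nonneg b I), ?_⟩
  have hsum := Complex.hasSum_ofReal.2 (hasSum_gibbsWeight hs hI)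
  rw [Complex.ofReal_one] at hsum
  exact hsum.congr_fun fun n => by rw [inner_ket_left, gibbs_entry, if_pos rfl]

theorem gibbsWeight_le_one (b : ℝ) (I : Set ℕ) (n : ℕ) : M.gibbsWeight b I n ≤ 1 := by
  by_cases hs : Summable (M.boltzmann b I)
  · exact div_le_one_of_le₀ (hs.le_tsum n fun m _ => M.boltzmann_nonneg b I m)
      (tsum_nonneg (M.boltzmann_nonneg b I))
  · simp [gibbsWeight, tsum_eq_zero_of_not_summable hs]

theorem norm_gibbs_le_one (b : ℝ) (I : Set ℕ) : ‖M.gibbs b I‖ ≤ 1 :=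
  norm_diagOp_le _ (M.gibbs_bounded b I) fun n => by
    rw [Complex.norm_real]
    exact (Real.norm_of_nonneg (M.gibbsWeight_nonneg b I n)).trans_le (M.gibbsWeight_le_one b I n)

theorem population_gibbs (b : ℝ) (I : Set ℕ) (n : ℕ) :
    population (M.gibbs b I) n = M.gibbsWeight b I n := by
  rw [population, gibbs_entry, if_pos rfl, Complex.ofReal_re]

theorem gibbs_ne {b : ℝ} {I J : Set ℕ} (hs : Summable (M.boltzmann b I)) {n : ℕ} (hI : n ∈ I)
    (hJ : n ∉ J) : M.gibbs b I ≠ M.gibbs b J := by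
  intro h
  refine (gibbsWeight_pos hs hI).ne' ?_
  rw [← population_gibbs, h, population_gibbs, gibbsWeight_of_notMem b hJ]

theorem expect_gibbs (b : ℝ) (I : Set ℕ) (A : Field →L[ℂ] Field) :
    expect (M.gibbs b I) A = ∑' n, (M.gibbsWeight b I n : ℂ) * A (ket n) n :=
  tsum_congr fun _ => inner_ket_left _ _

theorem boltzmann_betaStar (hE : M.E ≠ 0) (β : ℝ) (I : Set ℕ) (n : ℕ) :
    M.boltzmann (M.betaStar β) I n = I.indicator (fun n => M.atomRatio β ^ n) n := by
  unfold boltzmann betaStar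
  congr 1
  ext n
  rw [atomRatio, ← Real.exp_nat_mul]
  congr 1
  field_simp

theorem gibbsWeight_detailed_balance (hE : M.E ≠ 0) (β : ℝ) {I : Set ℕ} {m : ℕ}
    (hm : m + 1 ∈ I ↔ m ∈ I) :
    M.atomPopulation β 0 * M.gibbsWeight (M.betaStar β) I (m + 1) =
      M.atomPopulation β 1 * M.gibbsWeight (M.betaStar β) I m := by
  rw [gibbsWeight, gibbsWeight, boltzmann_betaStar hE, boltzmann_betaStar hE, atomPopulation_one]
  by_cases h : m ∈ I
  · rw [Set.indicator_of_mem h, Set.indicator_of_mem (hm.2 h)]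
    ring
  · rw [Set.indicator_of_notMem h, Set.indicator_of_notMem (hm.not.2 h)]
    ring

theorem rabiIndices_succ (k : ℕ) : M.rabiIndices (k + 1) = M.sectorIndex ⁻¹' {k} := by
  ext n
  rw [mem_rabiIndices]
  simp

theorem nonempty_rabiIndices (n : ℕ) : (M.rabiIndices (M.sectorIndex n + 1)).Nonempty := ⟨n, rfl⟩

variable (M) in
/-- The trace of `exp(-β* h_S) P_k` is finite. -/
def IsNormalizable (β : ℝ) (k : ℕ) : Prop :=
  Summable (M.boltzmann (M.betaStar β) (M.rabiIndices k))

theorem isNormalizable_of_finite {β : ℝ} {k : ℕ} (h : (M.rabiIndices k).Finite) :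
    M.IsNormalizable β k :=
  summable_of_hasFiniteSupport (h.subset Set.support_indicator_subset)

theorem isNormalizable_of_pos (hE : M.E ≠ 0) {β : ℝ} (hβ : 0 < β * M.E₀) (k : ℕ) :
    M.IsNormalizable β k := by
  have hratio : M.atomRatio β < 1 := by
    rw [atomRatio, Real.exp_lt_one_iff]
    linarith
  refine Summable.of_nonneg_of_le (M.boltzmann_nonneg _ _) (fun n => ?_)
    (summable_geometric_of_lt_one (M.atomRatio_pos β).le hratio)
  rw [boltzmann_betaStar hE]
  exact Set.indicator_le_self' (fun _ _ => pow_nonneg (M.atomRatio_pos β).le _) n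

theorem exchangeAmp_mul_detailed_balance (hE : M.E ≠ 0) (hξ : 0 < M.xi) (β : ℝ) (k m : ℕ) :
    M.exchangeAmp m * starRingEnd ℂ (M.exchangeAmp m) *
      (M.atomPopulation β 0 * M.gibbsWeight (M.betaStar β) (M.rabiIndices k) m -
        M.atomPopulation β 1 * M.gibbsWeight (M.betaStar β) (M.rabiIndices k) (m - 1)) = 0 := by
  by_cases h : M.exchangeAmp m = 0
  · simp [h]
  rw [exchangeAmp_eq_zero_iff hξ, not_or] at h
  obtain ⟨m, rfl⟩ := Nat.exists_eq_succ_of_ne_zero h.1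
  have hmem : m + 1 ∈ M.rabiIndices k ↔ m ∈ M.rabiIndices k := by
    rw [mem_rabiIndices, mem_rabiIndices, sectorIndex_succ_of_notMem h.2]
  have hbalance := gibbsWeight_detailed_balance hE β hmem
  refine mul_eq_zero_of_right _ (sub_eq_zero.2 ?_)
  exact_mod_cast hbalance

theorem rdm_rabiGibbs (hE : M.E ≠ 0) (hξ : 0 < M.xi) (β : ℝ) (k : ℕ) :
    M.rdm β (M.rabiGibbs β k) = M.rabiGibbs β k := by
  refine clm_ext_entry fun m n => ?_
  rw [rdm_entry hξ]
  simp only [rabiGibbs, gibbs_entry]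
  rcases eq_or_ne m n with rfl | hmn
  · simp only [if_true]
    have hpop : (M.atomPopulation β 0 : ℂ) + M.atomPopulation β 1 = 1 := by
      exact_mod_cast M.atomPopulation_sum β
    have hbalance_succ := exchangeAmp_mul_detailed_balance hE hξ β k (m + 1)
    rw [Nat.add_sub_cancel] at hbalance_succ
    linear_combination hbalance_succ - exchangeAmp_mul_detailed_balance hE hξ β k m +
      M.gibbsWeight (M.betaStar β) (M.rabiIndices k) m *
        ((M.atomPopulation β 0 : ℂ) * groundAmp_mul_conj_add hξ m +
          (M.atomPopulation β 1 : ℂ) * M.excitedAmp_mul_conj_add m + hpop)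
  · rcases m with _ | m <;> rcases n with _ | n <;>
      simp_all [exchangeAmp_zero]

theorem isInvariantState_rabiGibbs (hE : M.E ≠ 0) (hξ : 0 < M.xi) {β : ℝ} {k : ℕ}
    (hs : M.IsNormalizable β k) (hI : (M.rabiIndices k).Nonempty) :
    IsInvariantState (M.rdm β) (M.rabiGibbs β k) :=
  ⟨isState_gibbs hs hI, rdm_rabiGibbs hE hξ β k⟩

/-! ### Convergence of the Cesàro means -/

theorem tsum_gibbsWeight_mul_of_diagHeisenberg_eq (hξ : 0 < M.xi) {β : ℝ} {i : ℕ}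
    (hi : M.IsNormalizable β (M.sectorIndex i + 1)) {g : ℕ → ℂ} (hg : M.diagHeisenberg β 0 g = g) :
    ∑' n, (M.gibbsWeight (M.betaStar β) (M.rabiIndices (M.sectorIndex i + 1)) n : ℂ) * g n =
      g i := by
  have hsum := (Complex.hasSum_ofReal.2
    (hasSum_gibbsWeight hi (M.nonempty_rabiIndices i))).mul_right (g i)
  rw [Complex.ofReal_one, one_mul] at hsum
  rw [← hsum.tsum_eq]
  refine tsum_congr fun n => ?_
  by_cases hn : n ∈ M.rabiIndices (M.sectorIndex i + 1)
  · rw [mem_rabiIndices, add_left_inj] at hn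
    rw [eq_of_sectorIndex_eq hξ hg hn]
  · rw [gibbsWeight_of_notMem _ hn, Complex.ofReal_zero, zero_mul, zero_mul]

theorem tendsto_heisenbergMean_self (hE : M.E ≠ 0) (hξ : 0 < M.xi) {β : ℝ} {i : ℕ}
    (hi : M.IsNormalizable β (M.sectorIndex i + 1)) (A : Field →L[ℂ] Field) :
    Tendsto (fun N => M.heisenbergMean β A N (ket i) i) atTop
      (𝓝 (expect (M.rabiGibbs β (M.sectorIndex i + 1)) A)) := by
  rw [tendsto_iff_ultrafilter]
  intro U hU
  obtain ⟨g, hg, hfix, -⟩ := exists_stationary_limit hξ β 0 A hU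
  simp only [add_zero] at hg
  have hinv := isInvariantState_rabiGibbs hE hξ hi (M.nonempty_rabiIndices i)
  have hlim_weighted : Tendsto
      (fun N => expect (M.rabiGibbs β (M.sectorIndex i + 1)) (M.heisenbergMean β A N)) U
      (𝓝 (g i)) := by
    rw [← tsum_gibbsWeight_mul_of_diagHeisenberg_eq hξ hi hfix]
    simp only [rabiGibbs, expect_gibbs]
    refine tendsto_tsum_of_dominated_convergence
      ((hasSum_gibbsWeight hi (M.nonempty_rabiIndices i)).summable.mul_right ‖A‖)
      (fun n => (hg n).const_mul _) (Eventually.of_forall fun N n => ?_)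
    rw [norm_mul, Complex.norm_real, Real.norm_of_nonneg (M.gibbsWeight_nonneg _ _ n)]
    exact mul_le_mul_of_nonneg_left
      ((norm_entry_le _ n n).trans (norm_heisenbergMean_le hξ β A N)) (M.gibbsWeight_nonneg _ _ n)
  have hlim_invariant : Tendsto
      (fun N => expect (M.rabiGibbs β (M.sectorIndex i + 1)) (M.heisenbergMean β A N)) U
      (𝓝 (expect (M.rabiGibbs β (M.sectorIndex i + 1)) A)) := by
    refine tendsto_const_nhds.congr' ?_
    filter_upwards [hU (eventually_ne_atTop 0)] with N hN
    rw [← hinv.cesaroMean_eq A hN, cesaroMean_rdm hξ β hinv.1]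
  rw [← tendsto_nhds_unique hlim_weighted hlim_invariant]
  exact hg i

theorem tendsto_pow_mul_indicator (hE : M.E ≠ 0) {β : ℝ} {i : ℕ}
    (hi : M.IsNormalizable β (M.sectorIndex i + 1)) (d b : ℕ) {g : ℕ → ℂ} {C : ℝ}
    (hg : ∀ m, ‖g m‖ ≤ C) :
    Tendsto (fun m => (M.atomRatio β : ℂ) ^ m *
      {m | M.sectorIndex m = M.sectorIndex i ∧ M.sectorIndex (m + d) = b}.indicator g m)
      atTop (𝓝 0) := by
  have hlim := hi.tendsto_atTop_zero.mul_const C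
  rw [zero_mul] at hlim
  have hpow (m : ℕ) : 0 ≤ M.atomRatio β ^ m := pow_nonneg (M.atomRatio_pos β).le m
  refine squeeze_zero_norm (fun m => ?_) hlim
  rw [boltzmann_betaStar hE, norm_mul, norm_pow, Complex.norm_real,
    Real.norm_of_nonneg (M.atomRatio_pos β).le]
  by_cases hm : m ∈ {m | M.sectorIndex m = M.sectorIndex i ∧ M.sectorIndex (m + d) = b}
  · have hm' : m ∈ M.rabiIndices (M.sectorIndex i + 1) := by rw [mem_rabiIndices, hm.1]
    rw [Set.indicator_of_mem hm, Set.indicator_of_mem hm']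
    exact mul_le_mul_of_nonneg_left (hg m) (hpow m)
  · rw [Set.indicator_of_notMem hm, norm_zero, mul_zero]
    exact mul_nonneg (Set.indicator_nonneg (fun n _ => hpow n) _) ((norm_nonneg _).trans (hg 0))

theorem tendsto_heisenbergMean_add (hE : M.E ≠ 0) (hξ : 0 < M.xi) {β : ℝ} {i d : ℕ} (hd : 0 < d)
    (hi : M.IsNormalizable β (M.sectorIndex i + 1))
    (h : M.sectorIndex i = M.sectorIndex (i + d) ∨ ¬ M.IsDegenerate) (A : Field →L[ℂ] Field) :
    Tendsto (fun N => M.heisenbergMean β A N (ket i) (i + d)) atTop (𝓝 0) := by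
  rw [tendsto_iff_ultrafilter]
  intro U hU
  obtain ⟨g, hg, hfix, hbound⟩ := exists_stationary_limit hξ β d A hU
  set S := {m | M.sectorIndex m = M.sectorIndex i ∧ M.sectorIndex (m + d) = M.sectorIndex (i + d)}
    with hS
  have hfix_indicator : M.diagHeisenberg β d (S.indicator g) = S.indicator g := by
    rw [hS, diagHeisenberg_indicator_sectorIndex hξ, hfix]
  have hlim := tendsto_pow_mul_indicator hE hi d (M.sectorIndex (i + d)) hbound
  have hzero : S.indicator g = 0 := by
    rcases h with h | h
    · refine eq_zero_of_sectorIndex_eq hξ hd norm_one.ge (by rwa [one_smul]) hlim fun m hm => ?_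
      have hmS : m ∈ S := Set.mem_of_indicator_ne_zero hm
      rw [hmS.1, hmS.2, h]
    · exact eq_zero_of_not_isDegenerate hξ h hd hfix_indicator hlim
  have hi_zero : g i = 0 := by
    rw [← Set.indicator_of_mem (show i ∈ S from ⟨rfl, rfl⟩) g, hzero, Pi.zero_apply]
  rw [← hi_zero]
  exact hg i

theorem tendsto_heisenbergMean_of_ne (hE : M.E ≠ 0) (hξ : 0 < M.xi) {β : ℝ} {i j : ℕ}
    (hij : i ≠ j) (hi : M.IsNormalizable β (M.sectorIndex i + 1))
    (hj : M.IsNormalizable β (M.sectorIndex j + 1))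
    (h : M.sectorIndex i = M.sectorIndex j ∨ ¬ M.IsDegenerate) (A : Field →L[ℂ] Field) :
    Tendsto (fun N => M.heisenbergMean β A N (ket i) j) atTop (𝓝 0) := by
  rcases hij.lt_or_gt with hij | hij
  · obtain ⟨d, rfl⟩ := Nat.exists_eq_add_of_lt hij
    exact tendsto_heisenbergMean_add hE hξ d.succ_pos hi h A
  · obtain ⟨d, rfl⟩ := Nat.exists_eq_add_of_lt hij
    have hstar := (tendsto_heisenbergMean_add hE hξ d.succ_pos hj (h.imp_left Eq.symm)
      (ContinuousLinearMap.adjoint A)).star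
    rw [star_zero] at hstar
    refine hstar.congr fun N => ?_
    rw [heisenbergMean_adjoint, adjoint_apply_ket]
    exact Complex.conj_conj _

theorem tendsto_cesaroMean (hE : M.E ≠ 0) (hξ : 0 < M.xi) {β : ℝ} {J : Set ℕ}
    (hJ : ∀ i ∈ J, M.IsNormalizable β (M.sectorIndex i + 1))
    (hJ' : ∀ i ∈ J, ∀ j ∈ J, M.sectorIndex i = M.sectorIndex j ∨ ¬ M.IsDegenerate)
    {ρ : Field →L[ℂ] Field} (hρ : IsState ρ) (hρJ : ∀ i ∉ J, population ρ i = 0)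
    (A : Field →L[ℂ] Field) :
    Tendsto (cesaroMean (M.rdm β) ρ A) atTop
      (𝓝 (∑' n, population ρ n * expect (M.rabiGibbs β (M.sectorIndex n + 1)) A)) := by
  set t : ℕ → ℂ := J.indicator fun n => expect (M.rabiGibbs β (M.sectorIndex n + 1)) A with ht
  have htsum : ∑' n, population ρ n * expect (M.rabiGibbs β (M.sectorIndex n + 1)) A =
      ∑' n, population ρ n * t n := tsum_congr fun n => by
    by_cases hn : n ∈ J
    · rw [ht, Set.indicator_of_mem hn]
    · rw [hρJ n hn, Complex.ofReal_zero, zero_mul, zero_mul]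
  have hbound (n : ℕ) : ‖t n‖ ≤ ‖A‖ := by
    rw [ht, norm_indicator_eq_indicator_norm]
    refine Set.indicator_apply_le' (fun hn => ?_) fun _ => norm_nonneg A
    exact (isState_gibbs (hJ n hn) (M.nonempty_rabiIndices n)).norm_expect_le A
  rw [htsum, cesaroMean_rdm hξ β hρ]
  refine hρ.tendsto_expect hρJ (norm_heisenbergMean_le hξ β A) ⟨‖A‖, hbound⟩ (fun i hi => ?_)
    fun i hi j hj hij =>
      tendsto_heisenbergMean_of_ne hE hξ hij (hJ i hi) (hJ j hj) (hJ' i hi j hj) A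
  rw [ht, Set.indicator_of_mem hi]
  exact tendsto_heisenbergMean_self hE hξ (hJ i hi) A

end Maser

/-! ### Supports and ergodicity -/

theorem expect_proj {ρ : Field →L[ℂ] Field} (hρ : IsState ρ) (I : Set ℕ) :
    expect ρ (proj I) = ∑' n : I, (population ρ n : ℂ) := by
  rw [tsum_subtype I fun n => (population ρ n : ℂ), proj, ← (hρ.hasSum_expect_diagOp _ _).tsum_eq]
  refine tsum_congr fun n => ?_
  by_cases h : n ∈ I <;> simp [h]

theorem IsErgodicState.eq_of_isInvariantState {L : (Field →L[ℂ] Field) → (Field →L[ℂ] Field)}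
    {ρ σ : Field →L[ℂ] Field} (hρ : IsErgodicState L ρ) (hσ : IsInvariantState L σ)
    (h : supportProj σ ≤ supportProj ρ) : ρ = σ := by
  refine eq_of_expect_eq fun A => tendsto_nhds_unique (hρ.2 σ hσ.1 h A) ?_
  refine tendsto_const_nhds.congr' ?_
  filter_upwards [eventually_ne_atTop 0] with N hN
  rw [hσ.cesaroMean_eq A hN]

namespace Maser

variable {M : Maser}

theorem apply_eq_zero_of_mem_closure_range {b : ℝ} {I : Set ℕ} {n : ℕ} (hn : n ∉ I) {x : Field}
    (hx : x ∈ (LinearMap.range (M.gibbs b I).toLinearMap).topologicalClosure) : x n = 0 := by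
  have hle : (LinearMap.range (M.gibbs b I).toLinearMap).topologicalClosure ≤
      LinearMap.ker (innerSL ℂ (ket n : Field)).toLinearMap := by
    refine Submodule.topologicalClosure_minimal _ ?_ (ContinuousLinearMap.isClosed_ker _)
    rintro _ ⟨y, rfl⟩
    change ⟪(ket n : Field), M.gibbs b I y⟫_ℂ = 0
    rw [inner_ket_left]
    change (M.gibbsWeight b I n : ℂ) * y n = 0
    rw [gibbsWeight_of_notMem b hn, Complex.ofReal_zero, zero_mul]
  rw [← inner_ket_left]
  exact hle hx

theorem population_eq_zero_of_supportProj_le {b : ℝ} {I : Set ℕ} {μ : Field →L[ℂ] Field}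
    (h : supportProj μ ≤ supportProj (M.gibbs b I)) {n : ℕ} (hn : n ∉ I) :
    population μ n = 0 := by
  unfold supportProj at h
  rw [Submodule.starProjection_le_starProjection_iff] at h
  have hmem : μ (ket n) ∈ (LinearMap.range μ.toLinearMap).topologicalClosure :=
    Submodule.le_topologicalClosure _ ⟨ket n, rfl⟩
  rw [population, apply_eq_zero_of_mem_closure_range hn (h hmem), Complex.zero_re]

theorem supportProj_gibbs_le {b : ℝ} {I : Set ℕ} {ρ : Field →L[ℂ] Field} {c : ℕ → ℂ}
    (hρ : ∀ n, ρ (ket n) = c n • ket n) (hc : ∀ n ∈ I, c n ≠ 0) :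
    supportProj (M.gibbs b I) ≤ supportProj ρ := by
  unfold supportProj
  rw [Submodule.starProjection_le_starProjection_iff]
  refine Submodule.topologicalClosure_minimal _ ?_ (Submodule.isClosed_topologicalClosure _)
  rintro _ ⟨x, rfl⟩
  refine (Submodule.isClosed_topologicalClosure _).mem_of_tendsto
    (hasSum_smul_ket (M.gibbs b I x)) (Eventually.of_forall fun s => ?_)
  refine Submodule.sum_mem _ fun n _ => ?_
  by_cases hn : n ∈ I
  · refine Submodule.smul_mem _ _ (Submodule.le_topologicalClosure _ ⟨(c n)⁻¹ • ket n, ?_⟩)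
    change ρ ((c n)⁻¹ • ket n) = _
    rw [map_smul, hρ, smul_smul, inv_mul_cancel₀ (hc n hn), one_smul]
  · have hzero : M.gibbs b I x n = 0 := by
      change (M.gibbsWeight b I n : ℂ) * x n = 0
      rw [gibbsWeight_of_notMem b hn, Complex.ofReal_zero, zero_mul]
    rw [hzero, zero_smul]
    exact Submodule.zero_mem _

theorem isErgodicState_rabiGibbs (hE : M.E ≠ 0) (hξ : 0 < M.xi) {β : ℝ} {k : ℕ}
    (hs : M.IsNormalizable β k) (hI : (M.rabiIndices k).Nonempty) :
    IsErgodicState (M.rdm β) (M.rabiGibbs β k) := by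
  refine ⟨isState_gibbs hs hI, fun μ hμ hsupp A => ?_⟩
  have hpop (i : ℕ) (hi : i ∉ M.rabiIndices k) : population μ i = 0 :=
    population_eq_zero_of_supportProj_le hsupp hi
  have hlim := tendsto_cesaroMean hE hξ (J := M.rabiIndices k)
    (fun i hi => by rw [mem_rabiIndices] at hi; rwa [hi])
    (fun i hi j hj => by rw [mem_rabiIndices] at hi hj; left; omega) hμ hpop A
  convert hlim using 2
  have hsum := (Complex.hasSum_ofReal.2 hμ.hasSum_population).mul_right
    (expect (M.rabiGibbs β k) A)
  rw [Complex.ofReal_one, one_mul] at hsum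
  rw [← hsum.tsum_eq]
  refine tsum_congr fun n => ?_
  by_cases hn : n ∈ M.rabiIndices k
  · rw [mem_rabiIndices.1 hn]
  · rw [hpop n hn, Complex.ofReal_zero, zero_mul, zero_mul]

theorem heisenberg_heisenbergMean (β : ℝ) (A : Field →L[ℂ] Field) (N : ℕ) :
    M.heisenberg β (M.heisenbergMean β A N) = M.heisenbergMean β (M.heisenberg β A) N := by
  rw [heisenbergMean, map_birkhoffAverage ℂ ℂ]
  simp only [heisenbergMean, birkhoffAverage, birkhoffSum, Function.comp_apply, id,
    ← Function.iterate_succ_apply, ← Function.iterate_succ_apply']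

theorem isInvariantState_of_isErgodicState (hξ : 0 < M.xi) {β : ℝ} {ρ : Field →L[ℂ] Field}
    (hρ : IsErgodicState (M.rdm β) ρ) : IsInvariantState (M.rdm β) ρ := by
  refine ⟨hρ.1, eq_of_expect_eq fun A => ?_⟩
  have hlim := (hρ.2 ρ hρ.1 le_rfl (M.heisenberg β A)).sub (hρ.2 ρ hρ.1 le_rfl A)
  simp only [cesaroMean_rdm hξ β hρ.1, ← heisenberg_heisenbergMean, ← hρ.1.expect_sub] at hlim
  have hzero := squeeze_zero_norm (fun N => hρ.1.norm_expect_le _)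
    (tendsto_zero_iff_norm_tendsto_zero.1 (tendsto_heisenberg_heisenbergMean_sub hξ β A))
  rw [expect_rdm hρ.1]
  exact sub_eq_zero.1 (tendsto_nhds_unique (hρ.1.expect_sub _ _ ▸ hlim) hzero)

/-! ### Invariant states -/

theorem entry_eq_zero_of_isInvariantState (hξ : 0 < M.xi) (hM : ¬ M.IsDegenerate) {β : ℝ}
    {ρ : Field →L[ℂ] Field} (hρ : IsInvariantState (M.rdm β) ρ) {m n : ℕ} (hmn : m ≠ n) :
    ρ (ket n) m = 0 := by
  have hγ : (M.atomRatio β : ℂ) ≠ 0 := by exact_mod_cast (M.atomRatio_pos β).ne'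
  wlog hlt : m < n generalizing m n
  · rw [hρ.1.entry_conj, this hmn.symm (hmn.symm.lt_of_le (not_lt.1 hlt)), map_zero]
  obtain ⟨d, rfl⟩ := Nat.exists_eq_add_of_lt hlt
  have hzero := congrFun (eq_zero_of_not_isDegenerate hξ hM d.succ_pos
    (diagHeisenberg_eq_of_rdm_eq hξ hρ.2 (d + 1)) (by
      simp only [mul_inv_cancel_left₀ (pow_ne_zero _ hγ)]
      exact hρ.1.tendsto_entry (d + 1))) m
  exact (mul_eq_zero.1 hzero).resolve_left (inv_ne_zero (pow_ne_zero _ hγ))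

theorem apply_ket_of_isInvariantState (hξ : 0 < M.xi) (hM : ¬ M.IsDegenerate) {β : ℝ}
    {ρ : Field →L[ℂ] Field} (hρ : IsInvariantState (M.rdm β) ρ) (n : ℕ) :
    ρ (ket n) = (population ρ n : ℂ) • ket n := by
  ext m
  change _ = (population ρ n : ℂ) * (ket n : Field) m
  rw [ket_apply]
  rcases eq_or_ne m n with rfl | h
  · rw [if_pos rfl, mul_one, hρ.1.entry_self]
  · rw [if_neg h, mul_zero, entry_eq_zero_of_isInvariantState hξ hM hρ h]

theorem population_eq_of_sectorIndex_eq (hξ : 0 < M.xi) {β : ℝ} {ρ : Field →L[ℂ] Field}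
    (hρ : IsInvariantState (M.rdm β) ρ) {m n : ℕ} (h : M.sectorIndex m = M.sectorIndex n) :
    population ρ m = M.atomRatio β ^ m * ((M.atomRatio β ^ n)⁻¹ * population ρ n) := by
  have hγ : (M.atomRatio β : ℂ) ≠ 0 := by exact_mod_cast (M.atomRatio_pos β).ne'
  have hratio := eq_of_sectorIndex_eq hξ (diagHeisenberg_eq_of_rdm_eq hξ hρ.2 0) h
  simp only [add_zero, hρ.1.entry_self] at hratio
  rw [inv_mul_eq_iff_eq_mul₀ (pow_ne_zero _ hγ)] at hratio
  exact_mod_cast hratio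

variable (M) in
/-- The weight `ρ(P_{k+1})` of the sector with index `k` in a state. -/
def sectorWeight (ρ : Field →L[ℂ] Field) (k : ℕ) : ℝ :=
  ∑' n : M.sectorIndex ⁻¹' {k}, population ρ n

theorem expect_rabiProj_succ {ρ : Field →L[ℂ] Field} (hρ : IsState ρ) (k : ℕ) :
    expect ρ (M.rabiProj (k + 1)) = M.sectorWeight ρ k := by
  rw [rabiProj, expect_proj hρ, rabiIndices_succ, sectorWeight, Complex.ofReal_tsum]

variable (M) in
theorem hasSum_sectorWeight {ρ : Field →L[ℂ] Field} (hρ : IsState ρ) :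
    HasSum (M.sectorWeight ρ) 1 :=
  hρ.hasSum_population.tsum_fiberwise M.sectorIndex

theorem sectorWeight_nonneg {ρ : Field →L[ℂ] Field} (hρ : IsState ρ) (k : ℕ) :
    0 ≤ M.sectorWeight ρ k :=
  tsum_nonneg fun n => hρ.population_nonneg n

theorem sectorWeight_eq (hE : M.E ≠ 0) (hξ : 0 < M.xi) {β : ℝ} {ρ : Field →L[ℂ] Field}
    (hρ : IsInvariantState (M.rdm β) ρ) (n : ℕ) :
    M.sectorWeight ρ (M.sectorIndex n) = ((M.atomRatio β ^ n)⁻¹ * population ρ n) *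
      ∑' m, M.boltzmann (M.betaStar β) (M.rabiIndices (M.sectorIndex n + 1)) m := by
  rw [sectorWeight, tsum_subtype, ← tsum_mul_left]
  refine tsum_congr fun m => ?_
  rw [boltzmann_betaStar hE, rabiIndices_succ]
  by_cases hm : m ∈ M.sectorIndex ⁻¹' {M.sectorIndex n}
  · rw [Set.indicator_of_mem hm, Set.indicator_of_mem hm,
      population_eq_of_sectorIndex_eq hξ hρ hm, mul_comm]
  · rw [Set.indicator_of_notMem hm, Set.indicator_of_notMem hm, mul_zero]

theorem isNormalizable_of_population_ne_zero (hE : M.E ≠ 0) (hξ : 0 < M.xi) {β : ℝ}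
    {ρ : Field →L[ℂ] Field} (hρ : IsInvariantState (M.rdm β) ρ) {n : ℕ}
    (hn : population ρ n ≠ 0) : M.IsNormalizable β (M.sectorIndex n + 1) := by
  have hweight : (M.atomRatio β ^ n)⁻¹ * population ρ n ≠ 0 :=
    mul_ne_zero (inv_ne_zero (pow_ne_zero _ (M.atomRatio_pos β).ne')) hn
  refine ((hρ.1.hasSum_population.summable.indicator
    (M.rabiIndices (M.sectorIndex n + 1))).mul_left
      ((M.atomRatio β ^ n)⁻¹ * population ρ n)⁻¹).congr fun m => ?_
  rw [boltzmann_betaStar hE]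
  by_cases hm : m ∈ M.rabiIndices (M.sectorIndex n + 1)
  · rw [Set.indicator_of_mem hm, Set.indicator_of_mem hm,
      population_eq_of_sectorIndex_eq hξ hρ (add_left_injective 1 (mem_rabiIndices.1 hm)),
      mul_comm, mul_assoc, mul_inv_cancel₀ hweight, mul_one]
  · rw [Set.indicator_of_notMem hm, Set.indicator_of_notMem hm, mul_zero]

theorem population_eq_sectorWeight_mul (hE : M.E ≠ 0) (hξ : 0 < M.xi) {β : ℝ}
    {ρ : Field →L[ℂ] Field} (hρ : IsInvariantState (M.rdm β) ρ) (n : ℕ) :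
    population ρ n = M.sectorWeight ρ (M.sectorIndex n) *
      M.gibbsWeight (M.betaStar β) (M.rabiIndices (M.sectorIndex n + 1)) n := by
  rw [sectorWeight_eq hE hξ hρ]
  by_cases hn : population ρ n = 0
  · simp [hn]
  have htsum := tsum_boltzmann_pos (isNormalizable_of_population_ne_zero hE hξ hρ hn)
    (M.nonempty_rabiIndices n)
  have hpow := pow_ne_zero n (M.atomRatio_pos β).ne'
  rw [gibbsWeight, boltzmann_betaStar hE (n := n), Set.indicator_of_mem (mem_rabiIndices.2 rfl)]
  field_simp

theorem isNormalizable_of_sectorWeight_ne_zero (hE : M.E ≠ 0) (hξ : 0 < M.xi) {β : ℝ}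
    {ρ : Field →L[ℂ] Field} (hρ : IsInvariantState (M.rdm β) ρ) {k : ℕ}
    (hk : M.sectorWeight ρ k ≠ 0) :
    M.IsNormalizable β (k + 1) ∧ (M.rabiIndices (k + 1)).Nonempty := by
  obtain ⟨⟨n, rfl⟩, hn⟩ : ∃ n : M.sectorIndex ⁻¹' {k}, population ρ n ≠ 0 := by
    by_contra! h
    exact hk ((tsum_congr h).trans tsum_zero)
  exact ⟨isNormalizable_of_population_ne_zero hE hξ hρ hn, M.nonempty_rabiIndices n⟩

theorem summable_sectorWeight_smul_rabiGibbs {ρ : Field →L[ℂ] Field} (hρ : IsState ρ) (β : ℝ) :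
    Summable fun k => (M.sectorWeight ρ k : ℂ) • M.rabiGibbs β (k + 1) := by
  refine Summable.of_norm_bounded (M.hasSum_sectorWeight hρ).summable fun k => ?_
  rw [norm_smul, Complex.norm_real, Real.norm_of_nonneg (sectorWeight_nonneg hρ k)]
  exact mul_le_of_le_one_right (sectorWeight_nonneg hρ k) (norm_gibbs_le_one _ _)

theorem hasSum_sectorWeight_mul_entry (hE : M.E ≠ 0) (hξ : 0 < M.xi) (hM : ¬ M.IsDegenerate)
    {β : ℝ} {ρ : Field →L[ℂ] Field} (hρ : IsInvariantState (M.rdm β) ρ) (m n : ℕ) :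
    HasSum (fun k => (M.sectorWeight ρ k : ℂ) * M.rabiGibbs β (k + 1) (ket n) m)
      (ρ (ket n) m) := by
  simp only [rabiGibbs, gibbs_entry]
  rcases eq_or_ne m n with rfl | hmn
  · have hsum := hasSum_single (f := fun k => (M.sectorWeight ρ k : ℂ) *
        M.gibbsWeight (M.betaStar β) (M.rabiIndices (k + 1)) m) (M.sectorIndex m) fun k hk => by
      rw [gibbsWeight_of_notMem _ (by rw [mem_rabiIndices]; omega), Complex.ofReal_zero, mul_zero]
    simpa only [if_true, hρ.1.entry_self, ← Complex.ofReal_mul,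
      ← population_eq_sectorWeight_mul hE hξ hρ m] using hsum
  · simp only [if_neg hmn, mul_zero, entry_eq_zero_of_isInvariantState hξ hM hρ hmn]
    exact hasSum_zero

theorem hasSum_sectorWeight_smul_rabiGibbs (hE : M.E ≠ 0) (hξ : 0 < M.xi)
    (hM : ¬ M.IsDegenerate) {β : ℝ} {ρ : Field →L[ℂ] Field}
    (hρ : IsInvariantState (M.rdm β) ρ) :
    HasSum (fun k => (M.sectorWeight ρ k : ℂ) • M.rabiGibbs β (k + 1)) ρ := by
  have hsum := (summable_sectorWeight_smul_rabiGibbs (M := M) hρ.1 β).hasSum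
  have htsum : ∑' k, (M.sectorWeight ρ k : ℂ) • M.rabiGibbs β (k + 1) = ρ := by
    refine clm_ext_entry fun m n => ?_
    have hentry := (hsum.mapL (ContinuousLinearMap.apply ℂ Field (ket n))).mapL
      (innerSL ℂ (ket m : Field))
    simp only [ContinuousLinearMap.apply_apply, innerSL_apply_apply, inner_ket_left] at hentry
    exact hentry.unique (hasSum_sectorWeight_mul_entry hE hξ hM hρ m n)
  rwa [htsum] at hsum

theorem exists_eq_rabiGibbs_of_isErgodicState (hE : M.E ≠ 0) (hξ : 0 < M.xi)
    (hM : ¬ M.IsDegenerate) {β : ℝ} {ρ : Field →L[ℂ] Field} (hρ : IsErgodicState (M.rdm β) ρ) :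
    ∃ k, M.IsNormalizable β (k + 1) ∧ (M.rabiIndices (k + 1)).Nonempty ∧
      ρ = M.rabiGibbs β (k + 1) := by
  have hinv := isInvariantState_of_isErgodicState hξ hρ
  obtain ⟨k, hk⟩ : ∃ k, M.sectorWeight ρ k ≠ 0 := by
    by_contra! h
    have hzero : HasSum (M.sectorWeight ρ) 0 := (funext h : M.sectorWeight ρ = 0) ▸ hasSum_zero
    exact zero_ne_one (hzero.unique (M.hasSum_sectorWeight hρ.1))
  obtain ⟨hs, hI⟩ := isNormalizable_of_sectorWeight_ne_zero hE hξ hinv hk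
  refine ⟨k, hs, hI, hρ.eq_of_isInvariantState (isInvariantState_rabiGibbs hE hξ hs hI) ?_⟩
  refine supportProj_gibbs_le (apply_ket_of_isInvariantState hξ hM hinv) fun n hn => ?_
  have hweight := gibbsWeight_pos hs hn
  obtain rfl : M.sectorIndex n = k := add_left_injective 1 (mem_rabiIndices.1 hn)
  rw [population_eq_sectorWeight_mul hE hξ hinv]
  exact_mod_cast mul_ne_zero hk hweight.ne'

theorem rabiGibbs_ne {β : ℝ} {k l : ℕ} (hs : M.IsNormalizable β k)
    (hI : (M.rabiIndices k).Nonempty) (hkl : k ≠ l) : M.rabiGibbs β k ≠ M.rabiGibbs β l := by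
  obtain ⟨n, hn⟩ := hI
  refine gibbs_ne hs hn fun hn' => hkl ?_
  rw [← mem_rabiIndices.1 hn, mem_rabiIndices.1 hn']

theorem hasSum_expect_rabiProj_mul {β : ℝ} (hs : ∀ n, M.IsNormalizable β (M.sectorIndex n + 1))
    {ρ : Field →L[ℂ] Field} (hρ : IsState ρ) (A : Field →L[ℂ] Field) :
    HasSum (fun k : ℕ => expect ρ (M.rabiProj (k + 1)) * expect (M.rabiGibbs β (k + 1)) A)
      (∑' n, population ρ n * expect (M.rabiGibbs β (M.sectorIndex n + 1)) A) := by
  have hsummable : Summable fun n =>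
      (population ρ n : ℂ) * expect (M.rabiGibbs β (M.sectorIndex n + 1)) A := by
    refine Summable.of_norm_bounded (hρ.hasSum_population.summable.mul_right ‖A‖) fun n => ?_
    rw [norm_mul, Complex.norm_real, Real.norm_of_nonneg (hρ.population_nonneg n)]
    exact mul_le_mul_of_nonneg_left
      ((isState_gibbs (hs n) (M.nonempty_rabiIndices n)).norm_expect_le A) (hρ.population_nonneg n)
  refine (hsummable.hasSum.tsum_fiberwise M.sectorIndex).congr_fun fun k => ?_
  rw [expect_rabiProj_succ hρ, sectorWeight, Complex.ofReal_tsum, ← tsum_mul_right]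
  exact tsum_congr fun ⟨n, hn⟩ => by rw [show M.sectorIndex n = k from hn]

end Maser

/-! ### Exponential mixing -/

/-- The expectation `A ↦ ρ(A)` in a state as a linear functional, to take its kernel. -/
def IsState.expectLinear {ρ : Field →L[ℂ] Field} (h : IsState ρ) : (Field →L[ℂ] Field) →ₗ[ℂ] ℂ where
  toFun := expect ρ
  map_add' A B := by
    rw [← sub_neg_eq_add, h.expect_sub, ← neg_one_smul ℂ B, expect_smul]
    ring
  map_smul' := expect_smul ρ

theorem proj_apply (I : Set ℕ) (x : Field) (n : ℕ) : proj I x n = I.indicator x n := by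
  change I.indicator (fun _ => 1) n * x n = _
  rw [← Set.indicator_mul_left]
  simp only [one_mul]

theorem proj_eq_self {I : Set ℕ} {x : Field} (h : ∀ n ∉ I, x n = 0) : proj I x = x := by
  ext n
  rw [proj_apply, Set.indicator_apply_eq_self]
  exact h n

theorem adjoint_proj (I : Set ℕ) : ContinuousLinearMap.adjoint (proj I) = proj I := by
  classical
  refine clm_ext_entry fun n m => ?_
  rw [adjoint_apply_ket, proj_apply, proj_apply, Set.indicator_apply, Set.indicator_apply,
    ket_apply, ket_apply]
  grind

/-- The compression `A ↦ P A P` of observables to `ℓ²(I)`, where `P = proj I`. -/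
def compression (I : Set ℕ) : (Field →L[ℂ] Field) →ₗ[ℂ] (Field →L[ℂ] Field) where
  toFun A := proj I ∘L A ∘L proj I
  map_add' A B := by rw [ContinuousLinearMap.add_comp, ContinuousLinearMap.comp_add]
  map_smul' c A := by
    rw [ContinuousLinearMap.smul_comp, ContinuousLinearMap.comp_smul, RingHom.id_apply]

open Classical in
theorem compression_entry (I : Set ℕ) (A : Field →L[ℂ] Field) (m n : ℕ) :
    compression I A (ket m) n = if m ∈ I ∧ n ∈ I then A (ket m) n else 0 := by
  change proj I (A (proj I (ket m))) n = _
  rw [proj_apply, Set.indicator_apply, proj, diagOp_ket, Set.indicator_apply]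
  split_ifs <;> simp_all

theorem compression_idem (I : Set ℕ) (A : Field →L[ℂ] Field) :
    compression I (compression I A) = compression I A := by
  classical
  refine clm_ext_entry fun n m => ?_
  rw [compression_entry, compression_entry]
  grind

theorem entry_eq_zero_of_compression_eq {I : Set ℕ} {A : Field →L[ℂ] Field}
    (hA : compression I A = A) {m n : ℕ} (h : ¬ (m ∈ I ∧ n ∈ I)) : A (ket m) n = 0 := by
  classical
  rw [← hA, compression_entry, if_neg h]

theorem finiteDimensional_eqLocus_compression {I : Set ℕ} (hI : I.Finite) :
    FiniteDimensional ℂ (LinearMap.eqLocus (compression I) LinearMap.id) := by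
  have := hI.to_subtype
  let entries : LinearMap.eqLocus (compression I) LinearMap.id →ₗ[ℂ] (I → I → ℂ) :=
    { toFun := fun A i j => A.1 (ket i) j
      map_add' := fun _ _ => rfl
      map_smul' := fun _ _ => rfl }
  refine FiniteDimensional.of_injective entries ((injective_iff_map_eq_zero _).2 fun A hA => ?_)
  refine Subtype.ext (clm_ext_entry fun n m => ?_)
  by_cases h : m ∈ I ∧ n ∈ I
  · exact congrFun (congrFun hA ⟨m, h.1⟩) ⟨n, h.2⟩
  · exact entry_eq_zero_of_compression_eq A.2 h

theorem IsState.expect_compression {ρ : Field →L[ℂ] Field} (h : IsState ρ) {I : Set ℕ}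
    (hρ : ∀ n ∉ I, population ρ n = 0) (A : Field →L[ℂ] Field) :
    expect ρ (compression I A) = expect ρ A := by
  obtain ⟨S, hS, hSS, hs⟩ := h.exists_sqrt
  rw [← (hasSum_expect_of_sqrt hS hSS hs.summable _).tsum_eq,
    ← (hasSum_expect_of_sqrt hS hSS hs.summable A).tsum_eq]
  refine tsum_congr fun m => ?_
  have hproj : proj I (S (ket m)) = S (ket m) :=
    proj_eq_self fun n hn => sqrt_ket_apply_eq_zero hS hSS (hρ n hn) m
  change ⟪S (ket m), proj I (A (proj I (S (ket m))))⟫_ℂ = _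
  rw [← ContinuousLinearMap.adjoint_inner_left, adjoint_proj, hproj]

theorem tendsto_mul_of_finite_support {f g : ℕ → ℂ} {S : Set ℕ} (hS : S.Finite)
    (hf : ∀ m ∉ S, f m = 0) : Tendsto (fun m => g m * f m) atTop (𝓝 0) := by
  refine tendsto_const_nhds.congr' ?_
  rw [← Nat.cofinite_eq_atTop]
  filter_upwards [hS.compl_mem_cofinite] with m hm
  rw [hf m hm, mul_zero]

namespace Maser

variable {M : Maser} {β : ℝ} {k : ℕ} {A : Field →L[ℂ] Field} {z : ℂ}

theorem pred_mem_rabiIndices_iff (hξ : 0 < M.xi) {m : ℕ} (hm : M.exchangeAmp m ≠ 0) (k : ℕ) :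
    m - 1 ∈ M.rabiIndices k ↔ m ∈ M.rabiIndices k := by
  rw [Ne, exchangeAmp_eq_zero_iff hξ, not_or] at hm
  obtain ⟨m, rfl⟩ := Nat.exists_eq_succ_of_ne_zero hm.1
  rw [mem_rabiIndices, mem_rabiIndices, Nat.succ_sub_one, sectorIndex_succ_of_notMem hm.2]

theorem heisenberg_compression (hξ : 0 < M.xi) (β : ℝ) (k : ℕ) (A : Field →L[ℂ] Field) :
    M.heisenberg β (compression (M.rabiIndices k) A) =
      compression (M.rabiIndices k) (M.heisenberg β A) := by
  classical
  have exchange (m n : ℕ) (a : ℂ) : M.exchangeAmp m * starRingEnd ℂ (M.exchangeAmp n) *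
      (if m - 1 ∈ M.rabiIndices k ∧ n - 1 ∈ M.rabiIndices k then a else 0) =
      M.exchangeAmp m * starRingEnd ℂ (M.exchangeAmp n) *
        (if m ∈ M.rabiIndices k ∧ n ∈ M.rabiIndices k then a else 0) := by
    by_cases hm : M.exchangeAmp m = 0
    · simp only [hm, zero_mul]
    by_cases hn : M.exchangeAmp n = 0
    · simp only [hn, map_zero, mul_zero, zero_mul]
    simp only [pred_mem_rabiIndices_iff hξ hm, pred_mem_rabiIndices_iff hξ hn]
  refine clm_ext_entry fun n m => ?_
  have hup := exchange (m + 1) (n + 1) (A (ket (m + 1)) (n + 1))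
  simp only [Nat.add_sub_cancel] at hup
  rw [compression_entry, heisenberg_entry hξ, heisenberg_entry hξ, compression_entry,
    compression_entry, compression_entry, mul_assoc _ _ (ite _ _ _), exchange,
    mul_assoc _ _ (ite (m + 1 ∈ _ ∧ _) _ _), ← hup]
  split_ifs <;> ring

theorem entry_add_eq_zero_of_heisenberg_eq_smul (hξ : 0 < M.xi)
    (hk : (M.rabiIndices (k + 1)).Finite) (hA : compression (M.rabiIndices (k + 1)) A = A)
    (hz : 1 ≤ ‖z‖) (hAz : M.heisenberg β A = z • A) {d : ℕ} (hd : 0 < d) (m : ℕ) :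
    A (ket m) (m + d) = 0 := by
  refine congrFun (eq_zero_of_sectorIndex_eq (f := fun m => A (ket m) (m + d)) hξ hd hz
    (β := β) ?_ ?_ fun m hm => ?_) m
  · rw [diagHeisenberg_entry hξ, hAz]
    rfl
  · exact tendsto_mul_of_finite_support hk fun m hm =>
      entry_eq_zero_of_compression_eq hA fun h => hm h.1
  · have hmem := not_imp_comm.1 (entry_eq_zero_of_compression_eq hA) hm
    rw [mem_rabiIndices, mem_rabiIndices] at hmem
    omega

theorem entry_self_eq_zero_of_heisenberg_eq_smul (hξ : 0 < M.xi)
    (hk : (M.rabiIndices (k + 1)).Finite) (hA : compression (M.rabiIndices (k + 1)) A = A)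
    (hz : 1 ≤ ‖z‖) (hAz : M.heisenberg β A = z • A) (hA0 : expect (M.rabiGibbs β (k + 1)) A = 0)
    (m : ℕ) : A (ket m) m = 0 := by
  let f : ℕ → ℂ := fun m => A (ket m) (m + 0)
  have hfz : M.diagHeisenberg β 0 f = z • f := by
    rw [diagHeisenberg_entry hξ, hAz]
    rfl
  have hf0 (m : ℕ) (hm : m ∉ M.rabiIndices (k + 1)) : f m = 0 :=
    entry_eq_zero_of_compression_eq hA fun h => hm h.1
  by_contra hm
  have hperipheral (n : ℕ) : f n ≠ 0 → PeripheralAt M 0 f z n :=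
    peripheralAt hξ hz hfz (tendsto_mul_of_finite_support hk hf0)
  obtain ⟨n, hn, hexchange⟩ :=
    exists_ne_zero_of_exchangeAmp_eq_zero (fun n hn => (hperipheral n hn).down) hm
  have hz1 : z = 1 := by
    have hground := groundAmp_mul_conj_add hξ n
    have hphase := (hperipheral n hn).phase_ground
    rw [hexchange, zero_mul, add_zero] at hground
    rw [coherence, add_zero, hground, norm_one, Complex.ofReal_one, one_mul] at hphase
    exact hphase.symm
  rw [hz1, one_smul] at hfz
  obtain rfl : M.sectorIndex m = k :=
    Nat.succ_injective (mem_rabiIndices.1 (not_imp_comm.1 (hf0 m) hm))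
  rw [rabiGibbs, expect_gibbs] at hA0
  exact hm ((tsum_gibbsWeight_mul_of_diagHeisenberg_eq hξ (isNormalizable_of_finite hk)
    hfz).symm.trans hA0)

theorem eq_zero_of_heisenberg_eq_smul (hξ : 0 < M.xi) (hk : (M.rabiIndices (k + 1)).Finite)
    (hA : compression (M.rabiIndices (k + 1)) A = A) (hz : 1 ≤ ‖z‖)
    (hAz : M.heisenberg β A = z • A) (hA0 : expect (M.rabiGibbs β (k + 1)) A = 0) : A = 0 := by
  refine clm_ext_entry fun j i => ?_
  rcases lt_trichotomy i j with hij | rfl | hij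
  · obtain ⟨d, rfl⟩ := Nat.exists_eq_add_of_lt hij
    exact entry_add_eq_zero_of_heisenberg_eq_smul hξ hk hA hz hAz d.succ_pos i
  · exact entry_self_eq_zero_of_heisenberg_eq_smul hξ hk hA hz hAz hA0 i
  · obtain ⟨d, rfl⟩ := Nat.exists_eq_add_of_lt hij
    have hadjoint : compression (M.rabiIndices (k + 1)) (ContinuousLinearMap.adjoint A) =
        ContinuousLinearMap.adjoint A := by
      conv_rhs => rw [← hA]
      change _ = ContinuousLinearMap.adjoint (proj _ ∘L A ∘L proj _)
      rw [ContinuousLinearMap.adjoint_comp, ContinuousLinearMap.adjoint_comp, adjoint_proj]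
      rfl
    have hstar : M.heisenberg β (ContinuousLinearMap.adjoint A) =
        starRingEnd ℂ z • ContinuousLinearMap.adjoint A := by
      rw [← map_smulₛₗ, ← hAz]
      exact krausDual_adjoint A
    have hentry := entry_add_eq_zero_of_heisenberg_eq_smul hξ hk hadjoint
      (by rwa [RCLike.norm_conj]) hstar d.succ_pos j
    rw [adjoint_apply_ket] at hentry
    exact (map_eq_zero _).1 hentry

theorem expect_rabiGibbs_heisenberg (hE : M.E ≠ 0) (hξ : 0 < M.xi)
    (h : IsState (M.rabiGibbs β k)) (A : Field →L[ℂ] Field) :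
    expect (M.rabiGibbs β k) (M.heisenberg β A) = expect (M.rabiGibbs β k) A := by
  rw [← expect_rdm h, rdm_rabiGibbs hE hξ]

theorem exists_norm_heisenberg_iterate_le (hE : M.E ≠ 0) (hξ : 0 < M.xi)
    (hk : (M.rabiIndices (k + 1)).Finite) (hρ : IsState (M.rabiGibbs β (k + 1))) :
    ∃ r ∈ Set.Ioo (0 : ℝ) 1, ∀ A, compression (M.rabiIndices (k + 1)) A = A →
      expect (M.rabiGibbs β (k + 1)) A = 0 →
      ∃ C, ∀ n, ‖(M.heisenberg β)^[n] A‖ ≤ C * r ^ n := by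
  let W := LinearMap.eqLocus (compression (M.rabiIndices (k + 1))) LinearMap.id ⊓
    LinearMap.ker hρ.expectLinear
  have hmaps (A) (hA : A ∈ W) : M.heisenberg β A ∈ W :=
    ⟨(heisenberg_compression hξ β (k + 1) A).symm.trans (congrArg _ hA.1),
      (expect_rabiGibbs_heisenberg hE hξ hρ A).trans hA.2⟩
  have := finiteDimensional_eqLocus_compression hk
  have : FiniteDimensional ℂ W := Submodule.finiteDimensional_of_le inf_le_left
  have no_peripheral (z : ℂ) (hz : 1 ≤ ‖z‖) (A : W)
      (hAz : (M.heisenberg β).restrict hmaps A = z • A) : A = 0 :=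
    Subtype.ext (eq_zero_of_heisenberg_eq_smul hξ hk A.2.1 hz (congrArg Subtype.val hAz) A.2.2)
  obtain ⟨r, hr, hdecay⟩ := exists_norm_pow_apply_le (V := W)
    (T := (M.heisenberg β).restrict hmaps) no_peripheral
  refine ⟨r, hr, fun A hA hA0 => ?_⟩
  obtain ⟨C, hC⟩ := hdecay ⟨A, hA, hA0⟩
  refine ⟨C, fun n => ?_⟩
  have hCn := hC n
  rwa [Module.End.pow_restrict, Submodule.coe_norm, LinearMap.coe_restrict_apply,
    Module.End.pow_apply] at hCn

theorem isExpMixingState_rabiGibbs (hE : M.E ≠ 0) (hξ : 0 < M.xi) (β : ℝ)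
    (hk : (M.rabiIndices (k + 1)).Finite) (hI : (M.rabiIndices (k + 1)).Nonempty) :
    IsExpMixingState (M.rdm β) (M.rabiGibbs β (k + 1)) := by
  have hρ : IsState (M.rabiGibbs β (k + 1)) := isState_gibbs (isNormalizable_of_finite hk) hI
  obtain ⟨r, ⟨hr0, hr1⟩, hdecay⟩ := exists_norm_heisenberg_iterate_le hE hξ hk hρ
  refine ⟨hρ, -Real.log r, neg_pos.2 (Real.log_neg hr0 hr1), fun μ hμ hsupp A => ?_⟩
  let c := expect (M.rabiGibbs β (k + 1)) A
  have expect_centered {ν : Field →L[ℂ] Field} (hν : IsState ν) :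
      expect ν (A - c • 1) = expect ν A - c := by
    rw [hν.expect_sub, expect_smul, hν.expect_one, mul_one]
  have hpop (n : ℕ) (hn : n ∉ M.rabiIndices (k + 1)) : population μ n = 0 :=
    population_eq_zero_of_supportProj_le hsupp hn
  have hpopGibbs (n : ℕ) (hn : n ∉ M.rabiIndices (k + 1)) :
      population (M.rabiGibbs β (k + 1)) n = 0 := by
    rw [rabiGibbs, population_gibbs, gibbsWeight_of_notMem _ hn]
  obtain ⟨C, hC⟩ := hdecay (compression (M.rabiIndices (k + 1)) (A - c • 1))
    (compression_idem _ _) (by rw [hρ.expect_compression hpopGibbs, expect_centered hρ, sub_self])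
  have hcomm : Function.Commute (M.heisenberg β) (compression (M.rabiIndices (k + 1))) :=
    heisenberg_compression hξ β (k + 1)
  refine ⟨C, fun n => ?_⟩
  calc ‖expect ((M.rdm β)^[n] μ) A - c‖
      = ‖expect μ ((M.heisenberg β)^[n] (compression (M.rabiIndices (k + 1)) (A - c • 1)))‖ := by
        rw [hcomm.iterate_left n, hμ.expect_compression hpop, ← expect_rdm_iterate hξ β hμ,
          expect_centered (isState_rdm_iterate hξ β hμ n)]
    _ ≤ C * r ^ n := (hμ.norm_expect_le _).trans (hC n)
    _ = C * Real.exp (- -Real.log r * n) := by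
        rw [neg_neg, mul_comm (Real.log r), Real.exp_nat_mul, Real.exp_log hr0]

theorem finite_rabiIndices_of_finiteDimensional (h : FiniteDimensional ℂ (M.rabiSector k)) :
    (M.rabiIndices k).Finite := by
  have hket (n : M.rabiIndices k) : (ket (n : ℕ) : Field) ∈ M.rabiSector k :=
    ⟨ket n, proj_eq_self fun m hm => by rw [ket_apply, if_neg]; grind⟩
  have hindep : LinearIndependent ℂ
      fun n : M.rabiIndices k => (⟨ket n, hket n⟩ : M.rabiSector k) := by
    refine .of_comp (M.rabiSector k).subtype ?_
    exact orthonormal_ket.linearIndependent.comp _ Subtype.val_injective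
  have := hindep.finite
  exact Set.toFinite _

theorem nonempty_of_isState_rabiGibbs (h : IsState (M.rabiGibbs β k)) :
    (M.rabiIndices k).Nonempty := by
  obtain ⟨n, hn⟩ := h.exists_population_ne_zero
  refine ⟨n, not_imp_comm.1 (fun hmem => ?_) hn⟩
  rw [rabiGibbs, population_gibbs, gibbsWeight_of_notMem _ hmem]

end Maser

/-! ### Classification by resonances -/

namespace Maser

variable {M : Maser} {β : ℝ} {k r : ℕ}

theorem not_isDegenerate_of_finite (h : M.resonances.Finite) : ¬ M.IsDegenerate :=
  fun hdeg => hdeg.1 h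

theorem isErgodicState_iff (hE : M.E ≠ 0) (hξ : 0 < M.xi) (hM : ¬ M.IsDegenerate)
    (ρ : Field →L[ℂ] Field) :
    IsErgodicState (M.rdm β) ρ ↔ ∃ k, M.IsNormalizable β (k + 1) ∧
      (M.rabiIndices (k + 1)).Nonempty ∧ ρ = M.rabiGibbs β (k + 1) := by
  refine ⟨exists_eq_rabiGibbs_of_isErgodicState hE hξ hM, ?_⟩
  rintro ⟨k, hs, hI, rfl⟩
  exact isErgodicState_rabiGibbs hE hξ hs hI

theorem tendsto_cesaroMean_of_not_isDegenerate (hE : M.E ≠ 0) (hξ : 0 < M.xi)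
    (hM : ¬ M.IsDegenerate) (hs : ∀ k, M.IsNormalizable β (k + 1)) {ρ : Field →L[ℂ] Field}
    (hρ : IsState ρ) (A : Field →L[ℂ] Field) {ℓ : ℂ}
    (hℓ : HasSum (fun k : ℕ => expect ρ (M.rabiProj (k + 1)) *
      expect (M.rabiGibbs β (k + 1)) A) ℓ) :
    Tendsto (cesaroMean (M.rdm β) ρ A) atTop (𝓝 ℓ) := by
  rw [hℓ.unique (hasSum_expect_rabiProj_mul (fun _ => hs _) hρ A)]
  exact tendsto_cesaroMean hE hξ (J := Set.univ) (fun _ _ => hs _) (fun _ _ _ _ => Or.inr hM) hρ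
    (fun i hi => absurd (Set.mem_univ i) hi) A

theorem not_isNormalizable (hE : M.E ≠ 0) (hβ : β * M.E₀ ≤ 0)
    (hr : Set.Ici r ⊆ M.rabiIndices k) : ¬ M.IsNormalizable β k := by
  intro h
  have hratio : 1 ≤ M.atomRatio β := by
    rw [atomRatio, Real.one_le_exp_iff]
    linarith
  refine absurd (ge_of_tendsto h.tendsto_atTop_zero (b := 1) ?_) (by norm_num)
  filter_upwards [eventually_ge_atTop r] with n hn
  rw [boltzmann_betaStar hE, Set.indicator_of_mem (hr hn)]
  exact one_le_pow₀ hratio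

theorem rabiIndices_of_isNonResonant (h : M.IsNonResonant) (k : ℕ) :
    M.rabiIndices (k + 1) = if k = 0 then Set.univ else ∅ := by
  ext n
  have hindex : M.sectorIndex n = 0 := by
    rw [← M.sectorIndex_zero]
    refine (sectorIndex_eq_of_forall n.zero_le fun p _ _ hp => ?_).symm
    rwa [h] at hp
  rw [mem_rabiIndices, hindex]
  split_ifs with hk <;> simp [hk]

theorem sectorIndex_of_resonances_eq_singleton (h : M.resonances = {r}) (n : ℕ) :
    M.sectorIndex n = if r ≤ n then 1 else 0 := by
  have mem_iff (p : ℕ) : p ∈ M.resonances ↔ p = r := by rw [h, Set.mem_singleton_iff]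
  have hr : r ≠ 0 := fun hr => zero_notMem_resonances ((mem_iff 0).2 hr.symm)
  induction n with
  | zero => rw [sectorIndex_zero, if_neg (by omega)]
  | succ n ih =>
    classical
    rw [sectorIndex_succ, ih]
    simp only [mem_iff]
    grind

theorem rabiIndices_one_of_resonances_eq_singleton (h : M.resonances = {r}) :
    M.rabiIndices 1 = Set.Iio r := by
  ext n
  rw [mem_rabiIndices, sectorIndex_of_resonances_eq_singleton h, Set.mem_Iio]
  grind

theorem rabiIndices_two_of_resonances_eq_singleton (h : M.resonances = {r}) :
    M.rabiIndices 2 = Set.Ici r := by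
  ext n
  rw [mem_rabiIndices, sectorIndex_of_resonances_eq_singleton h, Set.mem_Ici]
  grind

theorem rabiIndices_eq_empty_of_resonances_eq_singleton (h : M.resonances = {r}) (hk : 2 ≤ k) :
    M.rabiIndices (k + 1) = ∅ := by
  refine Set.eq_empty_of_forall_notMem fun n hn => ?_
  rw [mem_rabiIndices, sectorIndex_of_resonances_eq_singleton h] at hn
  grind

theorem nonempty_rabiIndices_one : (M.rabiIndices 1).Nonempty :=
  ⟨0, mem_rabiIndices.2 (by rw [sectorIndex_zero])⟩

theorem exists_sectorIndex_eq (h : M.IsFullyResonant) (k : ℕ) : ∃ n, M.sectorIndex n = k := by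
  classical
  induction k with
  | zero => exact ⟨0, sectorIndex_zero⟩
  | succ k ih =>
    obtain ⟨n, rfl⟩ := ih
    have hex : ∃ p, p + 1 ∈ M.resonances ∧ n ≤ p := by
      obtain ⟨p, hp, hnp⟩ := h.exists_gt n
      obtain ⟨q, rfl⟩ := Nat.exists_eq_succ_of_ne_zero (Nat.ne_zero_of_lt hnp)
      exact ⟨q, hp, Nat.le_of_lt_succ hnp⟩
    obtain ⟨hmem, hle⟩ := Nat.find_spec hex
    refine ⟨Nat.find hex + 1, ?_⟩
    rw [sectorIndex_succ_of_mem hmem, ← sectorIndex_eq_of_forall hle fun p hnp hp hpmem => ?_]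
    obtain ⟨q, rfl⟩ := Nat.exists_eq_succ_of_ne_zero (Nat.ne_zero_of_lt hnp)
    exact Nat.find_min hex hp ⟨hpmem, Nat.le_of_lt_succ hnp⟩

theorem finite_rabiIndices (h : M.IsFullyResonant) (k : ℕ) : (M.rabiIndices k).Finite := by
  obtain ⟨N, hN⟩ := exists_sectorIndex_eq h k
  refine (Set.finite_Iio N).subset fun n hn => ?_
  by_contra hlt
  have := M.sectorIndex_mono (not_lt.1 hlt)
  rw [mem_rabiIndices] at hn
  omega

theorem nonempty_rabiIndices_of_isFullyResonant (h : M.IsFullyResonant) (hk : 1 ≤ k) :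
    (M.rabiIndices k).Nonempty := by
  obtain ⟨n, hn⟩ := exists_sectorIndex_eq h (k - 1)
  exact ⟨n, mem_rabiIndices.2 (by omega)⟩

/-! ### The dynamics in each resonance class -/

theorem not_exists_isInvariantState (hE : M.E ≠ 0) (hξ : 0 < M.xi) (h : M.IsNonResonant)
    (hβ : β * M.E₀ ≤ 0) : ¬ ∃ ρ, IsInvariantState (M.rdm β) ρ := by
  rintro ⟨ρ, hρ⟩
  obtain ⟨n, hn⟩ := hρ.1.exists_population_ne_zero
  have huniv : M.rabiIndices 1 = Set.univ := rabiIndices_of_isNonResonant h 0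
  have hindex : M.sectorIndex n + 1 = 1 := mem_rabiIndices.1 (huniv ▸ Set.mem_univ n)
  have hs := isNormalizable_of_population_ne_zero hE hξ hρ hn
  rw [hindex] at hs
  exact not_isNormalizable (r := 0) hE hβ (huniv ▸ Set.subset_univ _) hs

theorem gibbs_univ_eq_rabiGibbs (h : M.IsNonResonant) (β : ℝ) :
    M.gibbs (M.betaStar β) Set.univ = M.rabiGibbs β 1 := by
  rw [rabiGibbs, rabiIndices_of_isNonResonant h 0, if_pos rfl]

theorem isErgodicState_iff_of_isNonResonant (hE : M.E ≠ 0) (hξ : 0 < M.xi)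
    (h : M.IsNonResonant) (hβ : 0 < β * M.E₀) (ρ : Field →L[ℂ] Field) :
    IsErgodicState (M.rdm β) ρ ↔ ρ = M.gibbs (M.betaStar β) Set.univ := by
  have hM := not_isDegenerate_of_finite (h ▸ Set.finite_empty)
  rw [isErgodicState_iff hE hξ hM, gibbs_univ_eq_rabiGibbs h]
  constructor
  · rintro ⟨_ | k, -, hI, rfl⟩
    · rfl
    · simp [rabiIndices_of_isNonResonant h] at hI
  · rintro rfl
    exact ⟨0, isNormalizable_of_pos hE hβ 1, nonempty_rabiIndices_one, rfl⟩

theorem tendsto_cesaroMean_of_isNonResonant (hE : M.E ≠ 0) (hξ : 0 < M.xi)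
    (h : M.IsNonResonant) (hβ : 0 < β * M.E₀) {ρ : Field →L[ℂ] Field} (hρ : IsState ρ)
    (A : Field →L[ℂ] Field) :
    Tendsto (cesaroMean (M.rdm β) ρ A) atTop
      (𝓝 (expect (M.gibbs (M.betaStar β) Set.univ) A)) := by
  have hM := not_isDegenerate_of_finite (h ▸ Set.finite_empty)
  refine tendsto_cesaroMean_of_not_isDegenerate hE hξ hM
    (fun k => isNormalizable_of_pos hE hβ (k + 1)) hρ A ?_
  have hone : expect ρ (M.rabiProj 1) = 1 := by
    rw [rabiProj, expect_proj hρ, rabiIndices_of_isNonResonant h 0, if_pos rfl,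
      tsum_univ fun n => (population ρ n : ℂ), ← Complex.ofReal_tsum,
      hρ.hasSum_population.tsum_eq, Complex.ofReal_one]
  rw [gibbs_univ_eq_rabiGibbs h, ← one_mul (expect _ A), ← hone]
  refine hasSum_single 0 fun k hk => ?_
  rw [rabiProj, expect_proj hρ, rabiIndices_of_isNonResonant h, if_neg hk, tsum_empty, zero_mul]

theorem isErgodicState_iff_of_isSimplyResonant_of_nonpos (hE : M.E ≠ 0) (hξ : 0 < M.xi)
    (h : M.IsSimplyResonant) (hβ : β * M.E₀ ≤ 0) (ρ : Field →L[ℂ] Field) :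
    IsErgodicState (M.rdm β) ρ ↔ ρ = M.rabiGibbs β 1 := by
  obtain ⟨r, hr⟩ := h
  have hM := not_isDegenerate_of_finite (hr ▸ Set.finite_singleton r)
  have hfin : (M.rabiIndices 1).Finite :=
    rabiIndices_one_of_resonances_eq_singleton hr ▸ Set.finite_Iio r
  rw [isErgodicState_iff hE hξ hM]
  constructor
  · rintro ⟨_ | _ | k, hs, hI, rfl⟩
    · rfl
    · exact absurd hs
        (not_isNormalizable hE hβ (rabiIndices_two_of_resonances_eq_singleton hr).ge)
    · simp [rabiIndices_eq_empty_of_resonances_eq_singleton hr] at hI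
  · rintro rfl
    exact ⟨0, isNormalizable_of_finite hfin, nonempty_rabiIndices_one, rfl⟩

theorem isErgodicState_iff_of_isSimplyResonant_of_pos (hE : M.E ≠ 0) (hξ : 0 < M.xi)
    (h : M.IsSimplyResonant) (hβ : 0 < β * M.E₀) (ρ : Field →L[ℂ] Field) :
    IsErgodicState (M.rdm β) ρ ↔ ρ = M.rabiGibbs β 1 ∨ ρ = M.rabiGibbs β 2 := by
  obtain ⟨r, hr⟩ := h
  have hM := not_isDegenerate_of_finite (hr ▸ Set.finite_singleton r)
  have hs := isNormalizable_of_pos hE hβ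
  have hI : (M.rabiIndices 2).Nonempty :=
    rabiIndices_two_of_resonances_eq_singleton hr ▸ Set.nonempty_Ici
  rw [isErgodicState_iff hE hξ hM]
  constructor
  · rintro ⟨_ | _ | k, -, hI, rfl⟩
    · exact Or.inl rfl
    · exact Or.inr rfl
    · simp [rabiIndices_eq_empty_of_resonances_eq_singleton hr] at hI
  · rintro (rfl | rfl)
    · exact ⟨0, hs 1, nonempty_rabiIndices_one, rfl⟩
    · exact ⟨1, hs 2, hI, rfl⟩

theorem tendsto_cesaroMean_of_isSimplyResonant (hE : M.E ≠ 0) (hξ : 0 < M.xi)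
    (h : M.IsSimplyResonant) (hβ : 0 < β * M.E₀) {ρ : Field →L[ℂ] Field} (hρ : IsState ρ)
    (A : Field →L[ℂ] Field) :
    Tendsto (cesaroMean (M.rdm β) ρ A) atTop
      (𝓝 (expect ρ (M.rabiProj 1) * expect (M.rabiGibbs β 1) A +
        expect ρ (M.rabiProj 2) * expect (M.rabiGibbs β 2) A)) := by
  obtain ⟨r, hr⟩ := h
  have hM := not_isDegenerate_of_finite (hr ▸ Set.finite_singleton r)
  refine tendsto_cesaroMean_of_not_isDegenerate hE hξ hM
    (fun k => isNormalizable_of_pos hE hβ (k + 1)) hρ A ?_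
  have hzero (k : ℕ) (hk : k ∉ Finset.range 2) :
      expect ρ (M.rabiProj (k + 1)) * expect (M.rabiGibbs β (k + 1)) A = 0 := by
    have hk2 : 2 ≤ k := not_lt.1 (mt Finset.mem_range.2 hk)
    rw [rabiProj, expect_proj hρ, rabiIndices_eq_empty_of_resonances_eq_singleton hr hk2,
      tsum_empty, zero_mul]
  simpa only [Finset.sum_range_succ, Finset.sum_range_zero, zero_add] using
    hasSum_sum_of_ne_finset_zero hzero

theorem exists_hasSum_tendsto_cesaroMean (hE : M.E ≠ 0) (hξ : 0 < M.xi)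
    (h : M.IsFullyResonant) (hM : ¬ M.IsDegenerate) (β : ℝ) {ρ : Field →L[ℂ] Field}
    (hρ : IsState ρ) (A : Field →L[ℂ] Field) :
    ∃ ℓ : ℂ, HasSum (fun k : ℕ => expect ρ (M.rabiProj (k + 1)) *
      expect (M.rabiGibbs β (k + 1)) A) ℓ ∧
      Tendsto (cesaroMean (M.rdm β) ρ A) atTop (𝓝 ℓ) := by
  have hs (k : ℕ) : M.IsNormalizable β k := isNormalizable_of_finite (finite_rabiIndices h k)
  have hsum := hasSum_expect_rabiProj_mul (fun _ => hs _) hρ A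
  exact ⟨_, hsum, tendsto_cesaroMean_of_not_isDegenerate hE hξ hM (fun _ => hs _) hρ A hsum⟩

theorem exists_hasSum_smul_rabiGibbs (hE : M.E ≠ 0) (hξ : 0 < M.xi) (hM : ¬ M.IsDegenerate)
    {ρ : Field →L[ℂ] Field} (hρ : IsInvariantState (M.rdm β) ρ) :
    ∃ c : ℕ → ℝ, (∀ k, 0 ≤ c k) ∧ HasSum c 1 ∧
      (∀ k, c k ≠ 0 → IsErgodicState (M.rdm β) (M.rabiGibbs β (k + 1))) ∧
      HasSum (fun k => (c k : ℂ) • M.rabiGibbs β (k + 1)) ρ := by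
  refine ⟨M.sectorWeight ρ, sectorWeight_nonneg hρ.1, M.hasSum_sectorWeight hρ.1, fun k hk => ?_,
    hasSum_sectorWeight_smul_rabiGibbs hE hξ hM hρ⟩
  obtain ⟨hs, hI⟩ := isNormalizable_of_sectorWeight_ne_zero hE hξ hρ hk
  exact isErgodicState_rabiGibbs hE hξ hs hI

theorem isExpMixingState_of_finiteDimensional (hE : M.E ≠ 0) (hξ : 0 < M.xi) (hk : 1 ≤ k)
    (hρ : IsErgodicState (M.rdm β) (M.rabiGibbs β k))
    (hfin : FiniteDimensional ℂ (M.rabiSector k)) :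
    IsExpMixingState (M.rdm β) (M.rabiGibbs β k) := by
  obtain ⟨k, rfl⟩ := Nat.exists_eq_add_of_le' hk
  exact isExpMixingState_rabiGibbs hE hξ β (finite_rabiIndices_of_finiteDimensional hfin)
    (nonempty_of_isState_rabiGibbs hρ.1)

end Maser

end OneAtomMaser

end

open OneAtomMaser Maser Filter Topology in
theorem mainTheorem7_general (M : Maser) (hE : M.E ≠ 0) (hcoupling : M.coupling ≠ 0)
    (hτ : M.τ ≠ 0) (β : ℝ) :
    (M.IsNonResonant →
      (β * M.E₀ ≤ 0 → ¬ ∃ ρ, IsInvariantState (M.rdm β) ρ) ∧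
      (0 < β * M.E₀ →
        (∀ ρ, IsErgodicState (M.rdm β) ρ ↔ ρ = M.gibbs (M.betaStar β) Set.univ) ∧
        ∀ ρ, IsState ρ → ∀ A : Field →L[ℂ] Field,
          Tendsto (cesaroMean (M.rdm β) ρ A) atTop
            (𝓝 (expect (M.gibbs (M.betaStar β) Set.univ) A)))) ∧
    (M.IsSimplyResonant →
      (β * M.E₀ ≤ 0 → ∀ ρ, IsErgodicState (M.rdm β) ρ ↔ ρ = M.rabiGibbs β 1) ∧
      (0 < β * M.E₀ →
        (∀ ρ, IsErgodicState (M.rdm β) ρ ↔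
          (ρ = M.rabiGibbs β 1 ∨ ρ = M.rabiGibbs β 2)) ∧
        M.rabiGibbs β 1 ≠ M.rabiGibbs β 2 ∧
        ∀ ρ, IsState ρ → ∀ A : Field →L[ℂ] Field,
          Tendsto (cesaroMean (M.rdm β) ρ A) atTop
            (𝓝 (expect ρ (M.rabiProj 1) * expect (M.rabiGibbs β 1) A +
              expect ρ (M.rabiProj 2) * expect (M.rabiGibbs β 2) A)))) ∧
    (M.IsFullyResonant →
      (∀ k, 1 ≤ k → IsErgodicState (M.rdm β) (M.rabiGibbs β k)) ∧
      (∀ k l, 1 ≤ k → 1 ≤ l → k ≠ l → M.rabiGibbs β k ≠ M.rabiGibbs β l) ∧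
      (¬ M.IsDegenerate →
        ∀ ρ, IsState ρ → ∀ A : Field →L[ℂ] Field,
          ∃ ℓ : ℂ,
            HasSum (fun k : ℕ => expect ρ (M.rabiProj (k + 1)) *
              expect (M.rabiGibbs β (k + 1)) A) ℓ ∧
            Tendsto (cesaroMean (M.rdm β) ρ A) atTop (𝓝 ℓ))) ∧
    (¬ M.IsDegenerate → ∀ ρ, IsInvariantState (M.rdm β) ρ →
      IsDiagonal ρ ∧
      ∃ c : ℕ → ℝ, (∀ k, 0 ≤ c k) ∧ HasSum c 1 ∧
        (∀ k, c k ≠ 0 → IsErgodicState (M.rdm β) (M.rabiGibbs β (k + 1))) ∧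
        HasSum (fun k => (c k : ℂ) • M.rabiGibbs β (k + 1)) ρ) ∧
    (∀ k, 1 ≤ k → IsErgodicState (M.rdm β) (M.rabiGibbs β k) →
      FiniteDimensional ℂ (M.rabiSector k) →
      IsExpMixingState (M.rdm β) (M.rabiGibbs β k)) := by
  have hξ := xi_pos hcoupling hτ
  refine ⟨fun h => ⟨not_exists_isInvariantState hE hξ h, fun hβ => ⟨?_, fun _ hρ A => ?_⟩⟩,
    fun h => ⟨isErgodicState_iff_of_isSimplyResonant_of_nonpos hE hξ h,
      fun hβ => ⟨?_, ?_, fun _ hρ A => ?_⟩⟩,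
    fun h => ⟨fun k hk => ?_, fun k l hk _ hkl => ?_, fun hM _ hρ A => ?_⟩,
    fun hM ρ hρ => ⟨fun m n hmn => ?_, exists_hasSum_smul_rabiGibbs hE hξ hM hρ⟩,
    fun k hk => isExpMixingState_of_finiteDimensional hE hξ hk⟩
  · exact isErgodicState_iff_of_isNonResonant hE hξ h hβ
  · exact tendsto_cesaroMean_of_isNonResonant hE hξ h hβ hρ A
  · exact isErgodicState_iff_of_isSimplyResonant_of_pos hE hξ h hβ
  · exact rabiGibbs_ne (isNormalizable_of_pos hE hβ 1) nonempty_rabiIndices_one (by decide)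
  · exact tendsto_cesaroMean_of_isSimplyResonant hE hξ h hβ hρ A
  · exact isErgodicState_rabiGibbs hE hξ (isNormalizable_of_finite (finite_rabiIndices h k))
      (nonempty_rabiIndices_of_isFullyResonant h hk)
  · exact rabiGibbs_ne (isNormalizable_of_finite (finite_rabiIndices h k))
      (nonempty_rabiIndices_of_isFullyResonant h hk) hkl
  · exact exists_hasSum_tendsto_cesaroMean hE hξ h hM β hρ A
  · rw [inner_ket_left, entry_eq_zero_of_isInvariantState hξ hM hρ hmn]

theorem mainTheorem7 (M : OneAtomMaser.Maser) (hE : 0 < M.E) (hE₀ : 0 < M.E₀)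
    (hcoupling : M.coupling ≠ 0) (hτ : 0 < M.τ) (β : ℝ) :
    -- 1. non-resonant systems
    (M.IsNonResonant →
      (β ≤ 0 → ¬ ∃ ρ, OneAtomMaser.IsInvariantState (M.rdm β) ρ) ∧
      (0 < β →
        (∀ ρ, OneAtomMaser.IsErgodicState (M.rdm β) ρ ↔ ρ = M.gibbs (M.betaStar β) Set.univ) ∧
        ∀ ρ, OneAtomMaser.IsState ρ → ∀ A : OneAtomMaser.Field →L[ℂ] OneAtomMaser.Field,
          Filter.Tendsto (OneAtomMaser.cesaroMean (M.rdm β) ρ A) Filter.atTop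
            (nhds (OneAtomMaser.expect (M.gibbs (M.betaStar β) Set.univ) A)))) ∧
    -- 2. simply resonant systems
    (M.IsSimplyResonant →
      (β ≤ 0 → ∀ ρ, OneAtomMaser.IsErgodicState (M.rdm β) ρ ↔ ρ = M.rabiGibbs β 1) ∧
      (0 < β →
        (∀ ρ, OneAtomMaser.IsErgodicState (M.rdm β) ρ ↔
          (ρ = M.rabiGibbs β 1 ∨ ρ = M.rabiGibbs β 2)) ∧
        M.rabiGibbs β 1 ≠ M.rabiGibbs β 2 ∧
        ∀ ρ, OneAtomMaser.IsState ρ → ∀ A : OneAtomMaser.Field →L[ℂ] OneAtomMaser.Field,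
          Filter.Tendsto (OneAtomMaser.cesaroMean (M.rdm β) ρ A) Filter.atTop
            (nhds (OneAtomMaser.expect ρ (M.rabiProj 1) * OneAtomMaser.expect (M.rabiGibbs β 1) A +
              OneAtomMaser.expect ρ (M.rabiProj 2) *
                OneAtomMaser.expect (M.rabiGibbs β 2) A)))) ∧
    -- 3. fully resonant systems
    (M.IsFullyResonant →
      (∀ k, 1 ≤ k → OneAtomMaser.IsErgodicState (M.rdm β) (M.rabiGibbs β k)) ∧
      (∀ k l, 1 ≤ k → 1 ≤ l → k ≠ l → M.rabiGibbs β k ≠ M.rabiGibbs β l) ∧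
      (¬ M.IsDegenerate →
        ∀ ρ, OneAtomMaser.IsState ρ → ∀ A : OneAtomMaser.Field →L[ℂ] OneAtomMaser.Field,
          ∃ ℓ : ℂ,
            HasSum (fun k : ℕ => OneAtomMaser.expect ρ (M.rabiProj (k + 1)) *
              OneAtomMaser.expect (M.rabiGibbs β (k + 1)) A) ℓ ∧
            Filter.Tendsto (OneAtomMaser.cesaroMean (M.rdm β) ρ A) Filter.atTop (nhds ℓ))) ∧
    -- 4. invariant states of non-degenerate systems
    (¬ M.IsDegenerate → ∀ ρ, OneAtomMaser.IsInvariantState (M.rdm β) ρ →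
      OneAtomMaser.IsDiagonal ρ ∧
      ∃ c : ℕ → ℝ, (∀ k, 0 ≤ c k) ∧ HasSum c 1 ∧
        (∀ k, c k ≠ 0 → OneAtomMaser.IsErgodicState (M.rdm β) (M.rabiGibbs β (k + 1))) ∧
        HasSum (fun k => (c k : ℂ) • M.rabiGibbs β (k + 1)) ρ) ∧
    -- 5. exponential mixing in finite-dimensional sectors
    (∀ k, 1 ≤ k → OneAtomMaser.IsErgodicState (M.rdm β) (M.rabiGibbs β k) →
      FiniteDimensional ℂ (M.rabiSector k) →
      OneAtomMaser.IsExpMixingState (M.rdm β) (M.rabiGibbs β k)) := by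
  simpa only [← not_lt, mul_pos_iff_of_pos_right hE₀] using
    mainTheorem7_general M hE.ne' hcoupling hτ.ne' β
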